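/- **Setting.** Let $R=\mathbb C[x]$ and let $W\in R$ be such that $R/(W')$ is finite-dimensional over $\mathbb C$. "Bimodule" means $R$-$R$-bimodule with equal left and right $\mathbb C$-action, i.e. $R\otimes_{\mathbb C}R$-module. A *bi-factorisation* of $W$ is a pair of bimodules $X_0,X_1$ with bimodule maps $d_0:X_0\to X_1$, $d_1:X_1\to X_0$ such that $d_1d_0$ and $d_0d_1$ are the maps $m\mapsto W.m-m.W$. A morphism $\varphi=(\varphi_0,\varphi_1):X\to Y$ is a pair of bimodule maps $\varphi_i:X_i\to Y_i$ commuting with the differentials, modulo homotopy ($\varphi\sim\varphi'$ iff $\varphi_0-\varphi_0'=d_1\psi_0+\psi_1d_0$ and $\varphi_1-\varphi_1'=d_0\psi_1+\psi_0d_1$ for bimodule maps $\psi_0:X_0\to Y_1$, $\psi_1:X_1\to Y_0$). $\mathrm{MF}_{\mathrm{bi}}(W)$ is the category of those bi-factorisations that are homotopy equivalent to one by free bimodules of finite rank. *Tensor product.* $(X\otimes Y)_0=X_0\otimes_RY_0\oplus X_1\otimes_RY_1$, $(X\otimes Y)_1=X_1\otimes_RY_0\oplus X_0\otimes_RY_1$,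 with differential $d_X\otimes 1+(-1)^{|\cdot|}1\otimes d_Y$; on morphisms it is componentwise; the associator $\alpha$ is rebracketing. *Unit.* Write $a=x\otimes1$, $b=1\otimes x$; $I_0=I_1=R\otimes_{\mathbb C}R$, $d_1=a-b$, $d_0=\frac{W(a)-W(b)}{a-b}$. The unitors $\lambda_X:I\otimes X\to X$ and $\rho_X:X\otimes I\to X$ are induced by multiplication $\mu:R\otimes_{\mathbb C} R\to R$ on the summands with $I_0$ and vanish on the summands with $I_1$. *Duals.* $M^\vee=\mathrm{Hom}_{R\text{-}R}(M,R\otimes_{\mathbb C} R)$ with $(s.\phi.r)(m)=\phi(r.m.s)$, and $f^\vee(\phi)=\phi\circ f$. $X^\vee=(X_1^\vee,X_0^\vee)$ with $d_0^{X^\vee}=(d_0)^\vee$, $d_1^{X^\vee}=-(d_1)^\vee$, and $\varphi^\vee=(\varphi_1^\vee,\varphi_0^\vee):Y^\vee\to X^\vee$. With $\sigma$ the exchange of the factors of $R\otimes_{\mathbb C} R$, let $\delta_M:M\to M^{\vee\vee}$, $\delta_M(m)(\phi)=\sigma(\phi(m))$, and $\delta_X=(\delta_{X_0},\delta_{X_1}):X\to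 X^{\vee\vee}$. *Coevaluation and evaluation of matrix objects.* Let $Z$ be given by matrices $D_0,D_1$ on free bimodules with standard bases $(e_i)$ and dual bases $(e_i^*)$. Let $\mathrm{coev}_Z:I\to Z\otimes Z^\vee$ be the even map with $$1\in I_1\mapsto\Big(\sum_l e_l\otimes e_l^*,\ \sum_m e_m\otimes e_m^*\Big)\in Z_1\otimes_R Z_1^\vee\oplus Z_0\otimes_R Z_0^\vee,$$ $$1\in I_0\mapsto\Big(\sum_{m,l}\tfrac{(D_1)_{ml}(a,x)-(D_1)_{ml}(b,x)}{a-b}\,e_m\otimes e_l^*,\ \sum_{m,l}\tfrac{(D_0)_{ml}(a,x)-(D_0)_{ml}(b,x)}{a-b}\,e_m\otimes e_l^*\Big)\in Z_0\otimes_R Z_1^\vee\oplus Z_1\otimes_R Z_0^\vee,$$ where $a$, $x$, $b$ act on the left, in the middle and on the right. For $\phi\in Z_i^\vee$, $z\in Z_i$ put $\langle\phi,z\rangle=\sum_j\phi(e_j)(x,a)\,z_j(x,b)\in\mathbb C[a,b][x]$ and $$F(p)=\frac1{2\pi i}\oint\frac{(a-b-x)\,p(x)}{x\,(W(x)-W(b))}\,dx$$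 (over a contour around all poles). Let $\mathrm{ev}_Z:Z^\vee\otimes Z\to I$ be the even map $$\phi\otimes z\mapsto -F(\langle\phi,D_0z\rangle)\ \text{ on } Z_1^\vee\otimes_R Z_0,\qquad 0\ \text{ on } Z_0^\vee\otimes_R Z_1,$$ $$\phi\otimes z\mapsto\frac{F(\langle\phi\circ D_1,D_0z\rangle)}{a-b}\ \text{ on } Z_0^\vee\otimes_R Z_0,\qquad -\langle\phi,z\rangle|_{x=0}\ \text{ on } Z_1^\vee\otimes_R Z_1 .$$ **Theorem.** (1) $\mathrm{MF}_{\mathrm{bi}}(W)$ is closed under $\otimes$, all $\lambda_X,\rho_X$ are isomorphisms in it, and with $\otimes,I,\alpha,\lambda,\rho$ it is a monoidal category. (2) For all $X$ there are $\mathrm{coev}_X:I\to X\otimes X^\vee$ and $\mathrm{ev}_X:X^\vee\otimes X\to I$ that satisfy both Zorro (zig-zag) identities, such that for every matrix object $Z$ and every isomorphism $\vartheta:X\to Z$ in $\mathrm{MF}_{\mathrm{bi}}(W)$, the maps $\mathrm{coev}_Z,\mathrm{ev}_Z$ above are morphisms and $\mathrm{coev}_X=(\vartheta^{-1}\otimes\vartheta^\vee)\circ\mathrm{coev}_Z$,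 $\mathrm{ev}_X=\mathrm{ev}_Z\circ((\vartheta^{-1})^\vee\otimes\vartheta)$. So the category is right rigid; and the dual of a morphism defined through these maps, $$\lambda_{X^\vee}\circ(\mathrm{ev}_Y\otimes \mathrm{id})\circ\alpha^{-1}\circ(\mathrm{id}\otimes(\varphi\otimes \mathrm{id}))\circ(\mathrm{id}\otimes\mathrm{coev}_X)\circ\rho_{Y^\vee}^{-1},$$ is the componentwise $\varphi^\vee$. (3) $\delta$ is a pivotal structure on this right rigid monoidal category. That is, let $\nu^0=\lambda_{I^\vee}\circ\mathrm{coev}_I:I\to I^\vee$, let $\nu^2_{X,Y}:X^\vee\otimes Y^\vee\to(Y\otimes X)^\vee$ be the isomorphism obtained from $\mathrm{coev}_{Y\otimes X}$ by contracting with $\mathrm{ev}_Y$ and then with $\mathrm{ev}_X$, and let $\omega^0=((\nu^0)^{-1})^\vee\circ\nu^0$, $\omega^2_{X,Y}=((\nu^2_{Y,X})^{-1})^\vee\circ\nu^2_{X^\vee,Y^\vee}$. Then each $\delta_X$ is an isomorphism in $\mathrm{MF}_{\mathrm{bi}}(W)$, $\varphi^{\vee\vee}\circ\delta_X=\delta_Y\circ\varphi$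 for all $\varphi:X\to Y$, $\omega^2_{X,Y}\circ(\delta_X\otimes\delta_Y)=\delta_{X\otimes Y}$ for all $X,Y$, and $\delta_I=\omega^0$. Hence $\mathrm{MF}_{\mathrm{bi}}(W)$ is a pivotal category. -/

import Mathlib

open CategoryTheory MonoidalCategory
open scoped Polynomial TensorProduct

noncomputable section

namespace MFBi

/-- The enveloping algebra `R ⊗ R` of `R = ℂ[x]`. An `R`-bimodule (with both actions restricting to
the same `ℂ`-action) is the same thing as a `Bi`-module: `r ⊗ s` acts by `m ↦ r.m.s`.
We write `a = x ⊗ 1` and `b = 1 ⊗ x`. -/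
def Bi : Type := ℂ[X] ⊗[ℂ] ℂ[X]

instance : CommRing Bi := inferInstanceAs (CommRing (ℂ[X] ⊗[ℂ] ℂ[X]))

instance : Algebra ℂ Bi := inferInstanceAs (Algebra ℂ (ℂ[X] ⊗[ℂ] ℂ[X]))

/-- `r ↦ r ⊗ 1`, the left action of `R` -/
def inl : ℂ[X] →ₐ[ℂ] Bi :=
  (Algebra.TensorProduct.includeLeft : ℂ[X] →ₐ[ℂ] ℂ[X] ⊗[ℂ] ℂ[X])

/-- `r ↦ 1 ⊗ r`, the right action of `R` -/
def inr : ℂ[X] →ₐ[ℂ] Bi :=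
  (Algebra.TensorProduct.includeRight : ℂ[X] →ₐ[ℂ] ℂ[X] ⊗[ℂ] ℂ[X])

theorem inl_mul_inr (r s : ℂ[X]) : inl r * inr s = (r ⊗ₜ[ℂ] s : ℂ[X] ⊗[ℂ] ℂ[X]) := by
  refine (Algebra.TensorProduct.tmul_mul_tmul (R := ℂ) r 1 1 s).trans ?_
  rw [mul_one, one_mul]

theorem Bi.induction {p : Bi → Prop} (h1 : ∀ r s, p (inl r * inr s))
    (h2 : ∀ u v, p u → p v → p (u + v)) (u : Bi) : p u :=
  TensorProduct.induction_on (R := ℂ) (M := ℂ[X]) (N := ℂ[X]) (motive := p) u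
    (by have h := h1 0 0; rw [map_zero, zero_mul] at h; exact h) (fun r s => inl_mul_inr r s ▸ h1 r s) h2

/-- The algebra map `R ⊗ R → S` with `r ⊗ s ↦ f(r) g(s)`. -/
def Bi.lift {S : Type} [CommRing S] [Algebra ℂ S] (f g : ℂ[X] →ₐ[ℂ] S) : Bi →ₐ[ℂ] S :=
  (Algebra.TensorProduct.productMap f g : ℂ[X] ⊗[ℂ] ℂ[X] →ₐ[ℂ] S)

@[simp] theorem Bi.lift_inl {S : Type} [CommRing S] [Algebra ℂ S] (f g : ℂ[X] →ₐ[ℂ] S) (r : ℂ[X]) :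
    Bi.lift f g (inl r) = f r :=
  Algebra.TensorProduct.productMap_left_apply f g r

@[simp] theorem Bi.lift_inr {S : Type} [CommRing S] [Algebra ℂ S] (f g : ℂ[X] →ₐ[ℂ] S) (r : ℂ[X]) :
    Bi.lift f g (inr r) = g r :=
  Algebra.TensorProduct.productMap_right_apply f g r

/-- A map that is additive in each argument, as a bundled biadditive map. -/
def mkBi {M N P : Type} [AddCommGroup M] [AddCommGroup N] [AddCommGroup P] (f : M → N → P)
    (h1 : ∀ m m' n, f (m + m') n = f m n + f m' n)
    (h2 : ∀ m n n', f m (n + n') = f m n + f m n') : M →+ N →+ P :=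
  AddMonoidHom.mk' (fun m => AddMonoidHom.mk' (f m) (h2 m)) (fun m m' => by ext n; exact h1 m m' n)

@[simp] theorem mkBi_apply {M N P : Type} [AddCommGroup M] [AddCommGroup N] [AddCommGroup P]
    (f : M → N → P) (h1 : ∀ m m' n, f (m + m') n = f m n + f m' n)
    (h2 : ∀ m n n', f m (n + n') = f m n + f m n') (m : M) (n : N) :
    mkBi f h1 h2 m n = f m n := rfl

/-! ### The tensor product of bimodules over `R` -/

/-- The right `R`-module underlying a bimodule. -/
def RightRes (M : Type) : Type := M

/-- The left `R`-module underlying a bimodule. -/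
def LeftRes (M : Type) : Type := M

section Tensor

variable (M N : Type) [AddCommGroup M] [Module Bi M] [AddCommGroup N] [Module Bi N]

instance : AddCommGroup (RightRes M) := inferInstanceAs (AddCommGroup M)
instance : AddCommGroup (LeftRes M) := inferInstanceAs (AddCommGroup M)
instance : Module Bi (RightRes M) := inferInstanceAs (Module Bi M)
instance : Module Bi (LeftRes M) := inferInstanceAs (Module Bi M)

instance : Module ℂ[X] (RightRes M) :=
  Module.compHom (RightRes M)
    inr.toRingHom

instance : Module ℂ[X] (LeftRes M) :=
  Module.compHom (LeftRes M)
    inl.toRingHom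

/-- `M ⊗_R N`: the right action of `R` on `M` is identified with its left action on `N`. -/
def BT : Type := RightRes M ⊗[ℂ[X]] LeftRes N

instance : AddCommGroup (BT M N) := inferInstanceAs (AddCommGroup (RightRes M ⊗[ℂ[X]] LeftRes N))

variable {M N}

/-- the pure tensor `m ⊗_R n` -/
def bt (m : M) (n : N) : BT M N := TensorProduct.tmul ℂ[X] (show RightRes M from m) (show LeftRes N from n)

theorem bt_add_left (m m' : M) (n : N) : bt (m + m') n = bt m n + bt m' n :=
  TensorProduct.add_tmul (R := ℂ[X]) (M := RightRes M) (N := LeftRes N) m m' n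

theorem bt_add_right (m : M) (n n' : N) : bt m (n + n') = bt m n + bt m n' :=
  TensorProduct.tmul_add (R := ℂ[X]) (M := RightRes M) (N := LeftRes N) m n n'

theorem bt_zero_left (n : N) : bt (0 : M) n = 0 :=
  TensorProduct.zero_tmul (R := ℂ[X]) (RightRes M) (N := LeftRes N) n

theorem bt_zero_right (m : M) : bt m (0 : N) = 0 :=
  TensorProduct.tmul_zero (R := ℂ[X]) (M := RightRes M) (LeftRes N) m

theorem bt_balanced (r : ℂ[X]) (m : M) (n : N) : bt (inr r • m) n = bt m (inl r • n) :=
  TensorProduct.smul_tmul (R := ℂ[X]) (M := RightRes M) (N := LeftRes N) r m n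

theorem BT.induction {p : BT M N → Prop} (h0 : p 0) (h1 : ∀ m n, p (bt m n))
    (h2 : ∀ s t, p s → p t → p (s + t)) (t : BT M N) : p t :=
  TensorProduct.induction_on (R := ℂ[X]) (M := RightRes M) (N := LeftRes N) t h0 h1 h2

/-- The universal property of `M ⊗_R N` for balanced biadditive maps. -/
def BT.liftAdd {P : Type} [AddCommGroup P] (f : M →+ N →+ P)
    (hf : ∀ (r : ℂ[X]) (m : M) (n : N), f (inr r • m) n = f m (inl r • n)) : BT M N →+ P :=
  TensorProduct.liftAddHom (R := ℂ[X]) (M := RightRes M) (N := LeftRes N) f hf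

@[simp] theorem BT.liftAdd_bt {P : Type} [AddCommGroup P] (f : M →+ N →+ P)
    (hf : ∀ (r : ℂ[X]) (m : M) (n : N), f (inr r • m) n = f m (inl r • n)) (m : M) (n : N) :
    BT.liftAdd f hf (bt m n) = f m n := rfl

theorem BT.addHom_ext {P : Type} [AddCommGroup P] {f g : BT M N →+ P}
    (h : ∀ m n, f (bt m n) = g (bt m n)) : f = g := by
  ext t
  induction t using BT.induction with
  | h0 => simp
  | h1 m n => exact h m n
  | h2 s t hs ht => simp [hs, ht]

variable (M N)

/-- The left action of `R` on `M ⊗_R N`, through `M`. -/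
def BT.leftAct : ℂ[X] →+* AddMonoid.End (BT M N) where
  toFun r := BT.liftAdd
    (mkBi (fun m n => bt (inl r • m) n) (fun m m' n => by rw [smul_add, bt_add_left])
      (fun m n n' => bt_add_right _ n n'))
    (fun s m n => by
      simp only [mkBi_apply]
      rw [← bt_balanced, smul_smul, smul_smul, mul_comm])
  map_one' := BT.addHom_ext fun m n => by
    show bt (inl 1 • m) n = bt m n
    rw [map_one, one_smul]
  map_mul' r s := BT.addHom_ext fun m n => by
    show bt (inl (r * s) • m) n = bt (inl r • inl s • m) n
    rw [smul_smul, map_mul]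
  map_zero' := BT.addHom_ext fun m n => by
    show bt (inl 0 • m) n = 0
    rw [map_zero, zero_smul, bt_zero_left]
  map_add' r s := BT.addHom_ext fun m n => by
    show bt (inl (r + s) • m) n = bt (inl r • m) n + bt (inl s • m) n
    rw [← bt_add_left, ← add_smul, map_add]

/-- The right action of `R` on `M ⊗_R N`, through `N`. -/
def BT.rightAct : ℂ[X] →+* AddMonoid.End (BT M N) where
  toFun r := BT.liftAdd
    (mkBi (fun m n => bt m (inr r • n)) (fun m m' n => bt_add_left m m' _)
      (fun m n n' => by rw [smul_add, bt_add_right]))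
    (fun s m n => by
      simp only [mkBi_apply]
      rw [bt_balanced, smul_smul, smul_smul, mul_comm])
  map_one' := BT.addHom_ext fun m n => by
    show bt m (inr 1 • n) = bt m n
    rw [map_one, one_smul]
  map_mul' r s := BT.addHom_ext fun m n => by
    show bt m (inr (r * s) • n) = bt m (inr r • inr s • n)
    rw [smul_smul, map_mul]
  map_zero' := BT.addHom_ext fun m n => by
    show bt m (inr 0 • n) = 0
    rw [map_zero, zero_smul, bt_zero_right]
  map_add' r s := BT.addHom_ext fun m n => by
    show bt m (inr (r + s) • n) = bt m (inr r • n) + bt m (inr s • n)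
    rw [← bt_add_right, ← add_smul, map_add]

theorem BT.leftAct_bt (r : ℂ[X]) (m : M) (n : N) :
    BT.leftAct M N r (bt m n) = bt (inl r • m) n := rfl

theorem BT.rightAct_bt (r : ℂ[X]) (m : M) (n : N) :
    BT.rightAct M N r (bt m n) = bt m (inr r • n) := rfl

theorem BT.act_comm (r s : ℂ[X]) :
    BT.leftAct M N r * BT.rightAct M N s = BT.rightAct M N s * BT.leftAct M N r :=
  BT.addHom_ext fun _ _ => rfl

theorem inl_C (c : ℂ) : inl (Polynomial.C c) = inr (Polynomial.C c) :=
  (inl.commutes c).trans (inr.commutes c).symm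

theorem BT.act_C (c : ℂ) :
    BT.leftAct M N (Polynomial.C c) = BT.rightAct M N (Polynomial.C c) :=
  BT.addHom_ext fun m n => by
    show bt (inl (Polynomial.C c) • m) n = bt m (inr (Polynomial.C c) • n)
    rw [inl_C, bt_balanced, inl_C]

/-- `r ⊗ s ↦ (m ⊗ n ↦ r.m ⊗ n.s)` -/
def BT.actAdd : Bi →+ AddMonoid.End (BT M N) :=
  (TensorProduct.liftAddHom (R := ℂ) (M := ℂ[X]) (N := ℂ[X])
    ((AddMonoidHom.mul (R := AddMonoid.End (BT M N))).compl₂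
        (BT.rightAct M N).toAddMonoidHom |>.comp (BT.leftAct M N).toAddMonoidHom)
    (fun c r s => by
      show BT.leftAct M N (c • r) * BT.rightAct M N s = BT.leftAct M N r * BT.rightAct M N (c • s)
      rw [Polynomial.smul_eq_C_mul, Polynomial.smul_eq_C_mul, mul_comm, map_mul, map_mul,
        BT.act_C, mul_assoc]) : ℂ[X] ⊗[ℂ] ℂ[X] →+ AddMonoid.End (BT M N))

theorem BT.actAdd_apply (r s : ℂ[X]) :
    BT.actAdd M N (inl r * inr s) = BT.leftAct M N r * BT.rightAct M N s := by
  rw [inl_mul_inr]; rfl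

/-- The bimodule structure of `M ⊗_R N`: `r ⊗ s` acts by `m ⊗ n ↦ r.m ⊗ n.s`. -/
def BT.act : Bi →+* AddMonoid.End (BT M N) where
  toFun := BT.actAdd M N
  map_zero' := map_zero _
  map_add' := map_add _
  map_one' := by
    have h := BT.actAdd_apply M N 1 1
    rw [map_one, map_one, one_mul] at h
    rw [h, map_one, map_one, one_mul]
  map_mul' u v := by
    induction u using Bi.induction with
    | h2 u u' hu hu' => rw [add_mul, map_add, map_add, hu, hu', add_mul]
    | h1 r s =>
      induction v using Bi.induction with
      | h2 v v' hv hv' => rw [mul_add, map_add, map_add, hv, hv', mul_add]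
      | h1 r' s' =>
        rw [mul_mul_mul_comm, ← map_mul, ← map_mul, BT.actAdd_apply, BT.actAdd_apply,
          BT.actAdd_apply, map_mul, map_mul, mul_assoc, mul_assoc, ← mul_assoc (BT.leftAct M N r'),
          BT.act_comm M N r' s, mul_assoc]

instance : Module Bi (BT M N) := Module.compHom (BT M N) (BT.act M N)

variable {M N}

theorem smul_bt (r s : ℂ[X]) (m : M) (n : N) :
    (inl r * inr s) • bt m n = bt (inl r • m) (inr s • n) :=
  DFunLike.congr_fun (BT.actAdd_apply M N r s) (bt m n)

theorem inl_smul_bt (r : ℂ[X]) (m : M) (n : N) : inl r • bt m n = bt (inl r • m) n := by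
  have := smul_bt r 1 m n
  rwa [map_one, mul_one, one_smul] at this

theorem inr_smul_bt (s : ℂ[X]) (m : M) (n : N) : inr s • bt m n = bt m (inr s • n) := by
  have := smul_bt 1 s m n
  rwa [map_one, one_mul, one_smul] at this

/-- Balanced biadditive maps that are compatible with the two outer actions induce
bimodule maps on `M ⊗_R N`. -/
def BT.lift {P : Type} [AddCommGroup P] [Module Bi P] (f : M →+ N →+ P)
    (hf : ∀ (r : ℂ[X]) (m : M) (n : N), f (inr r • m) n = f m (inl r • n))
    (hl : ∀ (r s : ℂ[X]) (m : M) (n : N), f (inl r • m) (inr s • n) = (inl r * inr s) • f m n) :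
    BT M N →ₗ[Bi] P where
  toFun := BT.liftAdd f hf
  map_add' := map_add _
  map_smul' u t := by
    show BT.liftAdd f hf (u • t) = u • BT.liftAdd f hf t
    induction u using Bi.induction with
    | h2 u u' hu hu' => rw [add_smul, map_add, hu, hu', add_smul]
    | h1 r s =>
      induction t using BT.induction with
      | h0 => simp
      | h1 m n => rw [smul_bt]; exact hl r s m n
      | h2 t t' ht ht' => rw [smul_add, map_add, ht, ht', map_add, smul_add]

@[simp] theorem BT.lift_bt {P : Type} [AddCommGroup P] [Module Bi P] (f : M →+ N →+ P)
    (hf : ∀ (r : ℂ[X]) (m : M) (n : N), f (inr r • m) n = f m (inl r • n))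
    (hl : ∀ (r s : ℂ[X]) (m : M) (n : N), f (inl r • m) (inr s • n) = (inl r * inr s) • f m n)
    (m : M) (n : N) : BT.lift f hf hl (bt m n) = f m n := rfl

theorem BT.hom_ext {P : Type} [AddCommGroup P] [Module Bi P] {f g : BT M N →ₗ[Bi] P}
    (h : ∀ m n, f (bt m n) = g (bt m n)) : f = g := by
  ext t
  exact DFunLike.congr_fun (BT.addHom_ext (f := f.toAddMonoidHom) (g := g.toAddMonoidHom) h) t

end Tensor

/-! ### Functoriality and coherence maps of the tensor product of bimodules -/

section Maps

variable {M N P M' N' M'' N'' : Type} [AddCommGroup M] [Module Bi M] [AddCommGroup N] [Module Bi N]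
  [AddCommGroup P] [Module Bi P] [AddCommGroup M'] [Module Bi M'] [AddCommGroup N'] [Module Bi N']
  [AddCommGroup M''] [Module Bi M''] [AddCommGroup N''] [Module Bi N'']

/-- `f ⊗_R g` -/
def BT.map (f : M →ₗ[Bi] M') (g : N →ₗ[Bi] N') : BT M N →ₗ[Bi] BT M' N' :=
  BT.lift (mkBi (fun m n => bt (f m) (g n)) (fun m m' n => by rw [map_add, bt_add_left])
      (fun m n n' => by rw [map_add, bt_add_right]))
    (fun r m n => by simp only [mkBi_apply, map_smul, bt_balanced])
    (fun r s m n => by simp only [mkBi_apply, map_smul, smul_bt])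

@[simp] theorem BT.map_bt (f : M →ₗ[Bi] M') (g : N →ₗ[Bi] N') (m : M) (n : N) :
    BT.map f g (bt m n) = bt (f m) (g n) := rfl

theorem BT.map_comp_apply (f : M →ₗ[Bi] M') (g : N →ₗ[Bi] N') (f' : M' →ₗ[Bi] M'')
    (g' : N' →ₗ[Bi] N'') (t : BT M N) :
    BT.map f' g' (BT.map f g t) = BT.map (f' ∘ₗ f) (g' ∘ₗ g) t := by
  have : BT.map f' g' ∘ₗ BT.map f g = BT.map (f' ∘ₗ f) (g' ∘ₗ g) := BT.hom_ext fun _ _ => rfl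
  exact DFunLike.congr_fun this t

theorem BT.map_id_apply (t : BT M N) :
    BT.map (LinearMap.id : M →ₗ[Bi] M) (LinearMap.id : N →ₗ[Bi] N) t = t := by
  have : BT.map (LinearMap.id : M →ₗ[Bi] M) (LinearMap.id : N →ₗ[Bi] N) = LinearMap.id :=
    BT.hom_ext fun _ _ => rfl
  exact DFunLike.congr_fun this t

theorem BT.map_add_left (f f' : M →ₗ[Bi] M') (g : N →ₗ[Bi] N') :
    BT.map (f + f') g = BT.map f g + BT.map f' g :=
  BT.hom_ext fun _ _ => bt_add_left _ _ _

theorem BT.map_add_right (f : M →ₗ[Bi] M') (g g' : N →ₗ[Bi] N') :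
    BT.map f (g + g') = BT.map f g + BT.map f g' :=
  BT.hom_ext fun _ _ => bt_add_right _ _ _

theorem BT.map_zero_left (g : N →ₗ[Bi] N') : BT.map (0 : M →ₗ[Bi] M') g = 0 :=
  BT.hom_ext fun _ _ => bt_zero_left _

theorem BT.map_zero_right (f : M →ₗ[Bi] M') : BT.map f (0 : N →ₗ[Bi] N') = 0 :=
  BT.hom_ext fun _ _ => bt_zero_right _

variable (M N P)

/-- `m ⊗ n ↦ m ⊗ (n ⊗ p)` -/
def BT.assocHomAux (p : P) : BT M N →+ BT M (BT N P) :=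
  BT.liftAdd (mkBi (fun m n => bt m (bt n p)) (fun m m' n => bt_add_left m m' _)
      (fun m n n' => by rw [bt_add_left, bt_add_right]))
    (fun r m n => by
      simp only [mkBi_apply]
      rw [bt_balanced, inl_smul_bt])

/-- `n ⊗ p ↦ (m ⊗ n) ⊗ p` -/
def BT.assocInvAux (m : M) : BT N P →+ BT (BT M N) P :=
  BT.liftAdd (mkBi (fun n p => bt (bt m n) p) (fun n n' p => by rw [bt_add_right, bt_add_left])
      (fun n p p' => bt_add_right _ _ _))
    (fun r n p => by
      simp only [mkBi_apply]
      rw [← bt_balanced, inr_smul_bt])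

theorem BT.assocHomAux_bt (m : M) (n : N) (p : P) :
    BT.assocHomAux M N P p (bt m n) = bt m (bt n p) := rfl

theorem BT.assocInvAux_bt (m : M) (n : N) (p : P) :
    BT.assocInvAux M N P m (bt n p) = bt (bt m n) p := rfl

/-- `(m ⊗ n) ⊗ p ↦ m ⊗ (n ⊗ p)` -/
def BT.assocHom : BT (BT M N) P →ₗ[Bi] BT M (BT N P) :=
  BT.lift
    (mkBi (fun t p => BT.assocHomAux M N P p t)
      (fun t t' p => map_add (BT.assocHomAux M N P p) t t')
      (fun t p p' => by
        induction t using BT.induction with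
        | h0 => rw [map_zero, map_zero, map_zero, add_zero]
        | h1 m n => rw [assocHomAux_bt, assocHomAux_bt, assocHomAux_bt, bt_add_right, bt_add_right]
        | h2 s t hs ht => rw [map_add, map_add, map_add, hs, ht]; abel))
    (fun r t p => by
      rw [mkBi_apply, mkBi_apply]
      induction t using BT.induction with
      | h0 => rw [smul_zero, map_zero, map_zero]
      | h1 m n => rw [inr_smul_bt, assocHomAux_bt, assocHomAux_bt, bt_balanced]
      | h2 s t hs ht => rw [smul_add, map_add, map_add, hs, ht])
    (fun r s t p => by
      rw [mkBi_apply, mkBi_apply]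
      induction t using BT.induction with
      | h0 => rw [smul_zero, map_zero, map_zero, smul_zero]
      | h1 m n => rw [inl_smul_bt, assocHomAux_bt, assocHomAux_bt, smul_bt, inr_smul_bt]
      | h2 t t' ht ht' => rw [smul_add, map_add, map_add, ht, ht', smul_add])

/-- `m ⊗ (n ⊗ p) ↦ (m ⊗ n) ⊗ p` -/
def BT.assocInv : BT M (BT N P) →ₗ[Bi] BT (BT M N) P :=
  BT.lift
    (mkBi (fun m t => BT.assocInvAux M N P m t)
      (fun m m' t => by
        induction t using BT.induction with
        | h0 => rw [map_zero, map_zero, map_zero, add_zero]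
        | h1 n p => rw [assocInvAux_bt, assocInvAux_bt, assocInvAux_bt, bt_add_left, bt_add_left]
        | h2 s t hs ht => rw [map_add, map_add, map_add, hs, ht]; abel)
      (fun m t t' => map_add (BT.assocInvAux M N P m) t t'))
    (fun r m t => by
      rw [mkBi_apply, mkBi_apply]
      induction t using BT.induction with
      | h0 => rw [smul_zero, map_zero, map_zero]
      | h1 n p => rw [inl_smul_bt, assocInvAux_bt, assocInvAux_bt, bt_balanced]
      | h2 s t hs ht => rw [smul_add, map_add, map_add, hs, ht])
    (fun r s m t => by
      rw [mkBi_apply, mkBi_apply]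
      induction t using BT.induction with
      | h0 => rw [smul_zero, map_zero, map_zero, smul_zero]
      | h1 n p => rw [inr_smul_bt, assocInvAux_bt, assocInvAux_bt, smul_bt, inl_smul_bt]
      | h2 t t' ht ht' => rw [smul_add, map_add, map_add, ht, ht', smul_add])

@[simp] theorem BT.assocHom_bt (m : M) (n : N) (p : P) :
    BT.assocHom M N P (bt (bt m n) p) = bt m (bt n p) := rfl

@[simp] theorem BT.assocInv_bt (m : M) (n : N) (p : P) :
    BT.assocInv M N P (bt m (bt n p)) = bt (bt m n) p := rfl

theorem BT.hom_ext₃ {M N P Q : Type} [AddCommGroup M] [Module Bi M] [AddCommGroup N] [Module Bi N]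
    [AddCommGroup P] [Module Bi P] [AddCommGroup Q] [Module Bi Q]
    {f g : BT (BT M N) P →ₗ[Bi] Q}
    (h : ∀ m n p, f (bt (bt m n) p) = g (bt (bt m n) p)) : f = g :=
  BT.hom_ext fun t p => by
    induction t using BT.induction with
    | h0 => simp [bt_zero_left]
    | h1 m n => exact h m n p
    | h2 s t hs ht => rw [bt_add_left, map_add, map_add, hs, ht]

theorem BT.hom_ext₃' {M N P Q : Type} [AddCommGroup M] [Module Bi M] [AddCommGroup N] [Module Bi N]
    [AddCommGroup P] [Module Bi P] [AddCommGroup Q] [Module Bi Q]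
    {f g : BT M (BT N P) →ₗ[Bi] Q}
    (h : ∀ m n p, f (bt m (bt n p)) = g (bt m (bt n p))) : f = g :=
  BT.hom_ext fun m t => by
    induction t using BT.induction with
    | h0 => simp [bt_zero_right]
    | h1 n p => exact h m n p
    | h2 s t hs ht => rw [bt_add_right, map_add, map_add, hs, ht]

theorem BT.assocHom_assocInv (t : BT M (BT N P)) :
    BT.assocHom M N P (BT.assocInv M N P t) = t := by
  have : BT.assocHom M N P ∘ₗ BT.assocInv M N P = LinearMap.id := BT.hom_ext₃' fun _ _ _ => rfl
  exact DFunLike.congr_fun this t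

theorem BT.assocInv_assocHom (t : BT (BT M N) P) :
    BT.assocInv M N P (BT.assocHom M N P t) = t := by
  have : BT.assocInv M N P ∘ₗ BT.assocHom M N P = LinearMap.id := BT.hom_ext₃ fun _ _ _ => rfl
  exact DFunLike.congr_fun this t

/-- The multiplication map `μ : R ⊗ R → R`. -/
def mu : Bi →ₐ[ℂ] ℂ[X] := Bi.lift (AlgHom.id ℂ ℂ[X]) (AlgHom.id ℂ ℂ[X])

theorem mu_inl (r : ℂ[X]) : mu (inl r) = r := Bi.lift_inl _ _ r

theorem mu_inr (r : ℂ[X]) : mu (inr r) = r := Bi.lift_inr _ _ r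

/-- `μ ⊗_R id : (R ⊗ R) ⊗_R M → M` -/
def BT.lUnit : BT Bi M →ₗ[Bi] M :=
  BT.lift (mkBi (fun u m => inl (mu u) • m)
      (fun u u' m => by rw [map_add, map_add, add_smul])
      (fun u m m' => smul_add _ _ _))
    (fun r u m => by
      simp only [mkBi_apply, smul_eq_mul, map_mul, mu_inr, smul_smul, mul_comm])
    (fun r s u m => by
      simp only [mkBi_apply, smul_eq_mul, map_mul, mu_inl, smul_smul, mul_right_comm])

/-- `id ⊗_R μ : M ⊗_R (R ⊗ R) → M` -/
def BT.rUnit : BT M Bi →ₗ[Bi] M :=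
  BT.lift (mkBi (fun m u => inr (mu u) • m)
      (fun m m' u => smul_add _ _ _)
      (fun m u u' => by rw [map_add, map_add, add_smul]))
    (fun r m u => by
      simp only [mkBi_apply, smul_eq_mul, map_mul, mu_inl, smul_smul, mul_comm])
    (fun r s m u => by
      simp only [mkBi_apply, smul_eq_mul, map_mul, mu_inr, smul_smul]
      congr 1; ring)

@[simp] theorem BT.lUnit_bt (u : Bi) (m : M) : BT.lUnit M (bt u m) = inl (mu u) • m := rfl

@[simp] theorem BT.rUnit_bt (m : M) (u : Bi) : BT.rUnit M (bt m u) = inr (mu u) • m := rfl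

end Maps

/-! ### Duals of bimodules -/

/-- The exchange `σ : R ⊗ R → R ⊗ R` of the two tensor factors. -/
def sig : Bi →ₐ[ℂ] Bi := Bi.lift inr inl

@[simp] theorem sig_inl (r : ℂ[X]) : sig (inl r) = inr r := Bi.lift_inl _ _ r

@[simp] theorem sig_inr (r : ℂ[X]) : sig (inr r) = inl r := Bi.lift_inr _ _ r

@[simp] theorem sig_sig (u : Bi) : sig (sig u) = u := by
  induction u using Bi.induction with
  | h1 r s => rw [map_mul, map_mul, sig_inl, sig_inr, sig_inr, sig_inl]
  | h2 u v hu hv => rw [map_add, map_add, hu, hv]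

/-- The dual bimodule `M^∨ = Hom_{R-mod-R}(M, R ⊗ R)`. -/
def BDual (M : Type) [AddCommGroup M] [Module Bi M] : Type := M →ₗ[Bi] Bi

section Dual

variable {M N P : Type} [AddCommGroup M] [Module Bi M] [AddCommGroup N] [Module Bi N]
  [AddCommGroup P] [Module Bi P]

instance : AddCommGroup (BDual M) := inferInstanceAs (AddCommGroup (M →ₗ[Bi] Bi))

instance : FunLike (BDual M) M Bi := inferInstanceAs (FunLike (M →ₗ[Bi] Bi) M Bi)

instance : LinearMapClass (BDual M) Bi M Bi :=
  inferInstanceAs (LinearMapClass (M →ₗ[Bi] Bi) Bi M Bi)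

/-- The bimodule structure of `M^∨` is `(s.φ.r)(m) = φ(r.m.s)`. -/
instance : Module Bi (BDual M) :=
  Module.compHom (M →ₗ[Bi] Bi) sig.toRingHom

theorem BDual.smul_apply (u : Bi) (φ : BDual M) (m : M) : (u • φ) m = φ (sig u • m) := by
  rw [map_smul]; rfl

@[ext] theorem BDual.ext {φ ψ : BDual M} (h : ∀ m, φ m = ψ m) : φ = ψ := LinearMap.ext h

@[simp] theorem BDual.add_apply (φ ψ : BDual M) (m : M) : (φ + ψ) m = φ m + ψ m := rfl

@[simp] theorem BDual.neg_apply (φ : BDual M) (m : M) : (-φ) m = -φ m := rfl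

@[simp] theorem BDual.zero_apply (m : M) : (0 : BDual M) m = 0 := rfl

/-- The dual map `f^∨ : N^∨ → M^∨`, `ψ ↦ ψ ∘ f`. -/
def dualMap (f : M →ₗ[Bi] N) : BDual N →ₗ[Bi] BDual M where
  toFun ψ := (show N →ₗ[Bi] Bi from ψ) ∘ₗ f
  map_add' _ _ := rfl
  map_smul' _ _ := rfl

@[simp] theorem dualMap_apply (f : M →ₗ[Bi] N) (ψ : BDual N) (m : M) :
    dualMap f ψ m = ψ (f m) := rfl

variable (M)

/-- The canonical map `δ_M : M → M^∨∨`, `δ_M(m)(φ) = σ(φ(m))`. -/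
def bidual : M →ₗ[Bi] BDual (BDual M) where
  toFun m := show BDual M →ₗ[Bi] Bi from
    { toFun := fun φ => sig (φ m)
      map_add' := fun φ ψ => by simp
      map_smul' := fun u φ => by
        rw [BDual.smul_apply, map_smul, smul_eq_mul, map_mul, sig_sig]; rfl }
  map_add' m m' := by
    ext φ
    show sig (φ (m + m')) = sig (φ m) + sig (φ m')
    rw [map_add, map_add]
  map_smul' u m := by
    ext φ
    show sig (φ (u • m)) = sig u * sig (φ m)
    rw [map_smul, smul_eq_mul, map_mul]

@[simp] theorem bidual_apply (m : M) (φ : BDual M) : bidual M m φ = sig (φ m) := rfl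

end Dual

/-! ### Block maps -/

section Block

variable {A B C D E F : Type} [AddCommGroup A] [Module Bi A] [AddCommGroup B] [Module Bi B]
  [AddCommGroup C] [Module Bi C] [AddCommGroup D] [Module Bi D] [AddCommGroup E] [Module Bi E]
  [AddCommGroup F] [Module Bi F]

/-- The map `(p, q) ↦ (f p + g q, h p + k q)`. -/
def blk (f : A →ₗ[Bi] C) (g : B →ₗ[Bi] C) (h : A →ₗ[Bi] D) (k : B →ₗ[Bi] D) :
    A × B →ₗ[Bi] C × D :=
  (f.coprod g).prod (h.coprod k)

@[simp] theorem blk_apply (f : A →ₗ[Bi] C) (g : B →ₗ[Bi] C) (h : A →ₗ[Bi] D) (k : B →ₗ[Bi] D)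
    (p : A) (q : B) : blk f g h k (p, q) = (f p + g q, h p + k q) := rfl

theorem blk_comp (f : A →ₗ[Bi] C) (g : B →ₗ[Bi] C) (h : A →ₗ[Bi] D) (k : B →ₗ[Bi] D)
    (f' : C →ₗ[Bi] E) (g' : D →ₗ[Bi] E) (h' : C →ₗ[Bi] F) (k' : D →ₗ[Bi] F) :
    blk f' g' h' k' ∘ₗ blk f g h k =
      blk (f' ∘ₗ f + g' ∘ₗ h) (f' ∘ₗ g + g' ∘ₗ k) (h' ∘ₗ f + k' ∘ₗ h) (h' ∘ₗ g + k' ∘ₗ k) := by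
  ext <;> simp [blk]

theorem blk_add (f : A →ₗ[Bi] C) (g : B →ₗ[Bi] C) (h : A →ₗ[Bi] D) (k : B →ₗ[Bi] D)
    (f' : A →ₗ[Bi] C) (g' : B →ₗ[Bi] C) (h' : A →ₗ[Bi] D) (k' : B →ₗ[Bi] D) :
    blk f g h k + blk f' g' h' k' = blk (f + f') (g + g') (h + h') (k + k') := by
  ext <;> simp [blk]

theorem blk_id : blk (LinearMap.id : A →ₗ[Bi] A) 0 0 (LinearMap.id : B →ₗ[Bi] B) =
    LinearMap.id := by
  ext <;> simp [blk]

theorem blk_smul_id (u : Bi) : blk (u • LinearMap.id : A →ₗ[Bi] A) 0 0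
    (u • LinearMap.id : B →ₗ[Bi] B) = u • LinearMap.id := by
  ext <;> simp [blk]

end Block

section MapComp

variable {M N M' N' M'' N'' : Type} [AddCommGroup M] [Module Bi M] [AddCommGroup N] [Module Bi N]
  [AddCommGroup M'] [Module Bi M'] [AddCommGroup N'] [Module Bi N']
  [AddCommGroup M''] [Module Bi M''] [AddCommGroup N''] [Module Bi N'']

theorem BT.map_comp (f : M →ₗ[Bi] M') (g : N →ₗ[Bi] N') (f' : M' →ₗ[Bi] M'')
    (g' : N' →ₗ[Bi] N'') :
    BT.map f' g' ∘ₗ BT.map f g = BT.map (f' ∘ₗ f) (g' ∘ₗ g) := BT.hom_ext fun _ _ => rfl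

theorem BT.map_id : BT.map (LinearMap.id : M →ₗ[Bi] M) (LinearMap.id : N →ₗ[Bi] N) =
    LinearMap.id := BT.hom_ext fun _ _ => rfl

theorem bt_neg_left (m : M) (n : N) : bt (-m) n = -bt m n := by
  rw [eq_neg_iff_add_eq_zero, ← bt_add_left, neg_add_cancel, bt_zero_left]

theorem bt_neg_right (m : M) (n : N) : bt m (-n) = -bt m n := by
  rw [eq_neg_iff_add_eq_zero, ← bt_add_right, neg_add_cancel, bt_zero_right]

theorem bt_sub_left (m m' : M) (n : N) : bt (m - m') n = bt m n - bt m' n := by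
  rw [sub_eq_add_neg, bt_add_left, bt_neg_left, sub_eq_add_neg]

theorem bt_sub_right (m : M) (n n' : N) : bt m (n - n') = bt m n - bt m n' := by
  rw [sub_eq_add_neg, bt_add_right, bt_neg_right, sub_eq_add_neg]

theorem BT.map_neg_left (f : M →ₗ[Bi] M') (g : N →ₗ[Bi] N') :
    BT.map (-f) g = -BT.map f g := BT.hom_ext fun _ _ => bt_neg_left _ _

theorem BT.map_neg_right (f : M →ₗ[Bi] M') (g : N →ₗ[Bi] N') :
    BT.map f (-g) = -BT.map f g := BT.hom_ext fun _ _ => bt_neg_right _ _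

end MapComp

/-- `W ⊗ 1 - 1 ⊗ W`, so that `pot W • m = W.m - m.W` -/
def pot (W : ℂ[X]) : Bi := inl W - inr W

theorem pot_bt {M N : Type} [AddCommGroup M] [Module Bi M] [AddCommGroup N] [Module Bi N]
    (W : ℂ[X]) (m : M) (n : N) : bt (pot W • m) n + bt m (pot W • n) = pot W • bt m n := by
  simp only [pot, sub_smul, bt_sub_left, bt_sub_right, inl_smul_bt, inr_smul_bt]
  rw [bt_balanced]; abel

theorem map_pot {M N : Type} [AddCommGroup M] [Module Bi M] [AddCommGroup N] [Module Bi N]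
    (W : ℂ[X]) : BT.map (pot W • LinearMap.id : M →ₗ[Bi] M) (LinearMap.id : N →ₗ[Bi] N) +
      BT.map (LinearMap.id : M →ₗ[Bi] M) (pot W • LinearMap.id : N →ₗ[Bi] N) =
      pot W • LinearMap.id :=
  BT.hom_ext fun m n => pot_bt W m n

/-! ### Matrix bi-factorisations -/

/-- A (not necessarily finite-rank) bi-factorisation of `W`: a pair of bimodules with bimodule maps
`d0 : X0 → X1` and `d1 : X1 → X0` such that both composites are `m ↦ W.m - m.W`. -/
structure MF (W : ℂ[X]) where
  X0 : Type
  X1 : Type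
  [acg0 : AddCommGroup X0]
  [acg1 : AddCommGroup X1]
  [mod0 : Module Bi X0]
  [mod1 : Module Bi X1]
  d0 : X0 →ₗ[Bi] X1
  d1 : X1 →ₗ[Bi] X0
  d1_d0 : d1 ∘ₗ d0 = pot W • LinearMap.id
  d0_d1 : d0 ∘ₗ d1 = pot W • LinearMap.id

attribute [instance] MF.acg0 MF.acg1 MF.mod0 MF.mod1

namespace MF

variable {W : ℂ[X]}

/-- Even closed maps `φ = (f0, f1)`. -/
structure Hom (X Y : MF W) where
  f0 : X.X0 →ₗ[Bi] Y.X0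
  f1 : X.X1 →ₗ[Bi] Y.X1
  comm0 : Y.d0 ∘ₗ f0 = f1 ∘ₗ X.d0
  comm1 : Y.d1 ∘ₗ f1 = f0 ∘ₗ X.d1

theorem Hom.ext {X Y : MF W} {f g : Hom X Y} (h0 : f.f0 = g.f0) (h1 : f.f1 = g.f1) : f = g := by
  cases f; cases g; simp_all

/-- Two even closed maps are homotopic if they differ by `d ψ + ψ d` with `ψ = (h0, h1)` odd. -/
def Homotopic {X Y : MF W} (f g : Hom X Y) : Prop :=
  ∃ (h0 : X.X0 →ₗ[Bi] Y.X1) (h1 : X.X1 →ₗ[Bi] Y.X0),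
    f.f0 = g.f0 + (Y.d1 ∘ₗ h0 + h1 ∘ₗ X.d0) ∧ f.f1 = g.f1 + (Y.d0 ∘ₗ h1 + h0 ∘ₗ X.d1)

/-- The identity map. -/
def Hom.id (X : MF W) : Hom X X := ⟨LinearMap.id, LinearMap.id, rfl, rfl⟩

/-- The composite of `f` followed by `g`. -/
def Hom.comp {X Y Z : MF W} (f : Hom X Y) (g : Hom Y Z) : Hom X Z where
  f0 := g.f0 ∘ₗ f.f0
  f1 := g.f1 ∘ₗ f.f1
  comm0 := by rw [← LinearMap.comp_assoc, g.comm0, LinearMap.comp_assoc, f.comm0,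
    LinearMap.comp_assoc]
  comm1 := by rw [← LinearMap.comp_assoc, g.comm1, LinearMap.comp_assoc, f.comm1,
    LinearMap.comp_assoc]

theorem Homotopic.refl {X Y : MF W} (f : Hom X Y) : Homotopic f f := ⟨0, 0, by simp, by simp⟩

theorem Homotopic.symm {X Y : MF W} {f g : Hom X Y} : Homotopic f g → Homotopic g f := by
  rintro ⟨h0, h1, e0, e1⟩
  refine ⟨-h0, -h1, ?_, ?_⟩
  · rw [e0, LinearMap.comp_neg, LinearMap.neg_comp]; abel
  · rw [e1, LinearMap.comp_neg, LinearMap.neg_comp]; abel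

theorem Homotopic.trans {X Y : MF W} {f g h : Hom X Y} :
    Homotopic f g → Homotopic g h → Homotopic f h := by
  rintro ⟨h0, h1, e0, e1⟩ ⟨k0, k1, e0', e1'⟩
  refine ⟨h0 + k0, h1 + k1, ?_, ?_⟩
  · rw [e0, e0', LinearMap.comp_add, LinearMap.add_comp]; abel
  · rw [e1, e1', LinearMap.comp_add, LinearMap.add_comp]; abel

theorem Homotopic.comp {X Y Z : MF W} {f f' : Hom X Y} {g g' : Hom Y Z} (hf : Homotopic f f')
    (hg : Homotopic g g') : Homotopic (f.comp g) (f'.comp g') := by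
  obtain ⟨h0, h1, e0, e1⟩ := hf
  obtain ⟨k0, k1, e0', e1'⟩ := hg
  have l : Homotopic (f.comp g) (f'.comp g) := by
    refine ⟨g.f1 ∘ₗ h0, g.f0 ∘ₗ h1, ?_, ?_⟩
    · show g.f0 ∘ₗ f.f0 = g.f0 ∘ₗ f'.f0 + _
      rw [e0, ← LinearMap.comp_assoc, g.comm1]
      simp only [LinearMap.comp_add, LinearMap.comp_assoc]
    · show g.f1 ∘ₗ f.f1 = g.f1 ∘ₗ f'.f1 + _
      rw [e1, ← LinearMap.comp_assoc, g.comm0]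
      simp only [LinearMap.comp_add, LinearMap.comp_assoc]
  refine l.trans ⟨k0 ∘ₗ f'.f0, k1 ∘ₗ f'.f1, ?_, ?_⟩
  · show g.f0 ∘ₗ f'.f0 = g'.f0 ∘ₗ f'.f0 + _
    rw [e0', LinearMap.comp_assoc, ← f'.comm0]
    simp only [LinearMap.add_comp, LinearMap.comp_assoc]
  · show g.f1 ∘ₗ f'.f1 = g'.f1 ∘ₗ f'.f1 + _
    rw [e1', LinearMap.comp_assoc, ← f'.comm1]
    simp only [LinearMap.add_comp, LinearMap.comp_assoc]

/-- Homotopy is an equivalence relation. -/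
instance homSetoid (X Y : MF W) : Setoid (Hom X Y) :=
  ⟨Homotopic, Homotopic.refl, Homotopic.symm, Homotopic.trans⟩

/-- Homotopy equivalence of bi-factorisations. -/
def HEquiv (X Y : MF W) : Prop :=
  ∃ (f : Hom X Y) (g : Hom Y X), Homotopic (f.comp g) (Hom.id X) ∧ Homotopic (g.comp f) (Hom.id Y)

/-- `X` is homotopy equivalent to a bi-factorisation by free bimodules of finite rank. -/
def EssFinite (X : MF W) : Prop :=
  ∃ Z : MF W, Module.Free Bi Z.X0 ∧ Module.Finite Bi Z.X0 ∧ Module.Free Bi Z.X1 ∧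
    Module.Finite Bi Z.X1 ∧ HEquiv X Z

/-! ### Tensor product and unit -/

/-- The tensor product `X ⊗_R Y`, with differential `d ⊗ 1 + (-1)^{|.|} 1 ⊗ d`. The even part is
`X0 ⊗ Y0 ⊕ X1 ⊗ Y1` and the odd part is `X1 ⊗ Y0 ⊕ X0 ⊗ Y1`. -/
abbrev tensor (X Y : MF W) : MF W where
  X0 := BT X.X0 Y.X0 × BT X.X1 Y.X1
  X1 := BT X.X1 Y.X0 × BT X.X0 Y.X1
  d0 := blk (BT.map X.d0 LinearMap.id) (-BT.map LinearMap.id Y.d1)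
    (BT.map LinearMap.id Y.d0) (BT.map X.d1 LinearMap.id)
  d1 := blk (BT.map X.d1 LinearMap.id) (BT.map LinearMap.id Y.d1)
    (-BT.map LinearMap.id Y.d0) (BT.map X.d0 LinearMap.id)
  d1_d0 := by
    rw [blk_comp, ← blk_smul_id, ← map_pot, ← map_pot]
    simp only [LinearMap.comp_neg, LinearMap.neg_comp, BT.map_comp, LinearMap.id_comp,
      LinearMap.comp_id, X.d1_d0, X.d0_d1, Y.d1_d0, Y.d0_d1]
    congr 1 <;> abel
  d0_d1 := by
    rw [blk_comp, ← blk_smul_id, ← map_pot, ← map_pot]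
    simp only [LinearMap.comp_neg, LinearMap.neg_comp, BT.map_comp, LinearMap.id_comp,
      LinearMap.comp_id, X.d1_d0, X.d0_d1, Y.d1_d0, Y.d0_d1]
    congr 1 <;> abel

/-- `φ ⊗ ψ`, for even closed maps -/
def Hom.tensor {X Y X' Y' : MF W} (f : Hom X X') (g : Hom Y Y') :
    Hom (MF.tensor X Y) (MF.tensor X' Y') where
  f0 := blk (BT.map f.f0 g.f0) 0 0 (BT.map f.f1 g.f1)
  f1 := blk (BT.map f.f1 g.f0) 0 0 (BT.map f.f0 g.f1)
  comm0 := by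
    simp only [MF.tensor, blk_comp, LinearMap.comp_neg, LinearMap.neg_comp, BT.map_comp,
      LinearMap.id_comp, LinearMap.comp_id, LinearMap.comp_zero, LinearMap.zero_comp, add_zero,
      zero_add, neg_zero, f.comm0, f.comm1, g.comm0, g.comm1]
  comm1 := by
    simp only [MF.tensor, blk_comp, LinearMap.comp_neg, LinearMap.neg_comp, BT.map_comp,
      LinearMap.id_comp, LinearMap.comp_id, LinearMap.comp_zero, LinearMap.zero_comp, add_zero,
      zero_add, neg_zero, f.comm0, f.comm1, g.comm0, g.comm1]

theorem Homotopic.whiskerLeft (X : MF W) {Y Z : MF W} {f g : Hom Y Z} (h : Homotopic f g) :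
    Homotopic ((Hom.id X).tensor f) ((Hom.id X).tensor g) := by
  obtain ⟨h0, h1, e0, e1⟩ := h
  refine ⟨blk 0 (-BT.map LinearMap.id h1) (BT.map LinearMap.id h0) 0,
    blk 0 (BT.map LinearMap.id h1) (-BT.map LinearMap.id h0) 0, ?_, ?_⟩ <;>
  · simp only [MF.tensor, Hom.tensor, Hom.id, blk_comp, blk_add, LinearMap.comp_neg,
      LinearMap.neg_comp, BT.map_comp, LinearMap.id_comp, LinearMap.comp_id, LinearMap.comp_zero,
      LinearMap.zero_comp, e0, e1, BT.map_add_right]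
    congr 1 <;> abel

theorem Homotopic.whiskerRight {Y Z : MF W} (X : MF W) {f g : Hom Y Z} (h : Homotopic f g) :
    Homotopic (f.tensor (Hom.id X)) (g.tensor (Hom.id X)) := by
  obtain ⟨h0, h1, e0, e1⟩ := h
  refine ⟨blk (BT.map h0 LinearMap.id) 0 0 (BT.map h1 LinearMap.id),
    blk (BT.map h1 LinearMap.id) 0 0 (BT.map h0 LinearMap.id), ?_, ?_⟩ <;>
  · simp only [MF.tensor, Hom.tensor, Hom.id, blk_comp, blk_add, LinearMap.comp_neg,
      LinearMap.neg_comp, BT.map_comp, LinearMap.id_comp, LinearMap.comp_id, LinearMap.comp_zero,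
      LinearMap.zero_comp, e0, e1, BT.map_add_left]
    congr 1 <;> abel

end MF

/-- The difference quotient `r ↦ (r(a) - r(b)) / (a - b)`, given on monomials by
`x ^ n ↦ ∑_{i < n} a ^ i b ^ (n - 1 - i)`. -/
def dd : ℂ[X] →ₗ[ℂ] Bi :=
  Polynomial.lsum fun n =>
    LinearMap.toSpanSingleton ℂ Bi
      (∑ i ∈ Finset.range n, inl Polynomial.X ^ i * inr Polynomial.X ^ (n - 1 - i))

theorem dd_mul (r : ℂ[X]) : dd r * (inl Polynomial.X - inr Polynomial.X) = pot r := by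
  induction r using Polynomial.induction_on' with
  | add p q hp hq => rw [map_add, add_mul, hp, hq]; simp only [pot, map_add]; ring
  | monomial n c =>
    have h : dd (Polynomial.monomial n c) = c •
        ∑ i ∈ Finset.range n, inl Polynomial.X ^ i * inr Polynomial.X ^ (n - 1 - i) := by
      simp [dd, Polynomial.lsum_apply, Polynomial.sum_monomial_index]
    rw [h, smul_mul_assoc, Commute.geom_sum₂_mul (Commute.all _ _), pot,
      ← Polynomial.C_mul_X_pow_eq_monomial, ← Polynomial.smul_eq_C_mul, map_smul, map_smul,
      map_pow, map_pow, smul_sub]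

theorem mu_pot (r : ℂ[X]) : mu (pot r) = 0 := by rw [pot, map_sub, mu_inl, mu_inr, sub_self]

namespace MF

variable {W : ℂ[X]}

/-- The unit object `I`: `d1 = a - b` and `d0 = (W(a) - W(b)) / (a - b)`. -/
abbrev unit (W : ℂ[X]) : MF W where
  X0 := Bi
  X1 := Bi
  d0 := dd W • LinearMap.id
  d1 := pot Polynomial.X • LinearMap.id
  d1_d0 := by
    rw [LinearMap.comp_smul, LinearMap.comp_id, smul_smul, ← dd_mul W]; rfl
  d0_d1 := by
    rw [LinearMap.comp_smul, LinearMap.comp_id, smul_smul, ← dd_mul W, mul_comm]; rfl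

/-- `λ_X : I ⊗ X → X`, given by `μ ⊗ id` on `I0 ⊗ X` and by zero on `I1 ⊗ X` -/
def leftUnitor (X : MF W) : Hom (tensor (unit W) X) X where
  f0 := (BT.lUnit X.X0).coprod 0
  f1 := LinearMap.coprod 0 (BT.lUnit X.X1)
  comm0 := by
    refine LinearMap.prod_ext (BT.hom_ext fun u m => ?_) (BT.hom_ext fun u m => ?_)
    · simp [tensor, unit]
    · simp [tensor, unit, mu_pot]
  comm1 := by
    refine LinearMap.prod_ext (BT.hom_ext fun u m => ?_) (BT.hom_ext fun u m => ?_)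
    · simp [tensor, unit, mu_pot]
    · simp [tensor, unit]

/-- `ρ_X : X ⊗ I → X`, given by `id ⊗ μ` on `X ⊗ I0` and by zero on `X ⊗ I1` -/
def rightUnitor (X : MF W) : Hom (tensor X (unit W)) X where
  f0 := (BT.rUnit X.X0).coprod 0
  f1 := (BT.rUnit X.X1).coprod 0
  comm0 := by
    refine LinearMap.prod_ext (BT.hom_ext fun m u => ?_) (BT.hom_ext fun m u => ?_)
    · simp [tensor, unit]
    · simp [tensor, unit, mu_pot]
  comm1 := by
    refine LinearMap.prod_ext (BT.hom_ext fun m u => ?_) (BT.hom_ext fun m u => ?_)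
    · simp [tensor, unit]
    · simp [tensor, unit, mu_pot]

end MF

/-! ### The associator -/

section Assoc

variable (A A' B B' C C' : Type) [AddCommGroup A] [Module Bi A] [AddCommGroup A'] [Module Bi A']
  [AddCommGroup B] [Module Bi B] [AddCommGroup B'] [Module Bi B'] [AddCommGroup C] [Module Bi C]
  [AddCommGroup C'] [Module Bi C']

theorem BT.hom_ext_left {A A' B B' C Q : Type} [AddCommGroup A] [Module Bi A] [AddCommGroup A']
    [Module Bi A'] [AddCommGroup B] [Module Bi B] [AddCommGroup B'] [Module Bi B']
    [AddCommGroup C] [Module Bi C] [AddCommGroup Q] [Module Bi Q]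
    {f g : BT (BT A B × BT A' B') C →ₗ[Bi] Q}
    (h : ∀ a b c, f (bt (bt a b, 0) c) = g (bt (bt a b, 0) c))
    (h' : ∀ a b c, f (bt (0, bt a b) c) = g (bt (0, bt a b) c)) : f = g :=
  BT.hom_ext fun t c => by
    obtain ⟨s, s'⟩ := t
    have e : ((s, s') : BT A B × BT A' B') = (s, 0) + (0, s') := by simp
    rw [e, bt_add_left, map_add, map_add]
    congr 1
    · induction s using BT.induction with
      | h0 => rw [Prod.mk_zero_zero, bt_zero_left, map_zero, map_zero]
      | h1 a b => exact h a b c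
      | h2 s t hs ht =>
        have e : ((s + t, 0) : BT A B × BT A' B') = (s, 0) + (t, 0) := by simp
        rw [e, bt_add_left, map_add, map_add, hs (by simp), ht (by simp)]
    · induction s' using BT.induction with
      | h0 => rw [Prod.mk_zero_zero, bt_zero_left, map_zero, map_zero]
      | h1 a b => exact h' a b c
      | h2 s t hs ht =>
        have e : ((0, s + t) : BT A B × BT A' B') = (0, s) + (0, t) := by simp
        rw [e, bt_add_left, map_add, map_add, hs (by simp), ht (by simp)]

theorem BT.hom_ext_right {A A' B B' C Q : Type} [AddCommGroup A] [Module Bi A] [AddCommGroup A']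
    [Module Bi A'] [AddCommGroup B] [Module Bi B] [AddCommGroup B'] [Module Bi B']
    [AddCommGroup C] [Module Bi C] [AddCommGroup Q] [Module Bi Q]
    {f g : BT C (BT A B × BT A' B') →ₗ[Bi] Q}
    (h : ∀ a b c, f (bt c (bt a b, 0)) = g (bt c (bt a b, 0)))
    (h' : ∀ a b c, f (bt c (0, bt a b)) = g (bt c (0, bt a b))) : f = g :=
  BT.hom_ext fun c t => by
    obtain ⟨s, s'⟩ := t
    have e : ((s, s') : BT A B × BT A' B') = (s, 0) + (0, s') := by simp
    rw [e, bt_add_right, map_add, map_add]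
    congr 1
    · induction s using BT.induction with
      | h0 => rw [Prod.mk_zero_zero, bt_zero_right, map_zero, map_zero]
      | h1 a b => exact h a b c
      | h2 s t hs ht =>
        have e : ((s + t, 0) : BT A B × BT A' B') = (s, 0) + (t, 0) := by simp
        rw [e, bt_add_right, map_add, map_add, hs (by simp), ht (by simp)]
    · induction s' using BT.induction with
      | h0 => rw [Prod.mk_zero_zero, bt_zero_right, map_zero, map_zero]
      | h1 a b => exact h' a b c
      | h2 s t hs ht =>
        have e : ((0, s + t) : BT A B × BT A' B') = (0, s) + (0, t) := by simp
        rw [e, bt_add_right, map_add, map_add, hs (by simp), ht (by simp)]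

/-- The rebracketing `(m ⊗ n) ⊗ p ↦ m ⊗ (n ⊗ p)` on each of the four summands. -/
def assocFwd : BT (BT A B × BT A' B') C × BT (BT A' B × BT A B') C' →ₗ[Bi]
    BT A (BT B C × BT B' C') × BT A' (BT B' C × BT B C') :=
  blk (BT.map LinearMap.id (LinearMap.inl Bi _ _) ∘ₗ BT.assocHom A B C ∘ₗ
      BT.map (LinearMap.fst Bi _ _) LinearMap.id)
    (BT.map LinearMap.id (LinearMap.inr Bi _ _) ∘ₗ BT.assocHom A B' C' ∘ₗ
      BT.map (LinearMap.snd Bi _ _) LinearMap.id)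
    (BT.map LinearMap.id (LinearMap.inl Bi _ _) ∘ₗ BT.assocHom A' B' C ∘ₗ
      BT.map (LinearMap.snd Bi _ _) LinearMap.id)
    (BT.map LinearMap.id (LinearMap.inr Bi _ _) ∘ₗ BT.assocHom A' B C' ∘ₗ
      BT.map (LinearMap.fst Bi _ _) LinearMap.id)

/-- The rebracketing `m ⊗ (n ⊗ p) ↦ (m ⊗ n) ⊗ p` on each of the four summands. -/
def assocBwd : BT A (BT B C × BT B' C') × BT A' (BT B' C × BT B C') →ₗ[Bi]
    BT (BT A B × BT A' B') C × BT (BT A' B × BT A B') C' :=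
  blk (BT.map (LinearMap.inl Bi _ _) LinearMap.id ∘ₗ BT.assocInv A B C ∘ₗ
      BT.map LinearMap.id (LinearMap.fst Bi _ _))
    (BT.map (LinearMap.inr Bi _ _) LinearMap.id ∘ₗ BT.assocInv A' B' C ∘ₗ
      BT.map LinearMap.id (LinearMap.fst Bi _ _))
    (BT.map (LinearMap.inr Bi _ _) LinearMap.id ∘ₗ BT.assocInv A B' C' ∘ₗ
      BT.map LinearMap.id (LinearMap.snd Bi _ _))
    (BT.map (LinearMap.inl Bi _ _) LinearMap.id ∘ₗ BT.assocInv A' B C' ∘ₗ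
      BT.map LinearMap.id (LinearMap.snd Bi _ _))

theorem assocBwd_comp : assocBwd A A' B B' C C' ∘ₗ assocFwd A A' B B' C C' = LinearMap.id := by
  refine LinearMap.prod_ext (BT.hom_ext_left (fun a b c => ?_) (fun a b c => ?_))
    (BT.hom_ext_left (fun a b c => ?_) (fun a b c => ?_)) <;>
  simp [assocFwd, assocBwd, bt_zero_left, bt_zero_right]

theorem assocFwd_comp : assocFwd A A' B B' C C' ∘ₗ assocBwd A A' B B' C C' = LinearMap.id := by
  refine LinearMap.prod_ext (BT.hom_ext_right (fun a b c => ?_) (fun a b c => ?_))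
    (BT.hom_ext_right (fun a b c => ?_) (fun a b c => ?_)) <;>
  simp [assocFwd, assocBwd, bt_zero_left, bt_zero_right]

end Assoc

namespace MF

variable {W : ℂ[X]}

/-- `(X ⊗ Y) ⊗ Z → X ⊗ (Y ⊗ Z)`, without signs -/
def assocHom (X Y Z : MF W) : Hom (tensor (tensor X Y) Z) (tensor X (tensor Y Z)) where
  f0 := assocFwd X.X0 X.X1 Y.X0 Y.X1 Z.X0 Z.X1
  f1 := assocFwd X.X1 X.X0 Y.X0 Y.X1 Z.X0 Z.X1
  comm0 := by
    refine LinearMap.prod_ext (BT.hom_ext_left (fun a b c => ?_) (fun a b c => ?_))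
      (BT.hom_ext_left (fun a b c => ?_) (fun a b c => ?_)) <;>
    simp [assocFwd, tensor, bt_zero_left, bt_neg_left] <;>
    simp only [← bt_neg_right, ← bt_add_right, Prod.neg_mk, Prod.mk_add_mk, add_zero, zero_add,
      neg_zero, neg_neg]
  comm1 := by
    refine LinearMap.prod_ext (BT.hom_ext_left (fun a b c => ?_) (fun a b c => ?_))
      (BT.hom_ext_left (fun a b c => ?_) (fun a b c => ?_)) <;>
    simp [assocFwd, tensor, bt_zero_left, bt_neg_left] <;>
    simp only [← bt_neg_right, ← bt_add_right, Prod.neg_mk, Prod.mk_add_mk, add_zero, zero_add,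
      neg_zero, neg_neg]

/-- `X ⊗ (Y ⊗ Z) → (X ⊗ Y) ⊗ Z`, without signs -/
def assocInv (X Y Z : MF W) : Hom (tensor X (tensor Y Z)) (tensor (tensor X Y) Z) where
  f0 := assocBwd X.X0 X.X1 Y.X0 Y.X1 Z.X0 Z.X1
  f1 := assocBwd X.X1 X.X0 Y.X0 Y.X1 Z.X0 Z.X1
  comm0 := by
    refine LinearMap.prod_ext (BT.hom_ext_right (fun a b c => ?_) (fun a b c => ?_))
      (BT.hom_ext_right (fun a b c => ?_) (fun a b c => ?_)) <;>
    simp [assocBwd, tensor, bt_zero_right, bt_neg_right] <;>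
    simp only [← bt_neg_left, ← bt_add_left, Prod.neg_mk, Prod.mk_add_mk, add_zero, zero_add,
      neg_zero]
  comm1 := by
    refine LinearMap.prod_ext (BT.hom_ext_right (fun a b c => ?_) (fun a b c => ?_))
      (BT.hom_ext_right (fun a b c => ?_) (fun a b c => ?_)) <;>
    simp [assocBwd, tensor, bt_zero_right, bt_neg_right] <;>
    simp only [← bt_neg_left, ← bt_add_left, Prod.neg_mk, Prod.mk_add_mk, add_zero, zero_add,
      neg_zero]

theorem assocHom_assocInv (X Y Z : MF W) :
    (assocHom X Y Z).comp (assocInv X Y Z) = Hom.id _ :=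
  Hom.ext (assocBwd_comp _ _ _ _ _ _) (assocBwd_comp _ _ _ _ _ _)

theorem assocInv_assocHom (X Y Z : MF W) :
    (assocInv X Y Z).comp (assocHom X Y Z) = Hom.id _ :=
  Hom.ext (assocFwd_comp _ _ _ _ _ _) (assocFwd_comp _ _ _ _ _ _)

end MF

/-! ### Duals -/

section DualLemmas

variable {M N P : Type} [AddCommGroup M] [Module Bi M] [AddCommGroup N] [Module Bi N]
  [AddCommGroup P] [Module Bi P]

theorem dualMap_comp (f : M →ₗ[Bi] N) (g : N →ₗ[Bi] P) :
    dualMap (g ∘ₗ f) = dualMap f ∘ₗ dualMap g := rfl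

theorem dualMap_id : dualMap (LinearMap.id : M →ₗ[Bi] M) = LinearMap.id := rfl

theorem dualMap_add (f g : M →ₗ[Bi] N) : dualMap (f + g) = dualMap f + dualMap g := by
  refine LinearMap.ext fun ψ => BDual.ext fun m => ?_
  show ψ (f m + g m) = ψ (f m) + ψ (g m)
  exact map_add _ _ _

theorem dualMap_neg (f : M →ₗ[Bi] N) : dualMap (-f) = -dualMap f := by
  refine LinearMap.ext fun ψ => BDual.ext fun m => ?_
  show ψ (-f m) = -ψ (f m)
  exact map_neg _ _

theorem dualMap_pot (W : ℂ[X]) :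
    dualMap (pot W • LinearMap.id : M →ₗ[Bi] M) = -(pot W • LinearMap.id) := by
  refine LinearMap.ext fun ψ => BDual.ext fun m => ?_
  show ψ (pot W • m) = -(pot W • ψ) m
  rw [BDual.smul_apply, ← map_neg, ← neg_smul]
  congr 2
  simp [pot]

theorem bidual_natural (f : M →ₗ[Bi] N) : dualMap (dualMap f) ∘ₗ bidual M = bidual N ∘ₗ f := rfl

/-- The dual of a finitely generated free bimodule is free. -/
theorem BDual.free_finite [Module.Free Bi M] [Module.Finite Bi M] :
    Module.Free Bi (BDual M) ∧ Module.Finite Bi (BDual M) := by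
  let b := Module.Free.chooseBasis Bi M
  let F : BDual M →ₗ[Bi] (Module.Free.ChooseBasisIndex Bi M → Bi) :=
    { toFun := fun φ i => sig (φ (b i))
      map_add' := fun φ ψ => by
        funext i
        exact map_add sig (φ (b i)) (ψ (b i))
      map_smul' := fun u φ => by
        funext i
        rw [BDual.smul_apply, map_smul, smul_eq_mul, map_mul, sig_sig]; rfl }
  have hF : Function.Bijective F := by
    constructor
    · intro φ ψ h
      refine b.ext fun i => ?_
      have h' := congrArg sig (congrFun h i)
      exact (sig_sig _).symm.trans (h'.trans (sig_sig _))
    · intro v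
      refine ⟨b.constr ℕ fun i => sig (v i), ?_⟩
      funext i
      show sig (b.constr ℕ (fun i => sig (v i)) (b i)) = v i
      rw [b.constr_basis, sig_sig]
  let e := LinearEquiv.ofBijective F hF
  exact ⟨Module.Free.of_equiv e.symm, Module.Finite.equiv e.symm⟩

end DualLemmas

namespace MF

variable {W : ℂ[X]}

/-- The dual `X^∨`. -/
abbrev dual (X : MF W) : MF W where
  X0 := BDual X.X1
  X1 := BDual X.X0
  d0 := dualMap X.d0
  d1 := -dualMap X.d1
  d1_d0 := by
    rw [LinearMap.neg_comp, ← dualMap_comp, X.d0_d1, dualMap_pot, neg_neg]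
  d0_d1 := by
    rw [LinearMap.comp_neg, ← dualMap_comp, X.d1_d0, dualMap_pot, neg_neg]

/-- The dual `φ^∨ : Y^∨ → X^∨` of an even closed map `φ : X → Y`. -/
def Hom.dual {X Y : MF W} (f : Hom X Y) : Hom (MF.dual Y) (MF.dual X) where
  f0 := dualMap f.f1
  f1 := dualMap f.f0
  comm0 := by rw [← dualMap_comp, ← dualMap_comp, f.comm0]
  comm1 := by
    rw [LinearMap.comp_neg, LinearMap.neg_comp, ← dualMap_comp, ← dualMap_comp, f.comm1]

theorem Homotopic.dual {X Y : MF W} {f g : Hom X Y} (h : Homotopic f g) :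
    Homotopic f.dual g.dual := by
  obtain ⟨h0, h1, e0, e1⟩ := h
  refine ⟨-dualMap h0, dualMap h1, ?_, ?_⟩
  · simp only [Hom.dual, e1, dualMap_add, dualMap_comp, LinearMap.comp_neg, LinearMap.neg_comp,
      neg_neg]
    abel
  · simp only [Hom.dual, e0, dualMap_add, dualMap_comp, LinearMap.comp_neg, LinearMap.neg_comp,
      neg_neg]
    abel

/-- The canonical map `δ_X = (δ_{X0}, δ_{X1}) : X → X^∨∨`. -/
def delta (X : MF W) : Hom X (MF.dual (MF.dual X)) where
  f0 := bidual X.X0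
  f1 := bidual X.X1
  comm0 := rfl
  comm1 := by
    show (-dualMap (-dualMap X.d1)) ∘ₗ bidual X.X1 = bidual X.X0 ∘ₗ X.d1
    rw [dualMap_neg, neg_neg]; rfl

theorem EssFinite.unit (W : ℂ[X]) : EssFinite (unit W) :=
  ⟨MF.unit W, Module.Free.self Bi, Module.Finite.self Bi, Module.Free.self Bi,
    Module.Finite.self Bi, Hom.id _, Hom.id _, Homotopic.refl _, Homotopic.refl _⟩

theorem EssFinite.dual {X : MF W} : EssFinite X → EssFinite (MF.dual X) := by
  rintro ⟨Z, h1, h2, h3, h4, f, g, hf, hg⟩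
  exact ⟨MF.dual Z, (BDual.free_finite (M := Z.X1)).1, (BDual.free_finite (M := Z.X1)).2,
    (BDual.free_finite (M := Z.X0)).1, (BDual.free_finite (M := Z.X0)).2,
    g.dual, f.dual, Homotopic.dual hf, Homotopic.dual hg⟩

end MF

/-! ### The homotopy category -/

/-- The objects of `MF_bi(W)`: bi-factorisations of `W` that are homotopy equivalent to one by free
bimodules of finite rank. -/
structure MFbi (W : ℂ[X]) where
  toMF : MF W
  essFinite : toMF.EssFinite

namespace MFbi

variable {W : ℂ[X]}

/-- Morphisms are even closed maps modulo homotopy. -/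
instance : Category (MFbi W) where
  Hom X Y := Quotient (MF.homSetoid X.toMF Y.toMF)
  id X := Quotient.mk _ (MF.Hom.id X.toMF)
  comp f g := Quotient.map₂ MF.Hom.comp (fun _ _ hf _ _ hg => MF.Homotopic.comp hf hg) f g
  id_comp f := Quotient.inductionOn f fun _ => rfl
  comp_id f := Quotient.inductionOn f fun _ => rfl
  assoc f g h := Quotient.inductionOn₃ f g h fun _ _ _ => rfl

/-- The homotopy class of an even closed map. -/
def cls {X Y : MFbi W} (f : MF.Hom X.toMF Y.toMF) : X ⟶ Y :=
  Quotient.mk (MF.homSetoid X.toMF Y.toMF) f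

/-- The unit object. -/
def one (W : ℂ[X]) : MFbi W := ⟨MF.unit W, MF.EssFinite.unit W⟩

/-- The dual object. -/
def dual (X : MFbi W) : MFbi W := ⟨X.toMF.dual, X.essFinite.dual⟩

/-- The homotopy class of the dual map. -/
def dualHom {X Y : MFbi W} (f : X ⟶ Y) : dual Y ⟶ dual X :=
  Quotient.map MF.Hom.dual (fun _ _ h => MF.Homotopic.dual h) f

/-- The homotopy class of `δ_X`. -/
def delta (X : MFbi W) : X ⟶ dual (dual X) := cls X.toMF.delta

/-- Tensor products of objects of `MF_bi(W)` stay in `MF_bi(W)`. -/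
def TensorClosed (W : ℂ[X]) : Prop :=
  ∀ X Y : MF W, X.EssFinite → Y.EssFinite → (X.tensor Y).EssFinite

section Struct

variable (hT : TensorClosed W)

/-- The tensor product of objects. -/
def tens (X Y : MFbi W) : MFbi W := ⟨X.toMF.tensor Y.toMF, hT _ _ X.essFinite Y.essFinite⟩

/-- `λ_X` -/
def lam (X : MFbi W) : tens hT (one W) X ⟶ X := cls X.toMF.leftUnitor

/-- `ρ_X` -/
def rho (X : MFbi W) : tens hT X (one W) ⟶ X := cls X.toMF.rightUnitor

/-- `X ⊗ f` -/
def whiskL (X : MFbi W) {Y Z : MFbi W} (f : Y ⟶ Z) : tens hT X Y ⟶ tens hT X Z :=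
  Quotient.map (fun g => (MF.Hom.id X.toMF).tensor g)
    (fun _ _ h => MF.Homotopic.whiskerLeft X.toMF h) f

/-- `f ⊗ Z` -/
def whiskR {X Y : MFbi W} (f : X ⟶ Y) (Z : MFbi W) : tens hT X Z ⟶ tens hT Y Z :=
  Quotient.map (fun g => MF.Hom.tensor g (MF.Hom.id Z.toMF))
    (fun _ _ h => MF.Homotopic.whiskerRight Z.toMF h) f

/-- The associator. -/
def assoc (X Y Z : MFbi W) : tens hT (tens hT X Y) Z ≅ tens hT X (tens hT Y Z) where
  hom := cls (MF.assocHom X.toMF Y.toMF Z.toMF)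
  inv := cls (MF.assocInv X.toMF Y.toMF Z.toMF)
  hom_inv_id := congrArg cls (MF.assocHom_assocInv X.toMF Y.toMF Z.toMF)
  inv_hom_id := congrArg cls (MF.assocInv_assocHom X.toMF Y.toMF Z.toMF)

/-- The tensor product `φ ⊗ ψ` of two classes is represented by `φ ⊗ ψ` of the representatives. -/
def tensHom {X Y X' Y' : MFbi W} (f : X ⟶ Y) (g : X' ⟶ Y') : tens hT X X' ⟶ tens hT Y Y' :=
  Quotient.map₂ MF.Hom.tensor (fun f f' hf g g' hg => by
    have h1 := MF.Homotopic.comp (MF.Homotopic.whiskerRight X'.toMF hf)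
      (MF.Homotopic.whiskerLeft Y.toMF hg)
    have e : ∀ (p : MF.Hom X.toMF Y.toMF) (q : MF.Hom X'.toMF Y'.toMF),
        (p.tensor (MF.Hom.id X'.toMF)).comp ((MF.Hom.id Y.toMF).tensor q) = p.tensor q := by
      intro p q
      refine MF.Hom.ext ?_ ?_ <;>
      · simp only [MF.Hom.comp, MF.Hom.tensor, MF.Hom.id, blk_comp, BT.map_comp,
          LinearMap.id_comp, LinearMap.comp_id, LinearMap.comp_zero, LinearMap.zero_comp,
          add_zero, zero_add]
    rwa [e, e] at h1) f g

/-- The data of the monoidal structure, once the unitors are known to be isomorphisms. -/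
abbrev monStruct (hL : ∀ X : MFbi W, IsIso (lam hT X)) (hR : ∀ X : MFbi W, IsIso (rho hT X)) :
    MonoidalCategoryStruct (MFbi W) where
  tensorObj := tens hT
  tensorUnit := one W
  whiskerLeft X _ _ f := whiskL hT X f
  whiskerRight f Z := whiskR hT f Z
  tensorHom f g := tensHom hT f g
  associator := assoc hT
  leftUnitor X := @asIso _ _ _ _ (lam hT X) (hL X)
  rightUnitor X := @asIso _ _ _ _ (rho hT X) (hR X)

end Struct

end MFbi

/-! ### Matrices, coevaluation and evaluation -/

/-- A bi-factorisation of `W` given by two matrices over `R ⊗ R`. -/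
structure MatFact (W : ℂ[X]) where
  n0 : ℕ
  n1 : ℕ
  D0 : Matrix (Fin n1) (Fin n0) Bi
  D1 : Matrix (Fin n0) (Fin n1) Bi
  D1_D0 : D1 * D0 = pot W • 1
  D0_D1 : D0 * D1 = pot W • 1

theorem toLin_pot {m n : ℕ} (W : ℂ[X]) (A : Matrix (Fin m) (Fin n) Bi)
    (B : Matrix (Fin n) (Fin m) Bi) (h : A * B = pot W • 1) :
    A.mulVecLin ∘ₗ B.mulVecLin = pot W • LinearMap.id := by
  rw [← Matrix.mulVecLin_mul, h]
  ext i
  simp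

section Ins

variable {M N : Type} [AddCommGroup M] [Module Bi M] [AddCommGroup N] [Module Bi N]

theorem C_smul_bt (c : ℂ) (m : M) (n : N) :
    inr (Polynomial.C c) • bt m n = bt (inr (Polynomial.C c) • m) n := by
  rw [inr_smul_bt, bt_balanced, inl_C]

theorem smul_eq_inr_mul (c : ℂ) (u : Bi) : c • u = inr (Polynomial.C c) * u := by
  rw [Algebra.smul_def]; congr 1; exact (inr.commutes c).symm

/-- For `p(left, right)` in `R ⊗ R` this is `(p(a, x) - p(b, x)) / (a - b)` acting on `m ⊗ n`, where
`a` acts from the left on `m`, `x` acts in the middle, and `b` acts from the right on `n`: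
`r ⊗ s ↦ dd(r) • ((m.s) ⊗ n)`. -/
def ddMid (m : M) (n : N) : Bi →+ BT M N :=
  (TensorProduct.liftAddHom (R := ℂ) (M := ℂ[X]) (N := ℂ[X])
    (mkBi (fun r s => dd r • bt (inr s • m) n)
      (fun r r' s => by rw [map_add, add_smul])
      (fun r s s' => by rw [map_add, add_smul, bt_add_left, smul_add]))
    (fun c r s => by
      rw [mkBi_apply, mkBi_apply, map_smul, smul_eq_inr_mul, mul_comm, mul_smul, C_smul_bt,
        smul_smul, ← map_mul, Polynomial.smul_eq_C_mul]) : ℂ[X] ⊗[ℂ] ℂ[X] →+ BT M N)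

theorem ddMid_apply (m : M) (n : N) (r s : ℂ[X]) :
    ddMid m n (inl r * inr s) = dd r • bt (inr s • m) n := by
  rw [inl_mul_inr]; rfl

end Ins

/-- `p(left, right) ↦ p(x, a)`, a polynomial in `x` with coefficients in `R ⊗ R` -/
def atLeft : Bi →ₐ[ℂ] Polynomial Bi :=
  Bi.lift (Polynomial.aeval Polynomial.X) (Polynomial.aeval (Polynomial.C (inl Polynomial.X)))

/-- `p(left, right) ↦ p(x, b)`, a polynomial in `x` with coefficients in `R ⊗ R` -/
def atRight : Bi →ₐ[ℂ] Polynomial Bi :=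
  Bi.lift (Polynomial.aeval Polynomial.X) (Polynomial.aeval (Polynomial.C (inr Polynomial.X)))

/-- The monic polynomial `x (W(x) - W(b)) / w`, with `w` the leading coefficient of `W`. -/
def denom (W : ℂ[X]) : Polynomial Bi :=
  Polynomial.C (algebraMap ℂ Bi W.leadingCoeff⁻¹) *
    (Polynomial.X * (W.map (algebraMap ℂ Bi) - Polynomial.C (inr W)))

/-- The contour integral `(1/2πi) ∮ (a - b - x) p(x) / (x (W(x) - W(b))) dx` around all poles, for a
polynomial `p` in `x` with coefficients in `ℂ[a, b]`. It is minus the residue at infinity: the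
coefficient of `x ^ (deg W)` in the remainder of the numerator modulo the denominator, divided by
the leading coefficient of the denominator. -/
def res (W : ℂ[X]) (p : Polynomial Bi) : Bi :=
  algebraMap ℂ Bi W.leadingCoeff⁻¹ *
    (((Polynomial.C (inl Polynomial.X - inr Polynomial.X) - Polynomial.X) * p) %ₘ
      denom W).coeff W.natDegree

/-- The `i`-th dual basis vector of the free module of rank `n`. -/
def coord {n : ℕ} (i : Fin n) : BDual (Fin n → Bi) :=
  (LinearMap.proj i : (Fin n → Bi) →ₗ[Bi] Bi)

/-- For `φ ∈ (Bi^n)^∨` and `z ∈ Bi^n` the polynomial `∑ i, φ(e_i)(x, a) z_i(x, b)`. -/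
def pairPoly {n : ℕ} (φ : BDual (Fin n → Bi)) (z : Fin n → Bi) : Polynomial Bi :=
  ∑ i, atLeft (φ (Pi.single i 1)) * atRight (z i)

namespace MatFact

variable {W : ℂ[X]} (Z : MatFact W)

/-- The bi-factorisation by free modules with differentials `D0` and `D1`. -/
abbrev toMF : MF W where
  X0 := Fin Z.n0 → Bi
  X1 := Fin Z.n1 → Bi
  d0 := Z.D0.mulVecLin
  d1 := Z.D1.mulVecLin
  d1_d0 := toLin_pot W _ _ Z.D1_D0
  d0_d1 := toLin_pot W _ _ Z.D0_D1

/-- The corresponding object of `MF_bi(W)`. -/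
def toMFbi : MFbi W :=
  ⟨Z.toMF, Z.toMF, inferInstanceAs (Module.Free Bi (Fin Z.n0 → Bi)),
    inferInstanceAs (Module.Finite Bi (Fin Z.n0 → Bi)),
    inferInstanceAs (Module.Free Bi (Fin Z.n1 → Bi)),
    inferInstanceAs (Module.Finite Bi (Fin Z.n1 → Bi)),
    MF.Hom.id _, MF.Hom.id _, MF.Homotopic.refl _, MF.Homotopic.refl _⟩

/-- The even closed map `c : I → Z ⊗ Z^∨` is the coevaluation: in terms of the standard bases,
`c(1) = ∑ e_l ⊗ e_l^*` on `I1` and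
`c(1) = ∑ (D(a, x) - D(b, x))_{ml} / (a - b) • e_m ⊗ e_l^*` on `I0`. -/
def IsCoev (c : MF.Hom (MF.unit W) (Z.toMF.tensor Z.toMF.dual)) : Prop :=
  c.f0 (1 : Bi) =
    (∑ m : Fin Z.n0, ∑ l : Fin Z.n1,
        ddMid (Pi.single m (1 : Bi) : Fin Z.n0 → Bi) (coord l) (Z.D1 m l),
      ∑ m : Fin Z.n1, ∑ l : Fin Z.n0,
        ddMid (Pi.single m (1 : Bi) : Fin Z.n1 → Bi) (coord l) (Z.D0 m l)) ∧
  c.f1 (1 : Bi) =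
    (∑ l : Fin Z.n1, bt (Pi.single l (1 : Bi) : Fin Z.n1 → Bi) (coord l),
      ∑ m : Fin Z.n0, bt (Pi.single m (1 : Bi) : Fin Z.n0 → Bi) (coord m))

/-- The even closed map `e : Z^∨ ⊗ Z → I` is the evaluation, given by the residues `res`. Its value on
`I1` is determined by the third equation because `a - b` is not a zero divisor in `R ⊗ R`. -/
def IsEv (e : MF.Hom (Z.toMF.dual.tensor Z.toMF) (MF.unit W)) : Prop :=
  (∀ (φ : BDual (Fin Z.n1 → Bi)) (z : Fin Z.n0 → Bi),
    e.f0 (bt φ z, 0) = -res W (pairPoly φ (Z.D0.mulVec z))) ∧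
  (∀ (φ : BDual (Fin Z.n0 → Bi)) (z : Fin Z.n1 → Bi), e.f0 (0, bt φ z) = (0 : Bi)) ∧
  (∀ (φ : BDual (Fin Z.n0 → Bi)) (z : Fin Z.n0 → Bi),
    (inl Polynomial.X - inr Polynomial.X) * (e.f1 (bt φ z, 0) : Bi) =
      res W (pairPoly (dualMap Z.D1.mulVecLin φ) (Z.D0.mulVec z))) ∧
  (∀ (φ : BDual (Fin Z.n1 → Bi)) (z : Fin Z.n1 → Bi),
    e.f1 (0, bt φ z) = -(pairPoly φ z).eval 0)

end MatFact

namespace MFbi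

variable {W : ℂ[X]} (hT : TensorClosed W)

/-- `η = (ϑ⁻¹ ⊗ ϑ^∨) ∘ coev_Z` for every isomorphism `ϑ : X → Z` to a matrix object. -/
def IsCoev (X : MFbi W) (η : one W ⟶ tens hT X (dual X)) : Prop :=
  ∀ (Z : MatFact W) (ϑ : X ≅ Z.toMFbi),
    ∃ c : MF.Hom (MF.unit W) (Z.toMF.tensor Z.toMF.dual), Z.IsCoev c ∧
      η = (cls c : one W ⟶ tens hT Z.toMFbi (dual Z.toMFbi)) ≫
        tensHom hT ϑ.inv (dualHom ϑ.hom)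

/-- `ε = ev_Z ∘ ((ϑ⁻¹)^∨ ⊗ ϑ)` for every isomorphism `ϑ : X → Z` to a matrix object. -/
def IsEv (X : MFbi W) (ε : tens hT (dual X) X ⟶ one W) : Prop :=
  ∀ (Z : MatFact W) (ϑ : X ≅ Z.toMFbi),
    ∃ e : MF.Hom (Z.toMF.dual.tensor Z.toMF) (MF.unit W), Z.IsEv e ∧
      ε = tensHom hT (dualHom ϑ.inv) ϑ.hom ≫
        (cls e : tens hT (dual Z.toMFbi) Z.toMFbi ⟶ one W)

end MFbi

end MFBi

/-! ### Pivotal structures on right rigid monoidal categories -/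

namespace PivotalCat

/-- The axioms of a monoidal category, for given tensor product, unit, associator and unitors. -/
structure MonoidalLaws (C : Type*) [Category C] [MonoidalCategoryStruct C] : Prop where
  tensorHom_def : ∀ {X₁ Y₁ X₂ Y₂ : C} (f : X₁ ⟶ Y₁) (g : X₂ ⟶ Y₂),
    f ⊗ₘ g = (f ▷ X₂) ≫ (Y₁ ◁ g)
  id_tensorHom_id : ∀ X₁ X₂ : C, 𝟙 X₁ ⊗ₘ 𝟙 X₂ = 𝟙 (X₁ ⊗ X₂)
  tensorHom_comp_tensorHom :
    ∀ {X₁ Y₁ Z₁ X₂ Y₂ Z₂ : C} (f₁ : X₁ ⟶ Y₁) (f₂ : X₂ ⟶ Y₂) (g₁ : Y₁ ⟶ Z₁) (g₂ : Y₂ ⟶ Z₂),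
      (f₁ ⊗ₘ f₂) ≫ (g₁ ⊗ₘ g₂) = (f₁ ≫ g₁) ⊗ₘ (f₂ ≫ g₂)
  whiskerLeft_id : ∀ (X Y : C), X ◁ 𝟙 Y = 𝟙 (X ⊗ Y)
  id_whiskerRight : ∀ (X Y : C), 𝟙 X ▷ Y = 𝟙 (X ⊗ Y)
  associator_naturality :
    ∀ {X₁ X₂ X₃ Y₁ Y₂ Y₃ : C} (f₁ : X₁ ⟶ Y₁) (f₂ : X₂ ⟶ Y₂) (f₃ : X₃ ⟶ Y₃),
      ((f₁ ⊗ₘ f₂) ⊗ₘ f₃) ≫ (α_ Y₁ Y₂ Y₃).hom = (α_ X₁ X₂ X₃).hom ≫ (f₁ ⊗ₘ (f₂ ⊗ₘ f₃))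
  leftUnitor_naturality :
    ∀ {X Y : C} (f : X ⟶ Y), 𝟙_ C ◁ f ≫ (λ_ Y).hom = (λ_ X).hom ≫ f
  rightUnitor_naturality :
    ∀ {X Y : C} (f : X ⟶ Y), f ▷ 𝟙_ C ≫ (ρ_ Y).hom = (ρ_ X).hom ≫ f
  pentagon : ∀ W X Y Z : C,
    (α_ W X Y).hom ▷ Z ≫ (α_ W (X ⊗ Y) Z).hom ≫ W ◁ (α_ X Y Z).hom =
      (α_ (W ⊗ X) Y Z).hom ≫ (α_ W X (Y ⊗ Z)).hom
  triangle : ∀ X Y : C, (α_ X (𝟙_ C) Y).hom ≫ X ◁ (λ_ Y).hom = (ρ_ X).hom ▷ Y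

/-- The monoidal category with the given structure. -/
abbrev MonoidalLaws.toMonoidalCategory {C : Type*} [Category C] [s : MonoidalCategoryStruct C]
    (h : MonoidalLaws C) : MonoidalCategory C :=
  { s with
    tensorHom_def := h.tensorHom_def
    id_tensorHom_id := h.id_tensorHom_id
    tensorHom_comp_tensorHom := h.tensorHom_comp_tensorHom
    whiskerLeft_id := h.whiskerLeft_id
    id_whiskerRight := h.id_whiskerRight
    associator_naturality := h.associator_naturality
    leftUnitor_naturality := h.leftUnitor_naturality
    rightUnitor_naturality := h.rightUnitor_naturality
    pentagon := h.pentagon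
    triangle := h.triangle }

/-- A choice of right duals `X^∨` with (co)evaluations `𝟙 → X ⊗ X^∨` and `X^∨ ⊗ X → 𝟙` satisfying the
two zig-zag (Zorro) identities. -/
structure RightDuality (C : Type*) [Category C] [MonoidalCategory C] where
  dual : C → C
  pairing : ∀ X : C, ExactPairing X (dual X)

namespace RightDuality

variable {C : Type*} [Category C] [MonoidalCategory C] (D : RightDuality C)

/-- `coev_X` -/
def coev (X : C) : 𝟙_ C ⟶ X ⊗ D.dual X := (D.pairing X).coevaluation'

/-- `ev_X` -/
def ev (X : C) : D.dual X ⊗ X ⟶ 𝟙_ C := (D.pairing X).evaluation'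

/-- The dual `f^∨ : Y^∨ → X^∨` of `f : X → Y`. -/
def map {X Y : C} (f : X ⟶ Y) : D.dual Y ⟶ D.dual X :=
  (ρ_ _).inv ≫ D.dual Y ◁ D.coev X ≫ D.dual Y ◁ f ▷ D.dual X ≫ (α_ _ _ _).inv ≫
    D.ev Y ▷ D.dual X ≫ (λ_ _).hom

theorem map_eq {X Y : C} (f : X ⟶ Y) :
    D.map f = @rightAdjointMate C _ _ X Y (@HasRightDual.mk _ _ _ X (D.dual X) (D.pairing X))
      (@HasRightDual.mk _ _ _ Y (D.dual Y) (D.pairing Y)) f := rfl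

/-- `ν²_{X,Y} : X^∨ ⊗ Y^∨ → (Y ⊗ X)^∨` -/
def nu2 (X Y : C) : D.dual X ⊗ D.dual Y ≅ D.dual (Y ⊗ X) :=
  (rightDualIso (D.pairing (Y ⊗ X))
    (@ExactPairing.tensor C _ _ Y X (D.dual Y) (D.dual X) (D.pairing Y) (D.pairing X))).symm

/-- `ν²_{X,Y}` is obtained from `coev_{Y ⊗ X}` by contracting with `ev_Y` and then with `ev_X`. -/
theorem nu2_hom (X Y : C) : (D.nu2 X Y).hom =
    D.dual X ◁ (ρ_ (D.dual Y)).inv ≫ D.dual X ◁ D.dual Y ◁ D.coev (Y ⊗ X) ≫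
      D.dual X ◁ ((α_ _ _ _).inv ≫ (α_ _ _ _).inv ▷ _) ≫
      D.dual X ◁ (D.ev Y ▷ X) ▷ D.dual (Y ⊗ X) ≫
      D.dual X ◁ (λ_ X).hom ▷ D.dual (Y ⊗ X) ≫ (α_ _ _ _).inv ≫
      D.ev X ▷ D.dual (Y ⊗ X) ≫ (λ_ _).hom := by
  show (ρ_ _).inv ≫ (D.dual X ⊗ D.dual Y) ◁ D.coev (Y ⊗ X) ≫
    (D.dual X ⊗ D.dual Y) ◁ (𝟙 (Y ⊗ X)) ▷ D.dual (Y ⊗ X) ≫ (α_ _ _ _).inv ≫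
    (𝟙 _ ⊗≫ D.dual X ◁ (D.ev Y ▷ X) ⊗≫ D.ev X) ▷ D.dual (Y ⊗ X) ≫ (λ_ _).hom = _
  monoidal

/-- `ν⁰ : 𝟙 → 𝟙^∨` -/
def nu0 : 𝟙_ C ≅ D.dual (𝟙_ C) := rightDualIso exactPairingUnit (D.pairing (𝟙_ C))

theorem nu0_hom : D.nu0.hom = D.coev (𝟙_ C) ≫ (λ_ (D.dual (𝟙_ C))).hom := by
  show (ρ_ _).inv ≫ 𝟙_ C ◁ D.coev (𝟙_ C) ≫ 𝟙_ C ◁ (𝟙 (𝟙_ C)) ▷ D.dual (𝟙_ C) ≫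
    (α_ _ _ _).inv ≫ (ρ_ (𝟙_ C)).hom ▷ D.dual (𝟙_ C) ≫ (λ_ _).hom = _
  monoidal

/-- `ω²_{X,Y} : X^∨∨ ⊗ Y^∨∨ → (X ⊗ Y)^∨∨` -/
def omega2 (X Y : C) :
    D.dual (D.dual X) ⊗ D.dual (D.dual Y) ⟶ D.dual (D.dual (X ⊗ Y)) :=
  (D.nu2 (D.dual X) (D.dual Y)).hom ≫ D.map (D.nu2 Y X).inv

/-- `ω⁰ : 𝟙 → 𝟙^∨∨` -/
def omega0 : 𝟙_ C ⟶ D.dual (D.dual (𝟙_ C)) := D.nu0.hom ≫ D.map D.nu0.inv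

/-- `t` is a pivotal structure: a monoidal natural isomorphism from the identity functor to the
double dual functor with monoidal structure `(ω², ω⁰)`. -/
structure IsPivotal (t : ∀ X : C, X ⟶ D.dual (D.dual X)) : Prop where
  isIso : ∀ X : C, IsIso (t X)
  natural : ∀ {X Y : C} (f : X ⟶ Y), t X ≫ D.map (D.map f) = f ≫ t Y
  tensor : ∀ X Y : C, (t X ⊗ₘ t Y) ≫ D.omega2 X Y = t (X ⊗ Y)
  unit : t (𝟙_ C) = D.omega0

end RightDuality

end PivotalCat

end

/-! The finiteness of R/(W') enters as deg W > 0 (`natDegree_pos_of_finite`). Up to a nonzero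
constant, W(a) - W(b) is then a monic polynomial in b over ℂ[a], and the algebra rests on this.

Closure and unitors. For a matrix object Z both differentials are injective. The cokernel of d1 is
finitely generated and torsion free over the left factor R, hence free, so d1 splits left
R-linearly. Tensoring with a free bimodule Y turns this into a splitting by bimodule maps, because M
⊗_R (R ⊗ R) depends only on the left structure of M. Then Z ⊗ Y contracts onto coker(d1) ⊗_R Y,
which is free of finite rank (`Hom.exists_inverse_left`, `MatFact.hEquiv_cokerTensor`). The same
contraction with I in place of Z, where the cokernel of a - b is R, inverts λ; its mirror image
inverts ρ.

Zig-zag identities. Since d1 is injective on a matrix object, closed maps into it are homotopic once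
their even parts agree modulo the image of d1 (`Homotopic.of_range`). For maps into I this means
agreement after μ. Modulo homotopy the evaluation is therefore the residue pairing φ ⊗ z ↦ `Res` φ(d
z) on Z1^∨ ⊗ Z0, and zero on the other even summand. Contracting the difference quotients of the
coevaluation with it gives the commutator of the matrix D1 with an operator κ (`star_dd`). That
operator satisfies κ((W(a) - W(b)) u) = -u (`kapBi_pot_mul`). As D1 D0 = W(a) - W(b), the composite
sends z to d1(κ(d0 z)) + z, which is z up to homotopy.

General objects. The duality is transported along an isomorphism with a matrix object. The residue
pairing is dinatural (`IsResEv.dinatural`), so the choice does not matter for the evaluation, nor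
for the coevaluation, which the evaluation determines (`coevaluation_unique`). Dinaturality also
identifies the categorical dual of a morphism with the componentwise one.

Pivotality. A map into X^∨ is determined by its contraction with the evaluation, hence by residues
of its even part (`cls_eq_of_Res`). This identifies ν⁰ with u ↦ σ(u)·(-), through the reproducing
property `Res_dd_mul`. It identifies ν² with an explicit map built from the residue in the middle
variable, `star`. Compatibility of δ with tensor products is then an equality of two iterated
residues (`Res_star_sig`). It holds because the one-variable residue `tau` is linear over ℂ[W] and
takes values in ℂ[W] (`tau_tau_mul`). -/

noncomputable section

namespace MFBi

/-! ### The ring `R ⊗ R` -/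

/-- `R ⊗ R` as the polynomial ring over the left factor. -/
def Bi.toPoly : Bi ≃ₐ[ℂ] ℂ[X][X] := (polyEquivTensor ℂ ℂ[X]).symm

theorem Bi.toPoly_inl (r : ℂ[X]) : Bi.toPoly (inl r) = Polynomial.C r := by
  refine (polyEquivTensor_symm_apply_tmul ℂ ℂ[X] r 1).trans ?_
  rw [← Polynomial.C_1, Polynomial.sum_C_index] <;> simp

theorem Bi.toPoly_inr (s : ℂ[X]) : Bi.toPoly (inr s) = s.map Polynomial.C := by
  refine (polyEquivTensor_symm_apply_tmul ℂ ℂ[X] 1 s).trans ?_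
  rw [Polynomial.map, Polynomial.eval₂_eq_sum]
  simp [Polynomial.C_mul_X_pow_eq_monomial, Polynomial.algebraMap_eq]

instance : IsDomain Bi := Bi.toPoly.toMulEquiv.isDomain _

theorem natDegree_potPoly (W : ℂ[X]) :
    (Bi.toPoly (-pot W)).natDegree = W.natDegree := by
  rw [pot, neg_sub, map_sub, Bi.toPoly_inl, Bi.toPoly_inr, Polynomial.natDegree_sub_C,
    Polynomial.natDegree_map_eq_of_injective Polynomial.C_injective]

/-- `-(W ⊗ 1 - 1 ⊗ W)`, normalized to a monic polynomial. -/
def monicPot (W : ℂ[X]) : ℂ[X][X] :=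
  Polynomial.C (Polynomial.C W.leadingCoeff⁻¹) * Bi.toPoly (-pot W)

theorem monicPot_monic {W : ℂ[X]} (hW : 0 < W.natDegree) : (monicPot W).Monic := by
  have hw : W.leadingCoeff ≠ 0 := by
    rw [Ne, Polynomial.leadingCoeff_eq_zero]; rintro rfl; simp at hW
  refine Polynomial.monic_C_mul_of_mul_leadingCoeff_eq_one ?_
  rw [show (Bi.toPoly (-pot W)).leadingCoeff = (Bi.toPoly (-pot W)).coeff
    (Bi.toPoly (-pot W)).natDegree from rfl, natDegree_potPoly W, pot, neg_sub, map_sub, Bi.toPoly_inl,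
    Bi.toPoly_inr, Polynomial.coeff_sub, Polynomial.coeff_map, Polynomial.coeff_C_of_ne_zero hW.ne',
    sub_zero, ← Polynomial.C_mul]
  exact (congrArg Polynomial.C (inv_mul_cancel₀ hw)).trans Polynomial.C_1

theorem natDegree_monicPot {W : ℂ[X]} (hW : 0 < W.natDegree) :
    (monicPot W).natDegree = W.natDegree := by
  have hw : W.leadingCoeff ≠ 0 := by
    rw [Ne, Polynomial.leadingCoeff_eq_zero]; rintro rfl; simp at hW
  rw [monicPot, Polynomial.natDegree_C_mul (by simpa using hw), natDegree_potPoly W]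

theorem pot_ne_zero {W : ℂ[X]} (hW : 0 < W.natDegree) : pot W ≠ 0 := by
  intro h
  have := natDegree_potPoly W
  rw [h, neg_zero, map_zero, Polynomial.natDegree_zero] at this
  omega

theorem toPoly_dvd {W : ℂ[X]} {u : Bi} (h : monicPot W ∣ Bi.toPoly u) : pot W ∣ u := by
  obtain ⟨q, hq⟩ := h
  refine ⟨-(inl (Polynomial.C W.leadingCoeff⁻¹) * Bi.toPoly.symm q), ?_⟩
  apply Bi.toPoly.injective
  rw [hq, monicPot, map_mul, map_neg, map_neg, map_mul, Bi.toPoly_inl, AlgEquiv.apply_symm_apply]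
  ring

theorem dvd_toPoly {W : ℂ[X]} (hW : 0 < W.natDegree) {u : Bi} (h : pot W ∣ u) :
    monicPot W ∣ Bi.toPoly u := by
  have hw : W.leadingCoeff ≠ 0 := by
    rw [Ne, Polynomial.leadingCoeff_eq_zero]; rintro rfl; simp at hW
  obtain ⟨q, rfl⟩ := h
  refine ⟨-(Polynomial.C (Polynomial.C W.leadingCoeff) * Bi.toPoly q), ?_⟩
  have e : Polynomial.C (Polynomial.C W.leadingCoeff⁻¹) *
      Polynomial.C (Polynomial.C W.leadingCoeff) = (1 : ℂ[X][X]) := by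
    rw [← Polynomial.C_mul, ← Polynomial.C_mul, inv_mul_cancel₀ hw]; simp
  rw [monicPot, map_mul, map_neg]
  linear_combination (-Bi.toPoly (pot W) * Bi.toPoly q) * e

/-- `R ⊗ R` modulo `W ⊗ 1 - 1 ⊗ W` is torsion free over the left factor. -/
theorem pot_dvd_of_inl_mul {W : ℂ[X]} (hW : 0 < W.natDegree) {r : ℂ[X]} (hr : r ≠ 0) {v : Bi}
    (h : pot W ∣ inl r * v) : pot W ∣ v := by
  refine toPoly_dvd ?_
  have h' := dvd_toPoly hW h
  rw [map_mul, Bi.toPoly_inl, ← Polynomial.smul_eq_C_mul] at h'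
  have hm := monicPot_monic hW
  -- Division with remainder by a monic polynomial is linear over the coefficient ring, so the
  -- scalar r can be cancelled from the remainder.
  rw [← Polynomial.modByMonic_eq_zero_iff_dvd hm] at h' ⊢
  rw [Polynomial.smul_modByMonic] at h'
  exact (smul_eq_zero.1 h').resolve_left hr

/-- `R ⊗ R` modulo `W ⊗ 1 - 1 ⊗ W` is generated over the left factor by the polynomials of bounded
degree. -/
theorem exists_lowDegree {W : ℂ[X]} (hW : 0 < W.natDegree) (u : Bi) :
    ∃ p ∈ Polynomial.degreeLT ℂ[X] W.natDegree, pot W ∣ u - Bi.toPoly.symm p := by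
  have hm := monicPot_monic hW
  refine ⟨Bi.toPoly u %ₘ monicPot W, ?_, toPoly_dvd ?_⟩
  · rw [Polynomial.mem_degreeLT, ← natDegree_monicPot hW,
      ← Polynomial.degree_eq_natDegree hm.ne_zero]
    exact Polynomial.degree_modByMonic_lt _ hm
  · rw [map_sub, AlgEquiv.apply_symm_apply]
    nth_rw 1 [← Polynomial.modByMonic_add_div (Bi.toPoly u) (monicPot W)]
    rw [add_sub_cancel_left]
    exact dvd_mul_right _ _

theorem pot_X_ne_zero : pot Polynomial.X ≠ 0 := pot_ne_zero (by simp)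

theorem pot_eq_dd_mul (r : ℂ[X]) : pot r = pot Polynomial.X * dd r := by
  rw [← dd_mul r, mul_comm]; rfl

/-- Modulo a - b the left variable may be replaced by the right one; on r ⊗ s the quotient is the
difference quotient of r. -/
theorem mu_dvd (u : Bi) : pot Polynomial.X ∣ u - inr (mu u) := by
  induction u using Bi.induction with
  | h1 r s =>
    refine ⟨dd r * inr s, ?_⟩
    rw [← mul_assoc, ← pot_eq_dd_mul, pot, map_mul, mu_inl, mu_inr, map_mul]
    ring
  | h2 u v hu hv =>
    rw [map_add, map_add]
    convert dvd_add hu hv using 1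
    ring

theorem mu_eq_zero_iff (u : Bi) : mu u = 0 ↔ pot Polynomial.X ∣ u := by
  constructor
  · intro h
    have := mu_dvd u
    rwa [h, map_zero, sub_zero] at this
  · rintro ⟨v, rfl⟩
    rw [map_mul, mu_pot, zero_mul]

theorem mu_sig (u : Bi) : mu (sig u) = mu u := by
  induction u using Bi.induction with
  | h1 r s => simp only [map_mul, sig_inl, sig_inr, mu_inl, mu_inr]
  | h2 u v hu hv => rw [map_add, map_add, map_add, hu, hv]

/-- The twisted Leibniz rule, checked after multiplication by the nonzero divisor a - b. Exchanging
r and s gives a second expansion of the same element; comparing the two is what makes `Res_dd_mul`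
work. -/
theorem dd_mul' (r s : ℂ[X]) : dd (r * s) = inl r * dd s + inr s * dd r := by
  apply mul_left_cancel₀ pot_X_ne_zero
  rw [mul_add, mul_left_comm, mul_left_comm _ (inr s), ← pot_eq_dd_mul, ← pot_eq_dd_mul,
    ← pot_eq_dd_mul]
  simp only [pot, map_mul]; ring

theorem sig_pot (r : ℂ[X]) : sig (pot r) = -pot r := by simp [pot]

theorem sig_dd (r : ℂ[X]) : sig (dd r) = dd r := by
  apply mul_left_cancel₀ (neg_ne_zero.2 pot_X_ne_zero)
  nth_rw 1 [← sig_pot]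
  rw [← map_mul, ← pot_eq_dd_mul, sig_pot, pot_eq_dd_mul]
  ring

/-- The linear map `r ⊗ s ↦ f(r) g(s)`. -/
def Bi.mulMap {A : Type} [CommRing A] [Algebra ℂ A] (f g : ℂ[X] →ₗ[ℂ] A) : Bi →ₗ[ℂ] A :=
  (LinearMap.mul' ℂ A ∘ₗ TensorProduct.map f g : ℂ[X] ⊗[ℂ] ℂ[X] →ₗ[ℂ] A)

theorem Bi.mulMap_apply {A : Type} [CommRing A] [Algebra ℂ A] (f g : ℂ[X] →ₗ[ℂ] A) (r s : ℂ[X]) :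
    Bi.mulMap f g (inl r * inr s) = f r * g s := by
  rw [inl_mul_inr]; rfl

/-! ### Residues -/

section Res

variable {W : ℂ[X]}

theorem leadingCoeff_ne_zero_of_pos (hW : 0 < W.natDegree) : W.leadingCoeff ≠ 0 := by
  rw [Ne, Polynomial.leadingCoeff_eq_zero]; rintro rfl; simp at hW

/-- `W(x) - W(b)` as a polynomial in `x` -/
def diffPoly (W : ℂ[X]) : Polynomial Bi := W.map (algebraMap ℂ Bi) - Polynomial.C (inr W)

theorem natDegree_diffPoly (W : ℂ[X]) : (diffPoly W).natDegree = W.natDegree := by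
  rw [diffPoly, Polynomial.natDegree_sub_C,
    Polynomial.natDegree_map_eq_of_injective (algebraMap ℂ Bi).injective]

theorem coeff_diffPoly (hW : 0 < W.natDegree) :
    (diffPoly W).coeff W.natDegree = algebraMap ℂ Bi W.leadingCoeff := by
  rw [diffPoly, Polynomial.coeff_sub, Polynomial.coeff_map, Polynomial.coeff_C_of_ne_zero hW.ne',
    sub_zero]; rfl

theorem denom_eq (W : ℂ[X]) : denom W =
    Polynomial.X * (Polynomial.C (algebraMap ℂ Bi W.leadingCoeff⁻¹) * diffPoly W) := by
  rw [denom, diffPoly]; ring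

theorem inv_mul_algebraMap (hW : 0 < W.natDegree) :
    algebraMap ℂ Bi W.leadingCoeff⁻¹ * algebraMap ℂ Bi W.leadingCoeff = 1 := by
  rw [← map_mul, inv_mul_cancel₀ (leadingCoeff_ne_zero_of_pos hW), map_one]

theorem monic_C_mul_diffPoly (hW : 0 < W.natDegree) :
    (Polynomial.C (algebraMap ℂ Bi W.leadingCoeff⁻¹) * diffPoly W).Monic := by
  refine Polynomial.monic_C_mul_of_mul_leadingCoeff_eq_one ?_
  rw [show (diffPoly W).leadingCoeff = (diffPoly W).coeff (diffPoly W).natDegree from rfl,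
    natDegree_diffPoly, coeff_diffPoly hW,
    inv_mul_algebraMap hW]

theorem denom_monic (hW : 0 < W.natDegree) : (denom W).Monic := by
  rw [denom_eq]; exact Polynomial.monic_X.mul (monic_C_mul_diffPoly hW)

theorem natDegree_denom (hW : 0 < W.natDegree) : (denom W).natDegree = W.natDegree + 1 := by
  rw [denom_eq, (Polynomial.monic_X).natDegree_mul (monic_C_mul_diffPoly hW),
    Polynomial.natDegree_X, Polynomial.natDegree_C_mul, natDegree_diffPoly, add_comm]
  exact left_ne_zero_of_mul_eq_one (inv_mul_algebraMap hW)

theorem diffPoly_eq (hW : 0 < W.natDegree) : Polynomial.X * diffPoly W =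
    denom W * Polynomial.C (algebraMap ℂ Bi W.leadingCoeff) := by
  rw [denom_eq]
  have h : Polynomial.C (algebraMap ℂ Bi W.leadingCoeff⁻¹) *
      Polynomial.C (algebraMap ℂ Bi W.leadingCoeff) = 1 := by
    rw [← Polynomial.C_mul, inv_mul_algebraMap hW, Polynomial.C_1]
  linear_combination (-Polynomial.X * diffPoly W) * h

theorem res_add (W : ℂ[X]) (p q : Polynomial Bi) : res W (p + q) = res W p + res W q := by
  rw [res, mul_add, Polynomial.add_modByMonic, Polynomial.coeff_add, mul_add]; rfl

theorem res_C_mul (W : ℂ[X]) (u : Bi) (p : Polynomial Bi) :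
    res W (Polynomial.C u * p) = u * res W p := by
  rw [res, mul_left_comm, ← Polynomial.smul_eq_C_mul, Polynomial.smul_modByMonic,
    Polynomial.coeff_smul, smul_eq_mul, mul_left_comm]; rfl

/-- The factor W(x) - W(b) cancels in the integrand, leaving (a - b - x) p(x) / x, whose only pole
is at x = 0. This is the source of the component of the evaluation on Z1^∨ ⊗ Z1, and of the
W-linearity of `tau`. -/
theorem res_diffPoly_mul (hW : 0 < W.natDegree) (p : Polynomial Bi) :
    res W (diffPoly W * p) = pot Polynomial.X * p.eval 0 := by
  have hm := denom_monic hW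
  obtain ⟨q, hq⟩ : Polynomial.X ∣ p - Polynomial.C (p.eval 0) := by
    rw [Polynomial.X_dvd_iff, Polynomial.coeff_sub, Polynomial.coeff_C_zero,
      Polynomial.coeff_zero_eq_eval_zero, sub_self]
  have hp : p = Polynomial.C (p.eval 0) + Polynomial.X * q := by rw [← hq]; ring
  set c := p.eval 0 with hc
  -- With p = p(0) + x q, every term that contains a factor x besides W(x) - W(b) is a multiple of
  -- the denominator; only (a - b) p(0) (W(x) - W(b)) survives, and its degree is too small to be
  -- reduced.
  have e : (Polynomial.C (inl Polynomial.X - inr Polynomial.X) - Polynomial.X) *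
      (diffPoly W * p) = Polynomial.C (pot Polynomial.X * c) * diffPoly W +
        denom W * (Polynomial.C (algebraMap ℂ Bi W.leadingCoeff) *
          (-Polynomial.C c + Polynomial.C (pot Polynomial.X) * q - Polynomial.X * q)) := by
    rw [← mul_assoc (denom W), ← diffPoly_eq hW, hp, Polynomial.C_mul]
    simp only [pot]
    ring
  rw [res, e, Polynomial.add_modByMonic, (Polynomial.modByMonic_eq_zero_iff_dvd hm).2
    (dvd_mul_right _ _), add_zero, (Polynomial.modByMonic_eq_self_iff hm).2,
    Polynomial.coeff_C_mul, coeff_diffPoly hW, mul_left_comm, inv_mul_algebraMap hW, mul_one]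
  refine Polynomial.degree_lt_degree ?_
  rw [natDegree_denom hW]
  refine (Polynomial.natDegree_C_mul_le _ _).trans_lt ?_
  rw [natDegree_diffPoly]
  exact Nat.lt_succ_self _

/-- A polynomial `r(x)` with coefficients in `ℂ`, as a polynomial with coefficients in `R ⊗ R`. -/
def toX : ℂ[X] →ₐ[ℂ] Polynomial Bi := Polynomial.aeval Polynomial.X

theorem toX_eq (r : ℂ[X]) : toX r = r.map (algebraMap ℂ Bi) := by
  rw [toX, Polynomial.aeval_def, Polynomial.eval₂_eq_sum_range, Polynomial.map,
    Polynomial.eval₂_eq_sum_range]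
  rfl

theorem res_zero (W : ℂ[X]) : res W 0 = 0 := by
  have := res_C_mul W 0 0
  rwa [zero_mul, mul_zero] at this

theorem res_neg (W : ℂ[X]) (p : Polynomial Bi) : res W (-p) = -res W p := by
  rw [eq_neg_iff_add_eq_zero, ← res_add, neg_add_cancel, res_zero]

/-- The numerator has degree i + 1 ≤ deg W, one less than the denominator may have at most, so it is
its own remainder, and only its term -x^(i+1) can contribute to x^(deg W). -/
theorem res_X_pow (hW : 0 < W.natDegree) {i : ℕ} (hi : i < W.natDegree) :
    mu (-res W (Polynomial.X ^ i)) =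
      if i + 1 = W.natDegree then Polynomial.C W.leadingCoeff⁻¹ else 0 := by
  have hm := denom_monic hW
  rw [res, (Polynomial.modByMonic_eq_self_iff hm).2, sub_mul, ← pow_succ', Polynomial.coeff_sub,
    Polynomial.coeff_C_mul, Polynomial.coeff_X_pow, Polynomial.coeff_X_pow,
    if_neg hi.ne', mul_zero, zero_sub, mul_neg, neg_neg]
  · simp only [eq_comm (a := W.natDegree)]
    split_ifs
    · rw [mul_one]; exact mu.commutes _
    · rw [mul_zero, map_zero]
  · refine Polynomial.degree_lt_degree ?_
    rw [natDegree_denom hW]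
    refine (Polynomial.natDegree_mul_le).trans_lt ?_
    rw [Polynomial.natDegree_X_pow, ← Polynomial.natDegree_neg, neg_sub, Polynomial.natDegree_X_sub_C]
    omega

/-- The residue `r ↦ (1/2πi) ∮ r(x) / (W(x) - w) dx`, at `w = W(y)`. -/
def tau (W : ℂ[X]) : ℂ[X] →ₗ[ℂ] ℂ[X] where
  toFun r := mu (-res W (toX r))
  map_add' r s := by rw [map_add, res_add, neg_add, map_add]
  map_smul' c r := by
    rw [map_smul, Algebra.smul_def, show algebraMap ℂ (Polynomial Bi) c =
      Polynomial.C (algebraMap ℂ Bi c) from rfl, res_C_mul, ← mul_neg, map_mul,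
      Algebra.smul_def, mu.commutes]
    rfl

/-- Replacing W(x) by W(y) under the integral changes it by a pole-free integrand; formally, the
value of `res_diffPoly_mul` is a multiple of a - b, which μ kills. -/
theorem tau_W_mul (hW : 0 < W.natDegree) (r : ℂ[X]) : tau W (W * r) = W * tau W r := by
  have h := congrArg mu (res_diffPoly_mul hW (toX r))
  rw [map_mul, mu_pot, zero_mul, diffPoly, sub_mul, sub_eq_add_neg, res_add, res_neg, res_C_mul,
    map_add, map_neg, map_mul, mu_inr, ← toX_eq, ← map_mul] at h
  show mu (-res W (toX (W * r))) = W * mu (-res W (toX r))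
  rw [map_neg, map_neg]
  linear_combination -h

theorem tau_X_pow (hW : 0 < W.natDegree) {i : ℕ} (hi : i < W.natDegree) :
    tau W (Polynomial.X ^ i) =
      if i + 1 = W.natDegree then Polynomial.C W.leadingCoeff⁻¹ else 0 := by
  rw [← res_X_pow hW hi]
  show mu (-res W (toX _)) = _
  rw [toX, map_pow, Polynomial.aeval_X]

/-- The image of `tau` consists of polynomials in `W`. -/
theorem tau_mem (hW : 0 < W.natDegree) (p : ℂ[X]) :
    tau W p ∈ (Polynomial.aeval (R := ℂ) W).range := by
  induction hn : p.natDegree using Nat.strong_induction_on generalizing p with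
  | _ n ih =>
    subst hn
    set w := W.leadingCoeff⁻¹ with hw
    have hw0 : w ≠ 0 := inv_ne_zero (leadingCoeff_ne_zero_of_pos hW)
    have hm : (Polynomial.C w * W).Monic :=
      Polynomial.monic_C_mul_of_mul_leadingCoeff_eq_one
        (inv_mul_cancel₀ (leadingCoeff_ne_zero_of_pos hW))
    have hd : (Polynomial.C w * W).natDegree = W.natDegree := Polynomial.natDegree_C_mul hw0
    -- The remainder modulo W has constant residue because its degree is below deg W. On the
    -- multiple of W the factor W comes out, and the quotient has smaller degree.
    rw [← Polynomial.modByMonic_add_div p (Polynomial.C w * W), map_add]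
    refine add_mem ?_ ?_
    · rw [Polynomial.as_sum_range' (p %ₘ (Polynomial.C w * W)) W.natDegree, map_sum]
      · refine sum_mem fun i hi => ?_
        rw [← Polynomial.C_mul_X_pow_eq_monomial, ← Polynomial.smul_eq_C_mul, map_smul,
          tau_X_pow hW (Finset.mem_range.1 hi)]
        refine Subalgebra.smul_mem _ ?_ _
        split_ifs
        · exact Subalgebra.algebraMap_mem _ _
        · exact zero_mem _
      · rw [← hd]
        exact Polynomial.natDegree_modByMonic_lt _ hm fun h => by rw [h] at hd; simp at hd; omega
    · by_cases hq : p /ₘ (Polynomial.C w * W) = 0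
      · rw [hq, mul_zero, map_zero]; exact zero_mem _
      rw [mul_assoc, ← Polynomial.smul_eq_C_mul, map_smul, tau_W_mul hW]
      refine Subalgebra.smul_mem _ (mul_mem ((AlgHom.mem_range _).2
        ⟨Polynomial.X, Polynomial.aeval_X _⟩) (ih _ ?_ _ rfl)) _
      rw [Polynomial.natDegree_divByMonic p hm, hd]
      have : W.natDegree ≤ p.natDegree := by
        by_contra hlt
        refine hq (Polynomial.divByMonic_eq_zero_iff hm |>.2 ?_)
        refine Polynomial.degree_lt_degree ?_
        rw [hd]; omega
      omega

theorem tau_mul_of_mem (hW : 0 < W.natDegree) {s : ℂ[X]}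
    (hs : s ∈ (Polynomial.aeval (R := ℂ) W).range) (r : ℂ[X]) : tau W (s * r) = s * tau W r := by
  obtain ⟨p, rfl⟩ := hs
  show tau W (Polynomial.aeval W p * r) = Polynomial.aeval W p * tau W r
  induction p using Polynomial.induction_on' with
  | add p q hp hq => rw [map_add, add_mul, map_add, hp, hq, add_mul]
  | monomial n c =>
    rw [Polynomial.aeval_monomial, mul_assoc, mul_assoc, ← Algebra.smul_def, ← Algebra.smul_def,
      map_smul]
    congr 1
    induction n with
    | zero => simp
    | succ n ih => rw [pow_succ', mul_assoc, tau_W_mul hW, ih, mul_assoc]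

/-- `tau` is linear over its image. -/
theorem tau_tau_mul (hW : 0 < W.natDegree) (p q : ℂ[X]) :
    tau W (tau W p * q) = tau W p * tau W q := tau_mul_of_mem hW (tau_mem hW p) q

/-- The residue in the left variable, `r ⊗ s ↦ tau(r) s`. -/
def Res (W : ℂ[X]) : Bi →ₗ[ℂ] ℂ[X] := Bi.mulMap (tau W) LinearMap.id

theorem Res_apply (r s : ℂ[X]) : Res W (inl r * inr s) = tau W r * s := Bi.mulMap_apply _ _ _ _

theorem Res_inr_mul (s : ℂ[X]) (u : Bi) : Res W (inr s * u) = s * Res W u := by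
  induction u using Bi.induction with
  | h1 p q => rw [mul_left_comm, ← map_mul, Res_apply, Res_apply]; ring
  | h2 u v hu hv => rw [mul_add, map_add, hu, hv, map_add, mul_add]

/-- By W-linearity of `tau`, W(a) leaves the residue in the left variable as W(b). The residue
pairing thus ignores all composites d1 d0 and d0 d1, which makes the evaluation closed. -/
theorem Res_pot_mul (hW : 0 < W.natDegree) (u : Bi) : Res W (pot W * u) = 0 := by
  induction u using Bi.induction with
  | h1 p q =>
    rw [pot, sub_mul, map_sub, Res_inr_mul, ← mul_assoc, ← map_mul, Res_apply, Res_apply,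
      tau_W_mul hW]
    ring
  | h2 u v hu hv => rw [mul_add, map_add, hu, hv, add_zero]

/-- The residue in the right variable, `r ⊗ s ↦ r ⊗ tau(s)`. -/
def tauRight (W : ℂ[X]) : Bi →ₗ[ℂ] Bi := Bi.mulMap inl.toLinearMap (inr.toLinearMap ∘ₗ tau W)

theorem tauRight_apply (r s : ℂ[X]) : tauRight W (inl r * inr s) = inl r * inr (tau W s) :=
  Bi.mulMap_apply _ _ _ _

theorem tauRight_inl_mul (r : ℂ[X]) (u : Bi) : tauRight W (inl r * u) = inl r * tauRight W u := by
  induction u using Bi.induction with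
  | h1 p q => rw [← mul_assoc, ← map_mul, tauRight_apply, tauRight_apply, map_mul, mul_assoc]
  | h2 u v hu hv => rw [mul_add, map_add, hu, hv, map_add, mul_add]

theorem tauRight_inr_W_mul (hW : 0 < W.natDegree) (u : Bi) :
    tauRight W (inr W * u) = inr W * tauRight W u := by
  induction u using Bi.induction with
  | h1 p q =>
    rw [mul_left_comm, ← map_mul, tauRight_apply, tauRight_apply, tau_W_mul hW, map_mul,
      mul_left_comm]
  | h2 u v hu hv => rw [mul_add, map_add, hu, hv, map_add, mul_add]

theorem dd_monomial (n : ℕ) (c : ℂ) : dd (Polynomial.monomial n c) = c •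
    ∑ i ∈ Finset.range n, inl Polynomial.X ^ i * inr Polynomial.X ^ (n - 1 - i) := by
  simp [dd, Polynomial.lsum_apply, Polynomial.sum_monomial_index]

/-- Among the terms a^i b^(n-1-i) with n ≤ deg W only b^(deg W - 1) has nonzero residue, so the
leading term of W with i = 0 alone contributes, and its coefficient cancels the normalization of
`tau`. -/
theorem tauRight_dd_W (hW : 0 < W.natDegree) : tauRight W (dd W) = 1 := by
  have key : ∀ n ≤ W.natDegree, ∀ c : ℂ, tauRight W (dd (Polynomial.monomial n c)) =
      if n = W.natDegree then algebraMap ℂ Bi (c * W.leadingCoeff⁻¹) else 0 := by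
    intro n hn c
    rw [dd_monomial, map_smul, map_sum]
    have : ∀ i ∈ Finset.range n, tauRight W
        (inl Polynomial.X ^ i * inr Polynomial.X ^ (n - 1 - i)) =
        if i = 0 then (if n = W.natDegree then algebraMap ℂ Bi W.leadingCoeff⁻¹ else 0) else 0 := by
      intro i hi
      rw [Finset.mem_range] at hi
      rw [← map_pow, ← map_pow, tauRight_apply, tau_X_pow hW (by omega)]
      have hiff : n - 1 - i + 1 = W.natDegree ↔ i = 0 ∧ n = W.natDegree := by omega
      simp only [hiff]
      by_cases h0 : i = 0 <;> by_cases h1 : n = W.natDegree <;> simp [h0, h1]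
      exact (inr.commutes _)
    rw [Finset.sum_congr rfl this]
    split_ifs with h
    · have hpos : 0 < n := h ▸ hW
      rw [Finset.sum_ite_eq' (Finset.range n) 0 fun _ => algebraMap ℂ Bi W.leadingCoeff⁻¹,
        if_pos (Finset.mem_range.2 hpos), Algebra.smul_def, ← map_mul]
    · simp
  nth_rw 2 [W.as_sum_range]
  rw [map_sum, map_sum, Finset.sum_congr rfl fun n hn =>
    key n (Nat.lt_succ_iff.1 (Finset.mem_range.1 hn)) _, Finset.sum_ite_eq' (Finset.range _),
    if_pos (Finset.self_mem_range_succ _), show W.coeff W.natDegree = W.leadingCoeff from rfl,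
    mul_inv_cancel₀ (leadingCoeff_ne_zero_of_pos hW), map_one]

theorem Res_sig (u : Bi) : Res W (sig u) = mu (tauRight W u) := by
  induction u using Bi.induction with
  | h1 p q =>
    rw [tauRight_apply, map_mul sig, map_mul mu, sig_inl, sig_inr, mul_comm (inr p), Res_apply, mu_inl,
      mu_inr, mul_comm]
  | h2 u v hu hv => simp only [map_add, hu, hv]

/-- The difference quotient of W is a reproducing kernel for the residue: modulo W(a) - W(b) it does
not distinguish p(a) from p(b), and its own residue is 1. This is the zero-dimensional residue
duality used to compute ν⁰. -/
theorem Res_dd_mul (hW : 0 < W.natDegree) (u : Bi) : Res W (dd W * u) = mu u := by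
  have h0 : ∀ p, Res W (dd W * inl p) = p := by
    intro p
    have h1 := dd_mul' p W
    have h2 := dd_mul' W p
    -- Both Leibniz expansions of the difference quotient of W p, compared.
    have e : dd W * inl p = pot W * dd p + inr p * dd W := by
      rw [pot, sub_mul]
      rw [mul_comm p W] at h1
      linear_combination h2 - h1
    rw [e, map_add, Res_pot_mul hW, zero_add, Res_inr_mul, ← sig_dd, Res_sig, tauRight_dd_W hW,
      map_one, mul_one]
  induction u using Bi.induction with
  | h1 p q =>
    rw [← mul_assoc, mul_comm _ (inr q), Res_inr_mul, h0, map_mul, mu_inl, mu_inr, mul_comm]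
  | h2 u v hu hv => simp only [mul_add, map_add, hu, hv]

/-- `r ↦ (1/2πi) ∮ r(y) / ((a - y) (W(y) - W(x))) dy`, the contour surrounding `a`. -/
def kap (W : ℂ[X]) : ℂ[X] →ₗ[ℂ] Bi := -(tauRight W ∘ₗ dd)

theorem kap_apply (r : ℂ[X]) : kap W r = -tauRight W (dd r) := rfl

/-- The linear extension of `kap` over the right factor. -/
def kapBi (W : ℂ[X]) : Bi →ₗ[ℂ] Bi := Bi.mulMap (kap W) inr.toLinearMap

theorem kapBi_apply (r s : ℂ[X]) : kapBi W (inl r * inr s) = kap W r * inr s :=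
  Bi.mulMap_apply _ _ _ _

/-- The Leibniz rule for the product p W produces the extra term p(a) times the residue of the
difference quotient of W, which is 1. In the zig-zag identities this is the term that becomes the
identity. -/
theorem kapBi_pot_mul (hW : 0 < W.natDegree) (u : Bi) : kapBi W (pot W * u) = -u := by
  induction u using Bi.induction with
  | h1 p q =>
    have e : pot W * (inl p * inr q) = inl (W * p) * inr q - inl p * inr (W * q) := by
      simp only [pot, map_mul]; ring
    rw [e, map_sub, kapBi_apply, kapBi_apply, kap_apply, kap_apply, mul_comm W p, dd_mul', map_add,
      tauRight_inl_mul, tauRight_dd_W hW, tauRight_inr_W_mul hW, map_mul]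
    ring
  | h2 u v hu hv => rw [mul_add, map_add, hu, hv, neg_add]

theorem tauRight_dd_mul (r p : ℂ[X]) :
    tauRight W (dd r * inr p) = inl r * kap W p - kap W (r * p) := by
  rw [kap_apply, kap_apply, dd_mul', map_add, tauRight_inl_mul, mul_comm (dd r)]
  ring

/-- `(α ⊗ β) ⋆ (γ ⊗ δ) = α ⊗ tau(β γ) δ`, the residue in the middle variable. -/
def star (W : ℂ[X]) (u v : Bi) : Bi :=
  Bi.mulMap inl.toLinearMap
    (inr.toLinearMap ∘ₗ Res W ∘ₗ LinearMap.mulRight ℂ v ∘ₗ inl.toLinearMap) u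

theorem star_apply' (r s : ℂ[X]) (v : Bi) :
    star W (inl r * inr s) v = inl r * inr (Res W (inl s * v)) := Bi.mulMap_apply _ _ _ _

theorem star_apply (r s p q : ℂ[X]) :
    star W (inl r * inr s) (inl p * inr q) = inl r * inr (tau W (s * p) * q) := by
  rw [star_apply', ← mul_assoc, ← map_mul, Res_apply]

theorem star_add_left (u u' v : Bi) : star W (u + u') v = star W u v + star W u' v :=
  map_add _ _ _

theorem star_add_right (u v v' : Bi) : star W u (v + v') = star W u v + star W u v' := by
  induction u using Bi.induction with
  | h1 r s => rw [star_apply', star_apply', star_apply', mul_add, map_add, map_add, mul_add]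
  | h2 u u' hu hu' => rw [star_add_left, star_add_left, star_add_left, hu, hu']; ring

/-- Two biadditive maps on `R ⊗ R` agree if they agree on pure tensors. -/
theorem Bi.induction₂ {p : Bi → Bi → Prop} (h : ∀ r s r' s', p (inl r * inr s) (inl r' * inr s'))
    (hl : ∀ u u' v, p u v → p u' v → p (u + u') v)
    (hr : ∀ u v v', p u v → p u v' → p u (v + v')) (u v : Bi) : p u v := by
  induction u using Bi.induction with
  | h1 r s =>
    induction v using Bi.induction with
    | h1 r' s' => exact h r s r' s'
    | h2 v v' hv hv' => exact hr _ _ _ hv hv'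
  | h2 u u' hu hu' => exact hl _ _ _ hu hu'

theorem star_inl_mul (r : ℂ[X]) (u v : Bi) : star W (inl r * u) v = inl r * star W u v := by
  induction u using Bi.induction with
  | h1 p q => rw [← mul_assoc, ← map_mul, star_apply', star_apply', map_mul, mul_assoc]
  | h2 u u' hu hu' => rw [mul_add, star_add_left, hu, hu', star_add_left, mul_add]

theorem star_inr_mul (r : ℂ[X]) (u v : Bi) : star W (inr r * u) v = star W u (inl r * v) := by
  induction u using Bi.induction with
  | h1 p q =>
    rw [mul_left_comm, ← map_mul, star_apply', star_apply', mul_comm r q, map_mul inl, mul_assoc]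
  | h2 u u' hu hu' => rw [mul_add, star_add_left, hu, hu', star_add_left]

theorem star_mul_inr (r : ℂ[X]) (u v : Bi) : star W u (inr r * v) = inr r * star W u v := by
  induction u using Bi.induction with
  | h1 p q =>
    rw [star_apply', star_apply', mul_left_comm, Res_inr_mul, map_mul, mul_left_comm]
  | h2 u u' hu hu' => rw [star_add_left, hu, hu', star_add_left, mul_add]

/-- The heart of the zig-zag identities: contracting a difference quotient in the middle variable
gives the commutator of multiplication by r ⊗ s with `kapBi`. The Leibniz rule splits dd(r) p into
dd(r p) and r dd(p), whose residues are values of `kap`. -/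
theorem star_dd (r s : ℂ[X]) (v : Bi) : star W (dd r) v * inr s =
    inl r * inr s * kapBi W v - kapBi W (inl r * inr s * v) := by
  induction v using Bi.induction with
  | h1 p q =>
    have key : ∀ u, star W u (inl p * inr q) = tauRight W (u * inr p) * inr q := by
      intro u
      induction u using Bi.induction with
      | h1 r s => rw [star_apply, mul_assoc, ← map_mul, tauRight_apply, map_mul, mul_assoc]
      | h2 u u' hu hu' => rw [star_add_left, hu, hu', add_mul, map_add, add_mul]
    rw [key, tauRight_dd_mul, mul_mul_mul_comm, ← map_mul, ← map_mul, kapBi_apply, kapBi_apply,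
      map_mul inr]
    ring
  | h2 u v hu hv => rw [star_add_right, add_mul, hu, hv, map_add, mul_add, mul_add, map_add]; ring

end Res

end MFBi

namespace MFBi

/-! ### Tensor products with free bimodules -/

section BiLift

variable {P : Type} [AddCommGroup P]

/-- The additive map on `R ⊗ R` induced by a `ℂ`-balanced biadditive map. -/
def Bi.liftAdd (f : ℂ[X] →+ ℂ[X] →+ P)
    (h : ∀ (c : ℂ) r s, f (c • r) s = f r (c • s)) : Bi →+ P :=
  (TensorProduct.liftAddHom (R := ℂ) (M := ℂ[X]) (N := ℂ[X]) f h : ℂ[X] ⊗[ℂ] ℂ[X] →+ P)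

theorem Bi.liftAdd_apply (f : ℂ[X] →+ ℂ[X] →+ P)
    (h : ∀ (c : ℂ) r s, f (c • r) s = f r (c • s)) (r s : ℂ[X]) :
    Bi.liftAdd f h (inl r * inr s) = f r s := by
  rw [inl_mul_inr]; rfl

end BiLift

section Lift

variable {M N P : Type} [AddCommGroup M] [Module Bi M] [AddCommGroup N] [Module Bi N]
  [AddCommGroup P] [Module Bi P]

/-- The map `r ⊗ s ↦ s • ρ (m . r)` -/
def BT.liftRAux (ρ : M →+ P) (h : ∀ (r : ℂ[X]) m, ρ (inl r • m) = inl r • ρ m) (m : M) : Bi →+ P :=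
  Bi.liftAdd (mkBi (fun r s => inr s • ρ (inr r • m))
      (fun r r' s => by rw [map_add, add_smul, map_add, smul_add])
      (fun r s s' => by rw [map_add, add_smul]))
    (fun c r s => by
      simp only [mkBi_apply]
      rw [Polynomial.smul_eq_C_mul, Polynomial.smul_eq_C_mul, map_mul, map_mul, ← inl_C, mul_smul,
        h, ← mul_smul, mul_comm])

theorem BT.liftRAux_apply (ρ : M →+ P) (h : ∀ (r : ℂ[X]) m, ρ (inl r • m) = inl r • ρ m) (m : M)
    (r s : ℂ[X]) : BT.liftRAux ρ h m (inl r * inr s) = inr s • ρ (inr r • m) :=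
  Bi.liftAdd_apply _ _ r s

/-- A left `R`-linear map `ρ : M → P` extends to a bimodule map `M ⊗_R (R ⊗ R) → P`. -/
def BT.liftR (ρ : M →+ P) (h : ∀ (r : ℂ[X]) m, ρ (inl r • m) = inl r • ρ m) : BT M Bi →ₗ[Bi] P :=
  BT.lift (mkBi (fun m u => BT.liftRAux ρ h m u)
      (fun m m' u => by
        induction u using Bi.induction with
        | h1 r s => simp only [BT.liftRAux_apply, smul_add, map_add]
        | h2 u v hu hv => rw [map_add, hu, hv, map_add, map_add]; abel)
      (fun m u v => map_add _ _ _))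
    (fun r m u => by
      simp only [mkBi_apply, smul_eq_mul]
      induction u using Bi.induction with
      | h1 p q =>
        rw [← mul_assoc, ← map_mul, BT.liftRAux_apply, BT.liftRAux_apply, smul_smul, ← map_mul,
          mul_comm p]
      | h2 u v hu hv => rw [mul_add, map_add, map_add, hu, hv])
    (fun r s m u => by
      simp only [mkBi_apply, smul_eq_mul]
      induction u using Bi.induction with
      | h1 p q =>
        rw [mul_left_comm, ← map_mul, BT.liftRAux_apply, BT.liftRAux_apply, smul_comm, h,
          smul_smul, smul_smul, map_mul]
        congr 1; ring
      | h2 u v hu hv => rw [mul_add, map_add, map_add, hu, hv, smul_add])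

@[simp] theorem BT.liftR_bt_one (ρ : M →+ P) (h : ∀ (r : ℂ[X]) m, ρ (inl r • m) = inl r • ρ m)
    (m : M) : BT.liftR ρ h (bt m 1) = ρ m := by
  have := BT.liftRAux_apply ρ h m 1 1
  rw [map_one, map_one, mul_one, one_smul, one_smul] at this
  exact this

theorem bt_mul_right (m : M) (r s : ℂ[X]) :
    bt m (inl r * inr s) = inr s • bt (inr r • m) (1 : Bi) := by
  rw [inr_smul_bt, bt_balanced, smul_eq_mul, smul_eq_mul, mul_one]

theorem bt_mul_left (n : N) (r s : ℂ[X]) :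
    bt (inl r * inr s) n = inl r • bt (1 : Bi) (inl s • n) := by
  rw [← bt_balanced, inl_smul_bt, smul_eq_mul, smul_eq_mul, mul_one]

/-- The middle action can be moved onto m and the right action pulled out, so the elements m ⊗ 1
generate. -/
theorem BT.hom_ext_one_right {f g : BT M Bi →ₗ[Bi] P} (h : ∀ m, f (bt m 1) = g (bt m 1)) :
    f = g :=
  BT.hom_ext fun m u => by
    induction u using Bi.induction with
    | h1 r s => rw [bt_mul_right, map_smul, map_smul, h]
    | h2 u v hu hv => rw [bt_add_right, map_add, map_add, hu, hv]

theorem BT.hom_ext_one_left {f g : BT Bi N →ₗ[Bi] P} (h : ∀ n, f (bt 1 n) = g (bt 1 n)) :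
    f = g :=
  BT.hom_ext fun u n => by
    induction u using Bi.induction with
    | h1 r s => rw [bt_mul_left, map_smul, map_smul, h]
    | h2 u v hu hv => rw [bt_add_left, map_add, map_add, hu, hv]

/-- The map `r ⊗ s ↦ r • ρ (s . n)` -/
def BT.liftLAux (ρ : N →+ P) (h : ∀ (r : ℂ[X]) n, ρ (inr r • n) = inr r • ρ n) (n : N) : Bi →+ P :=
  Bi.liftAdd (mkBi (fun r s => inl r • ρ (inl s • n))
      (fun r r' s => by rw [map_add, add_smul])
      (fun r s s' => by rw [map_add, add_smul, map_add, smul_add]))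
    (fun c r s => by
      simp only [mkBi_apply]
      rw [Polynomial.smul_eq_C_mul, Polynomial.smul_eq_C_mul, map_mul, map_mul, inl_C, mul_smul,
        mul_smul, h, smul_comm])

theorem BT.liftLAux_apply (ρ : N →+ P) (h : ∀ (r : ℂ[X]) n, ρ (inr r • n) = inr r • ρ n) (n : N)
    (r s : ℂ[X]) : BT.liftLAux ρ h n (inl r * inr s) = inl r • ρ (inl s • n) :=
  Bi.liftAdd_apply _ _ r s

/-- A right `R`-linear map `ρ : N → P` extends to a bimodule map `(R ⊗ R) ⊗_R N → P`. -/
def BT.liftL (ρ : N →+ P) (h : ∀ (r : ℂ[X]) n, ρ (inr r • n) = inr r • ρ n) : BT Bi N →ₗ[Bi] P :=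
  BT.lift (mkBi (fun u n => BT.liftLAux ρ h n u)
      (fun u v n => map_add _ _ _)
      (fun u n n' => by
        induction u using Bi.induction with
        | h1 r s => simp only [BT.liftLAux_apply, smul_add, map_add]
        | h2 u v hu hv => rw [map_add, hu, hv, map_add, map_add]; abel))
    (fun r u n => by
      simp only [mkBi_apply, smul_eq_mul]
      induction u using Bi.induction with
      | h1 p q =>
        rw [mul_left_comm, ← map_mul, BT.liftLAux_apply, BT.liftLAux_apply, smul_smul, ← map_mul,
          mul_comm r]
      | h2 u v hu hv => rw [mul_add, map_add, map_add, hu, hv])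
    (fun r s u n => by
      simp only [mkBi_apply, smul_eq_mul]
      induction u using Bi.induction with
      | h1 p q =>
        rw [← mul_assoc, ← map_mul, BT.liftLAux_apply, BT.liftLAux_apply, smul_comm, h,
          smul_smul, smul_smul, map_mul]
        congr 1; ring
      | h2 u v hu hv => rw [mul_add, map_add, map_add, hu, hv, smul_add])

@[simp] theorem BT.liftL_one_bt (ρ : N →+ P) (h : ∀ (r : ℂ[X]) n, ρ (inr r • n) = inr r • ρ n)
    (n : N) : BT.liftL ρ h (bt 1 n) = ρ n := by
  have := BT.liftLAux_apply ρ h n 1 1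
  rw [map_one, map_one, mul_one, one_smul, one_smul] at this
  exact this

end Lift

section Sums

variable {M M' N : Type} [AddCommGroup M] [Module Bi M] [AddCommGroup M'] [Module Bi M']
  [AddCommGroup N] [Module Bi N] {n : ℕ}

/-- `M ⊗_R -` applied to the `i`-th inclusion -/
def BT.singleR (M : Type) [AddCommGroup M] [Module Bi M] (i : Fin n) :
    BT M Bi →ₗ[Bi] BT M (Fin n → Bi) :=
  BT.map LinearMap.id (LinearMap.single Bi (fun _ => Bi) i)

/-- `M ⊗_R -` applied to the `i`-th projection -/
def BT.projR (M : Type) [AddCommGroup M] [Module Bi M] (i : Fin n) :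
    BT M (Fin n → Bi) →ₗ[Bi] BT M Bi :=
  BT.map LinearMap.id (LinearMap.proj i)

/-- `- ⊗_R N` applied to the `i`-th inclusion -/
def BT.singleL (N : Type) [AddCommGroup N] [Module Bi N] (i : Fin n) :
    BT Bi N →ₗ[Bi] BT (Fin n → Bi) N :=
  BT.map (LinearMap.single Bi (fun _ => Bi) i) LinearMap.id

/-- `- ⊗_R N` applied to the `i`-th projection -/
def BT.projL (N : Type) [AddCommGroup N] [Module Bi N] (i : Fin n) :
    BT (Fin n → Bi) N →ₗ[Bi] BT Bi N :=
  BT.map (LinearMap.proj i) LinearMap.id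

theorem bt_sum_left {ι : Type} (s : Finset ι) (f : ι → M) (n : N) :
    bt (∑ i ∈ s, f i) n = ∑ i ∈ s, bt (f i) n :=
  TensorProduct.sum_tmul (R := ℂ[X]) (M := RightRes M) (N := LeftRes N) s f n

theorem bt_sum_right {ι : Type} (s : Finset ι) (m : M) (f : ι → N) :
    bt m (∑ i ∈ s, f i) = ∑ i ∈ s, bt m (f i) :=
  TensorProduct.tmul_sum (R := ℂ[X]) (M := RightRes M) (N := LeftRes N) m s f

theorem BT.sum_single_proj_right : ∑ i, BT.singleR (n := n) M i ∘ₗ BT.projR M i = LinearMap.id :=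
  BT.hom_ext fun m v => by
    rw [LinearMap.sum_apply]
    show ∑ i, bt m (Pi.single i (v i)) = bt m v
    rw [← bt_sum_right, Finset.univ_sum_single]

theorem BT.sum_single_proj_left : ∑ i, BT.singleL (n := n) N i ∘ₗ BT.projL N i = LinearMap.id :=
  BT.hom_ext fun v m => by
    rw [LinearMap.sum_apply]
    show ∑ i, bt (Pi.single i (v i)) m = bt v m
    rw [← bt_sum_left, Finset.univ_sum_single]

theorem BT.proj_single_right (i j : Fin n) :
    BT.projR M i ∘ₗ BT.singleR M j = if i = j then LinearMap.id else 0 := by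
  refine BT.hom_ext fun m u => ?_
  show bt m ((Pi.single j u : Fin n → Bi) i) = _
  split_ifs with h
  · subst h; rw [Pi.single_eq_same]; rfl
  · rw [Pi.single_eq_of_ne h, bt_zero_right]; rfl

variable (M n) in
/-- `M ⊗_R (R ⊗ R)^n` is the sum of `n` copies of `M ⊗_R (R ⊗ R)`. -/
def BT.piRight : BT M (Fin n → Bi) ≃ₗ[Bi] (Fin n → BT M Bi) :=
  LinearEquiv.ofLinearMap (LinearMap.pi fun i => BT.projR M i)
    (∑ i, BT.singleR M i ∘ₗ LinearMap.proj i)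
    (LinearMap.ext fun v => funext fun i => by
      rw [LinearMap.comp_apply, LinearMap.sum_apply, map_sum, Finset.sum_apply]
      refine (Finset.sum_congr rfl fun j _ => DFunLike.congr_fun
        (BT.proj_single_right (M := M) i j) (v j)).trans ?_
      rw [Finset.sum_eq_single i, if_pos rfl]
      · rfl
      · intro j _ h; rw [if_neg h.symm]; rfl
      · simp)
    (by
      rw [← BT.sum_single_proj_right]
      ext t
      rw [LinearMap.comp_apply, LinearMap.sum_apply, LinearMap.sum_apply]
      rfl)

/-- Tensor product of isomorphisms. -/
def BT.congr {M N M' N' : Type} [AddCommGroup M] [Module Bi M] [AddCommGroup N] [Module Bi N]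
    [AddCommGroup M'] [Module Bi M'] [AddCommGroup N'] [Module Bi N'] (e : M ≃ₗ[Bi] M')
    (f : N ≃ₗ[Bi] N') : BT M N ≃ₗ[Bi] BT M' N' :=
  LinearEquiv.ofLinearMap (BT.map e.toLinearMap f.toLinearMap)
    (BT.map e.symm.toLinearMap f.symm.toLinearMap)
    (by rw [BT.map_comp, LinearEquiv.comp_symm, LinearEquiv.comp_symm, BT.map_id])
    (by rw [BT.map_comp, LinearEquiv.symm_comp, LinearEquiv.symm_comp, BT.map_id])

end Sums

section Free

variable {M N : Type} [AddCommGroup M] [Module Bi M] [AddCommGroup N] [Module Bi N]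

/-- The coordinates in a basis over the left action, as an additive map. -/
def leftCoord {ι : Type} (b : Module.Basis ι ℂ[X] (LeftRes M)) : M →+ (ι →₀ Bi) :=
  (Finsupp.mapRange.addMonoidHom (inl : ℂ[X] →+ Bi)).comp
    (b.repr.toLinearMap.toAddMonoidHom : M →+ (ι →₀ ℂ[X]))

theorem leftCoord_smul {ι : Type} (b : Module.Basis ι ℂ[X] (LeftRes M)) (r : ℂ[X]) (m : M) :
    leftCoord b (inl r • m) = inl r • leftCoord b m := by
  ext i
  have e : b.repr (inl r • m : M) = r • b.repr (m : M) :=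
    map_smul b.repr r (show LeftRes M from m)
  show inl (b.repr (inl r • m : M) i) = inl r * inl (b.repr (m : M) i)
  rw [e, ← map_mul]; rfl

/-- The basis vectors as elements of the bimodule. -/
def leftVec {ι : Type} (b : Module.Basis ι ℂ[X] (LeftRes M)) (i : ι) : M := b i

theorem leftCoord_vec {ι : Type} (b : Module.Basis ι ℂ[X] (LeftRes M)) (i : ι) :
    leftCoord b (leftVec b i) = Finsupp.single i 1 := by
  show Finsupp.mapRange (inl : ℂ[X] →+ Bi) (map_zero _) (b.repr (b i)) = _
  rw [b.repr_self, Finsupp.mapRange_single]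
  exact congrArg _ (map_one inl)

theorem leftVec_induction {ι : Type} (b : Module.Basis ι ℂ[X] (LeftRes M)) {p : M → Prop}
    (h0 : p 0) (h1 : ∀ r i, p (inl r • leftVec b i)) (h2 : ∀ m m', p m → p m' → p (m + m'))
    (m : M) : p m := by
  have h : ∀ f : ι →₀ ℂ[X], p (b.repr.symm f : LeftRes M) := by
    intro f
    induction f using Finsupp.induction_linear with
    | zero => rw [map_zero]; exact h0
    | add f g hf hg => rw [map_add]; exact h2 _ _ hf hg
    | single i r => rw [b.repr_symm_single]; exact h1 r i
  have := h (b.repr m)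
  exact (b.repr.symm_apply_apply m) ▸ this

/-- For `M` free as a left `R`-module, `M ⊗_R (R ⊗ R)` is free. -/
def BT.finsuppEquiv {ι : Type} (b : Module.Basis ι ℂ[X] (LeftRes M)) :
    BT M Bi ≃ₗ[Bi] (ι →₀ Bi) :=
  LinearEquiv.ofLinearMap (BT.liftR (leftCoord b) (leftCoord_smul b))
    (Finsupp.linearCombination Bi fun i => bt (leftVec b i) (1 : Bi))
    (by
      refine Finsupp.lhom_ext' fun i => LinearMap.ext_ring ?_
      rw [LinearMap.comp_apply, LinearMap.comp_apply, Finsupp.lsingle_apply,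
        Finsupp.linearCombination_single, one_smul, BT.liftR_bt_one, leftCoord_vec]
      rfl)
    (by
      refine BT.hom_ext_one_right fun m => ?_
      rw [LinearMap.comp_apply, BT.liftR_bt_one, LinearMap.id_apply]
      induction m using leftVec_induction b with
      | h0 => rw [map_zero, map_zero, bt_zero_left]
      | h1 r i =>
        rw [leftCoord_smul, map_smul, leftCoord_vec, Finsupp.linearCombination_single, one_smul,
          inl_smul_bt]
      | h2 m m' h h' => rw [map_add, map_add, h, h', bt_add_left])

/-- Freeness over `R` from the left. -/
theorem leftRes_free [Module.Free Bi M] : Module.Free ℂ[X] (LeftRes M) := by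
  let : Algebra ℂ[X] Bi := inl.toRingHom.toAlgebra
  have : IsScalarTower ℂ[X] Bi (LeftRes M) := ⟨fun r u m => mul_smul (inl r) u m⟩
  have : Module.Free Bi (LeftRes M) := ‹Module.Free Bi M›
  let e : ℂ[X][X] ≃ₗ[ℂ[X]] Bi :=
    { Bi.toPoly.symm.toRingEquiv.toAddEquiv with
      map_smul' := fun r p => by
        show Bi.toPoly.symm (r • p) = inl r * Bi.toPoly.symm p
        rw [AlgEquiv.symm_apply_eq, map_mul, Bi.toPoly_inl, AlgEquiv.apply_symm_apply,
          Polynomial.smul_eq_C_mul] }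
  have : Module.Free ℂ[X] Bi := Module.Free.of_equiv e
  exact Module.Free.trans (R := ℂ[X]) (S := Bi) (M := LeftRes M)

/-- M ⊗_R (R ⊗ R) is M with a new free right variable, so freeness of M from the left suffices. This
matters for cokernels of differentials: they are annihilated by W(a) - W(b), but are free over the
left factor. -/
theorem BT.free_of_leftFree [Module.Free ℂ[X] (LeftRes M)] [Module.Free Bi N]
    [Module.Finite Bi N] : Module.Free Bi (BT M N) := by
  have : Module.Free Bi (BT M Bi) := Module.Free.of_equiv
    (BT.finsuppEquiv (M := M) (Module.Free.chooseBasis ℂ[X] (LeftRes M))).symm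
  let e := (Module.finBasis Bi N).equivFun
  exact Module.Free.of_equiv
    ((BT.congr (LinearEquiv.refl Bi M) e).trans (BT.piRight M _)).symm

theorem BT.finite_of_leftFinite [Module.Free ℂ[X] (LeftRes M)] [Module.Finite ℂ[X] (LeftRes M)]
    [Module.Free Bi N] [Module.Finite Bi N] : Module.Finite Bi (BT M N) := by
  have : Module.Finite Bi (BT M Bi) := Module.Finite.equiv
    (BT.finsuppEquiv (M := M) (Module.Free.chooseBasis ℂ[X] (LeftRes M))).symm
  let e := (Module.finBasis Bi N).equivFun
  exact Module.Finite.equiv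
    ((BT.congr (LinearEquiv.refl Bi M) e).trans (BT.piRight M _)).symm

instance [Module.Free Bi M] [Module.Free Bi N] [Module.Finite Bi N] : Module.Free Bi (BT M N) :=
  haveI := leftRes_free (M := M)
  BT.free_of_leftFree

end Free

section Retract

variable {A B : Type} [AddCommGroup A] [Module Bi A] [AddCommGroup B] [Module Bi B]

/-- A left `R`-linear retraction of `f` induces a retraction of `f ⊗_R (R ⊗ R)^n`. -/
theorem BT.exists_retraction_right (f : A →ₗ[Bi] B) (ρ : B →+ A)
    (h : ∀ (r : ℂ[X]) m, ρ (inl r • m) = inl r • ρ m) (hf : ∀ a, ρ (f a) = a) (n : ℕ) :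
    ∃ r : BT B (Fin n → Bi) →ₗ[Bi] BT A (Fin n → Bi),
      r ∘ₗ BT.map f LinearMap.id = LinearMap.id := by
  let ρ' : B →+ BT A Bi := AddMonoidHom.mk' (fun b => bt (ρ b) 1)
    fun b b' => by rw [map_add, bt_add_left]
  -- The retraction is only left linear, but tensoring with R ⊗ R adds a fresh right action along
  -- which it extends to a bimodule map.
  let r₁ : BT B Bi →ₗ[Bi] BT A Bi := BT.liftR ρ' fun r m => by
    show bt (ρ _) 1 = inl r • bt (ρ m) 1
    rw [h, inl_smul_bt]
  have h₁ : r₁ ∘ₗ BT.map f LinearMap.id = LinearMap.id := BT.hom_ext_one_right fun a => by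
    show r₁ (bt (f a) 1) = bt a 1
    rw [BT.liftR_bt_one]
    show bt (ρ (f a)) 1 = _
    rw [hf]
  refine ⟨∑ i, BT.singleR A i ∘ₗ r₁ ∘ₗ BT.projR B i, ?_⟩
  rw [← BT.sum_single_proj_right]
  refine LinearMap.ext fun t => ?_
  rw [LinearMap.comp_apply, LinearMap.sum_apply, LinearMap.sum_apply]
  refine Finset.sum_congr rfl fun i _ => ?_
  have e : BT.projR B i ∘ₗ BT.map f LinearMap.id =
      BT.map f LinearMap.id ∘ₗ BT.projR (n := n) A i := BT.hom_ext fun _ _ => rfl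
  exact congrArg _ ((congrArg r₁ (DFunLike.congr_fun e t)).trans (DFunLike.congr_fun h₁ _))

/-- A right `R`-linear retraction of `f` induces a retraction of `(R ⊗ R)^n ⊗_R f`. -/
theorem BT.exists_retraction_left (f : A →ₗ[Bi] B) (ρ : B →+ A)
    (h : ∀ (r : ℂ[X]) m, ρ (inr r • m) = inr r • ρ m) (hf : ∀ a, ρ (f a) = a) (n : ℕ) :
    ∃ r : BT (Fin n → Bi) B →ₗ[Bi] BT (Fin n → Bi) A,
      r ∘ₗ BT.map LinearMap.id f = LinearMap.id := by
  let ρ' : B →+ BT Bi A := AddMonoidHom.mk' (fun b => bt 1 (ρ b))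
    fun b b' => by rw [map_add, bt_add_right]
  let r₁ : BT Bi B →ₗ[Bi] BT Bi A := BT.liftL ρ' fun r m => by
    show bt 1 (ρ _) = inr r • bt 1 (ρ m)
    rw [h, inr_smul_bt]
  have h₁ : r₁ ∘ₗ BT.map LinearMap.id f = LinearMap.id := BT.hom_ext_one_left fun a => by
    show r₁ (bt 1 (f a)) = bt 1 a
    rw [BT.liftL_one_bt]
    show bt 1 (ρ (f a)) = _
    rw [hf]
  refine ⟨∑ i, BT.singleL A i ∘ₗ r₁ ∘ₗ BT.projL B i, ?_⟩
  rw [← BT.sum_single_proj_left]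
  refine LinearMap.ext fun t => ?_
  rw [LinearMap.comp_apply, LinearMap.sum_apply, LinearMap.sum_apply]
  refine Finset.sum_congr rfl fun i _ => ?_
  have e : BT.projL B i ∘ₗ BT.map LinearMap.id f =
      BT.map LinearMap.id f ∘ₗ BT.projL (n := n) A i := BT.hom_ext fun _ _ => rfl
  exact congrArg _ ((congrArg r₁ (DFunLike.congr_fun e t)).trans (DFunLike.congr_fun h₁ _))

end Retract

/-! ### Exactness -/

section Exact

variable {A B C N : Type} [AddCommGroup A] [Module Bi A] [AddCommGroup B] [Module Bi B]
  [AddCommGroup C] [Module Bi C] [AddCommGroup N] [Module Bi N]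

/-- The underlying map of right `R`-modules. -/
def rightResMap (f : A →ₗ[Bi] B) : RightRes A →ₗ[ℂ[X]] RightRes B where
  toFun := f
  map_add' := map_add f
  map_smul' r a := map_smul f (inr r) a

/-- Right exactness of `- ⊗_R N` -/
theorem BT.map_exact {f : A →ₗ[Bi] B} {g : B →ₗ[Bi] C} (h : Function.Exact f g)
    (hg : Function.Surjective g) : Function.Exact (BT.map f (LinearMap.id : N →ₗ[Bi] N))
      (BT.map g (LinearMap.id : N →ₗ[Bi] N)) := by
  have key : ∀ {A B : Type} [AddCommGroup A] [Module Bi A] [AddCommGroup B] [Module Bi B]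
      (f : A →ₗ[Bi] B) (t : BT A N), BT.map f (LinearMap.id : N →ₗ[Bi] N) t =
        (rightResMap f).rTensor (LeftRes N) t := by
    intro A B _ _ _ _ f t
    induction t using BT.induction with
    | h0 => rw [map_zero]; exact (map_zero _).symm
    | h1 m n => rfl
    | h2 s t hs ht => rw [map_add, hs, ht]; exact (map_add _ _ _).symm
  intro t
  rw [key]
  refine (rTensor_exact (R := ℂ[X]) (LeftRes N) (f := rightResMap f) (g := rightResMap g) h hg
    t).trans ?_
  exact exists_congr fun s => Eq.congr_left (key f s).symm

theorem BT.map_surjective {g : B →ₗ[Bi] C} (hg : Function.Surjective g) :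
    Function.Surjective (BT.map g (LinearMap.id : N →ₗ[Bi] N)) := by
  intro t
  induction t using BT.induction with
  | h0 => exact ⟨0, map_zero _⟩
  | h1 m n => obtain ⟨b, rfl⟩ := hg m; exact ⟨bt b n, rfl⟩
  | h2 s t hs ht =>
    obtain ⟨s, rfl⟩ := hs
    obtain ⟨t, rfl⟩ := ht
    exact ⟨s + t, map_add _ _ _⟩

end Exact

end MFBi

namespace MFBi

/-! ### Homotopy equivalences -/

section Factor

variable {A B C : Type} [AddCommGroup A] [Module Bi A] [AddCommGroup B] [Module Bi B]
  [AddCommGroup C] [Module Bi C]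

theorem exists_factor {p : A →ₗ[Bi] B} (hp : Function.Surjective p) {f : A →ₗ[Bi] C}
    (h : ∀ a, p a = 0 → f a = 0) : ∃ g : B →ₗ[Bi] C, g ∘ₗ p = f := by
  refine ⟨(LinearMap.ker p).liftQ f h ∘ₗ (p.quotKerEquivOfSurjective hp).symm, ?_⟩
  ext a
  have : (p.quotKerEquivOfSurjective hp).symm (p a) = Submodule.Quotient.mk a := by
    rw [LinearEquiv.symm_apply_eq]; rfl
  show (LinearMap.ker p).liftQ f h ((p.quotKerEquivOfSurjective hp).symm (p a)) = f a
  rw [this]; rfl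

theorem comp_right_cancel {p : A →ₗ[Bi] B} (hp : Function.Surjective p) {f g : B →ₗ[Bi] C}
    (h : f ∘ₗ p = g ∘ₗ p) : f = g := by
  ext b
  obtain ⟨a, rfl⟩ := hp b
  exact DFunLike.congr_fun h a

end Factor

namespace MF

variable {W : ℂ[X]}

theorem d1_d0_apply (X : MF W) (x : X.X0) : X.d1 (X.d0 x) = pot W • x :=
  DFunLike.congr_fun X.d1_d0 x

theorem d0_d1_apply (X : MF W) (x : X.X1) : X.d0 (X.d1 x) = pot W • x :=
  DFunLike.congr_fun X.d0_d1 x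

theorem Hom.comm0_apply {X Y : MF W} (f : Hom X Y) (x : X.X0) : Y.d0 (f.f0 x) = f.f1 (X.d0 x) :=
  DFunLike.congr_fun f.comm0 x

theorem Hom.comm1_apply {X Y : MF W} (f : Hom X Y) (x : X.X1) : Y.d1 (f.f1 x) = f.f0 (X.d1 x) :=
  DFunLike.congr_fun f.comm1 x

/-- A surjective even closed map whose kernel is contractible, in a way that is compatible with the
map, is a homotopy equivalence. -/
theorem Hom.exists_inverse {P Q : MF W} (p : Hom P Q) (H0 : P.X0 →ₗ[Bi] P.X1)
    (H1 : P.X1 →ₗ[Bi] P.X0) (s0 : Function.Surjective p.f0) (s1 : Function.Surjective p.f1)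
    (z0 : p.f1 ∘ₗ H0 = 0) (z1 : p.f0 ∘ₗ H1 = 0)
    (k0 : ∀ x, p.f0 x = 0 → P.d1 (H0 x) + H1 (P.d0 x) = x)
    (k1 : ∀ x, p.f1 x = 0 → P.d0 (H1 x) + H0 (P.d1 x) = x) :
    ∃ g : Hom Q P, g.comp p = Hom.id Q ∧ Homotopic (p.comp g) (Hom.id P) := by
  -- The map id - (dH + Hd) vanishes on the kernel of p, so it descends to a map g. It is closed,
  -- and since p kills H, it satisfies p g = id; by construction g p differs from id by a homotopy.
  obtain ⟨g0, h0⟩ := exists_factor s0 (f := LinearMap.id - (P.d1 ∘ₗ H0 + H1 ∘ₗ P.d0))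
    fun x hx => sub_eq_zero.2 (k0 x hx).symm
  obtain ⟨g1, h1⟩ := exists_factor s1 (f := LinearMap.id - (P.d0 ∘ₗ H1 + H0 ∘ₗ P.d1))
    fun x hx => sub_eq_zero.2 (k1 x hx).symm
  have h0' : ∀ x, g0 (p.f0 x) = x - (P.d1 (H0 x) + H1 (P.d0 x)) := DFunLike.congr_fun h0
  have h1' : ∀ x, g1 (p.f1 x) = x - (P.d0 (H1 x) + H0 (P.d1 x)) := DFunLike.congr_fun h1
  have z0' : ∀ x, p.f1 (H0 x) = 0 := DFunLike.congr_fun z0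
  have z1' : ∀ x, p.f0 (H1 x) = 0 := DFunLike.congr_fun z1
  refine ⟨⟨g0, g1, comp_right_cancel s0 ?_, comp_right_cancel s1 ?_⟩, Hom.ext ?_ ?_,
    -H0, -H1, ?_, ?_⟩
  · ext x
    show P.d0 (g0 (p.f0 x)) = g1 (Q.d0 (p.f0 x))
    rw [p.comm0_apply, h0', h1']
    simp only [map_sub, map_add, d0_d1_apply, d1_d0_apply, map_smul]
    abel
  · ext x
    show P.d1 (g1 (p.f1 x)) = g0 (Q.d1 (p.f1 x))
    rw [p.comm1_apply, h0', h1']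
    simp only [map_sub, map_add, d0_d1_apply, d1_d0_apply, map_smul]
    abel
  · refine comp_right_cancel s0 ?_
    ext x
    show p.f0 (g0 (p.f0 x)) = p.f0 x
    rw [h0', map_sub, map_add, ← p.comm1_apply, z0', z1']
    simp
  · refine comp_right_cancel s1 ?_
    ext x
    show p.f1 (g1 (p.f1 x)) = p.f1 x
    rw [h1', map_sub, map_add, ← p.comm0_apply, z0', z1']
    simp
  · show g0 ∘ₗ p.f0 = LinearMap.id + _
    rw [h0, LinearMap.comp_neg, LinearMap.neg_comp]; abel
  · show g1 ∘ₗ p.f1 = LinearMap.id + _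
    rw [h1, LinearMap.comp_neg, LinearMap.neg_comp]; abel

/-- A closed map from `A ⊗ Y` that vanishes on `A1 ⊗ Y` is a homotopy equivalence if `A1 ⊗ Y → A0 ⊗ Y`
is split injective with quotient the target. -/
theorem Hom.exists_inverse_left {A Y Q : MF W} (p : Hom (MF.tensor A Y) Q)
    (π0 : BT A.X0 Y.X0 →ₗ[Bi] Q.X0) (π1 : BT A.X0 Y.X1 →ₗ[Bi] Q.X1)
    (hp0 : p.f0 = π0.coprod 0) (hp1 : p.f1 = LinearMap.coprod 0 π1)
    (s0 : Function.Surjective π0) (s1 : Function.Surjective π1)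
    (k0 : ∀ t, π0 t = 0 → ∃ t', BT.map A.d1 LinearMap.id t' = t)
    (k1 : ∀ t, π1 t = 0 → ∃ t', BT.map A.d1 LinearMap.id t' = t)
    (r0 : BT A.X0 Y.X0 →ₗ[Bi] BT A.X1 Y.X0) (r1 : BT A.X0 Y.X1 →ₗ[Bi] BT A.X1 Y.X1)
    (hr0 : r0 ∘ₗ BT.map A.d1 LinearMap.id = LinearMap.id)
    (hr1 : r1 ∘ₗ BT.map A.d1 LinearMap.id = LinearMap.id) :
    ∃ g : Hom Q (MF.tensor A Y), g.comp p = Hom.id Q ∧ Homotopic (p.comp g) (Hom.id _) := by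
  have hr0' : ∀ t, r0 (BT.map A.d1 LinearMap.id t) = t := DFunLike.congr_fun hr0
  have hr1' : ∀ t, r1 (BT.map A.d1 LinearMap.id t) = t := DFunLike.congr_fun hr1
  have c0 : ∀ t : BT A.X1 Y.X0, BT.map LinearMap.id Y.d0 (BT.map A.d1 LinearMap.id t) =
      BT.map A.d1 LinearMap.id (BT.map LinearMap.id Y.d0 t) := fun t => by
    rw [BT.map_comp_apply, BT.map_comp_apply]; rfl
  have c1 : ∀ t : BT A.X1 Y.X1, BT.map LinearMap.id Y.d1 (BT.map A.d1 LinearMap.id t) =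
      BT.map A.d1 LinearMap.id (BT.map LinearMap.id Y.d1 t) := fun t => by
    rw [BT.map_comp_apply, BT.map_comp_apply]; rfl
  -- The retractions of d1 ⊗ 1 are the contracting homotopy. They land in A1 ⊗ Y, where p vanishes.
  refine p.exists_inverse (blk r0 0 0 0) (blk 0 0 0 r1) ?_ ?_ ?_ ?_ ?_ ?_
  · intro q
    obtain ⟨t, rfl⟩ := s0 q
    exact ⟨(t, 0), by simp [hp0]⟩
  · intro q
    obtain ⟨t, rfl⟩ := s1 q
    exact ⟨(0, t), by simp [hp1]⟩
  · rw [hp1]; ext <;> simp [blk]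
  · rw [hp0]; ext <;> simp [blk]
  · rintro ⟨t, u⟩ h
    obtain ⟨t', rfl⟩ := k0 t (by simpa [hp0] using h)
    simp [hr0', hr1', c0]
  · rintro ⟨t, u⟩ h
    obtain ⟨u', rfl⟩ := k1 u (by simpa [hp1] using h)
    simp [hr0', hr1', c1]

/-- The mirror image of `Hom.exists_inverse_left`. -/
theorem Hom.exists_inverse_right {Y A Q : MF W} (p : Hom (MF.tensor Y A) Q)
    (π0 : BT Y.X0 A.X0 →ₗ[Bi] Q.X0) (π1 : BT Y.X1 A.X0 →ₗ[Bi] Q.X1)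
    (hp0 : p.f0 = π0.coprod 0) (hp1 : p.f1 = π1.coprod 0)
    (s0 : Function.Surjective π0) (s1 : Function.Surjective π1)
    (k0 : ∀ t, π0 t = 0 → ∃ t', BT.map LinearMap.id A.d1 t' = t)
    (k1 : ∀ t, π1 t = 0 → ∃ t', BT.map LinearMap.id A.d1 t' = t)
    (r0 : BT Y.X0 A.X0 →ₗ[Bi] BT Y.X0 A.X1) (r1 : BT Y.X1 A.X0 →ₗ[Bi] BT Y.X1 A.X1)
    (hr0 : r0 ∘ₗ BT.map LinearMap.id A.d1 = LinearMap.id)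
    (hr1 : r1 ∘ₗ BT.map LinearMap.id A.d1 = LinearMap.id) :
    ∃ g : Hom Q (MF.tensor Y A), g.comp p = Hom.id Q ∧ Homotopic (p.comp g) (Hom.id _) := by
  have hr0' : ∀ t, r0 (BT.map LinearMap.id A.d1 t) = t := DFunLike.congr_fun hr0
  have hr1' : ∀ t, r1 (BT.map LinearMap.id A.d1 t) = t := DFunLike.congr_fun hr1
  have c0 : ∀ t : BT Y.X0 A.X1, BT.map Y.d0 LinearMap.id (BT.map LinearMap.id A.d1 t) =
      BT.map LinearMap.id A.d1 (BT.map Y.d0 LinearMap.id t) := fun t => by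
    rw [BT.map_comp_apply, BT.map_comp_apply]; rfl
  have c1 : ∀ t : BT Y.X1 A.X1, BT.map Y.d1 LinearMap.id (BT.map LinearMap.id A.d1 t) =
      BT.map LinearMap.id A.d1 (BT.map Y.d1 LinearMap.id t) := fun t => by
    rw [BT.map_comp_apply, BT.map_comp_apply]; rfl
  -- The sign of r1 cancels the Koszul sign of 1 ⊗ d1 on Y1 ⊗ A1.
  refine p.exists_inverse (blk 0 0 r0 0) (blk 0 0 (-r1) 0) ?_ ?_ ?_ ?_ ?_ ?_
  · intro q
    obtain ⟨t, rfl⟩ := s0 q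
    exact ⟨(t, 0), by simp [hp0]⟩
  · intro q
    obtain ⟨t, rfl⟩ := s1 q
    exact ⟨(t, 0), by simp [hp1]⟩
  · rw [hp1]; ext <;> simp [blk]
  · rw [hp0]; ext <;> simp [blk]
  · rintro ⟨t, u⟩ h
    obtain ⟨t', rfl⟩ := k0 t (by simpa [hp0] using h)
    simp [hr0', hr1', c0]
  · rintro ⟨t, u⟩ h
    obtain ⟨u', rfl⟩ := k1 t (by simpa [hp1] using h)
    simp [hr0', hr1', c1]

theorem HEquiv.trans {X Y Z : MF W} : HEquiv X Y → HEquiv Y Z → HEquiv X Z := by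
  rintro ⟨f, g, h1, h2⟩ ⟨f', g', h1', h2'⟩
  refine ⟨f.comp f', g'.comp g, ?_, ?_⟩
  · exact (Homotopic.comp (Homotopic.refl f) (Homotopic.comp h1' (Homotopic.refl g))).trans h1
  · exact (Homotopic.comp (Homotopic.refl g') (Homotopic.comp h2 (Homotopic.refl f'))).trans h2'

theorem Hom.tensor_comp {X X' X'' Y Y' Y'' : MF W} (f : Hom X X') (f' : Hom X' X'')
    (g : Hom Y Y') (g' : Hom Y' Y'') :
    (f.comp f').tensor (g.comp g') = (f.tensor g).comp (f'.tensor g') := by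
  refine Hom.ext ?_ ?_ <;>
  · simp only [Hom.comp, Hom.tensor, blk_comp, BT.map_comp, LinearMap.comp_zero,
      LinearMap.zero_comp, add_zero, zero_add]

theorem Hom.tensor_id (X Y : MF W) : (Hom.id X).tensor (Hom.id Y) = Hom.id (MF.tensor X Y) := by
  refine Hom.ext ?_ ?_ <;>
  · simp only [Hom.id, Hom.tensor, BT.map_id, blk_id]

theorem Homotopic.tensor {X X' Y Y' : MF W} {f f' : Hom X X'} {g g' : Hom Y Y'}
    (hf : Homotopic f f') (hg : Homotopic g g') : Homotopic (f.tensor g) (f'.tensor g') := by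
  have e : ∀ (f : Hom X X') (g : Hom Y Y'), f.tensor g =
      (f.tensor (Hom.id Y)).comp ((Hom.id X').tensor g) := fun f g =>
    (Hom.tensor_comp f (Hom.id X') (Hom.id Y) g)
  rw [e f g, e f' g']
  exact Homotopic.comp (Homotopic.whiskerRight Y hf) (Homotopic.whiskerLeft X' hg)

theorem HEquiv.tensor {X X' Y Y' : MF W} : HEquiv X X' → HEquiv Y Y' →
    HEquiv (MF.tensor X Y) (MF.tensor X' Y') := by
  rintro ⟨f, g, h1, h2⟩ ⟨f', g', h1', h2'⟩
  refine ⟨f.tensor f', g.tensor g', ?_, ?_⟩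
  · rw [← Hom.tensor_comp, ← Hom.tensor_id]
    exact Homotopic.tensor h1 h1'
  · rw [← Hom.tensor_comp, ← Hom.tensor_id]
    exact Homotopic.tensor h2 h2'

/-- A bi-factorisation by free bimodules of finite rank is given by matrices. -/
theorem exists_matFact {X : MF W} (hX : X.EssFinite) : ∃ Z : MatFact W, HEquiv X Z.toMF := by
  obtain ⟨Y, h1, h2, h3, h4, h⟩ := hX
  let e0 := (Module.finBasis Bi Y.X0).equivFun
  let e1 := (Module.finBasis Bi Y.X1).equivFun
  let f0 := e1.toLinearMap ∘ₗ Y.d0 ∘ₗ e0.symm.toLinearMap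
  let f1 := e0.toLinearMap ∘ₗ Y.d1 ∘ₗ e1.symm.toLinearMap
  have h10 : f1 ∘ₗ f0 = pot W • LinearMap.id := by
    refine LinearMap.ext fun v => ?_
    show e0 (Y.d1 (e1.symm (e1 (Y.d0 (e0.symm v))))) = pot W • v
    rw [e1.symm_apply_apply, d1_d0_apply, map_smul, e0.apply_symm_apply]
  have h01 : f0 ∘ₗ f1 = pot W • LinearMap.id := by
    refine LinearMap.ext fun v => ?_
    show e1 (Y.d0 (e0.symm (e0 (Y.d1 (e1.symm v))))) = pot W • v
    rw [e0.symm_apply_apply, d0_d1_apply, map_smul, e1.apply_symm_apply]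
  let Z : MatFact W :=
    { n0 := _
      n1 := _
      D0 := LinearMap.toMatrix' f0
      D1 := LinearMap.toMatrix' f1
      D1_D0 := by rw [← LinearMap.toMatrix'_comp, h10, map_smul, LinearMap.toMatrix'_id]
      D0_D1 := by rw [← LinearMap.toMatrix'_comp, h01, map_smul, LinearMap.toMatrix'_id] }
  have hd0 : Z.toMF.d0 = f0 := by
    show (LinearMap.toMatrix' f0).mulVecLin = f0
    rw [← Matrix.toLin'_apply', Matrix.toLin'_toMatrix']
  have hd1 : Z.toMF.d1 = f1 := by
    show (LinearMap.toMatrix' f1).mulVecLin = f1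
    rw [← Matrix.toLin'_apply', Matrix.toLin'_toMatrix']
  let F : Hom Y Z.toMF := ⟨e0.toLinearMap, e1.toLinearMap,
    by rw [hd0]; ext v; simp [f0], by rw [hd1]; ext v; simp [f1]⟩
  let G : Hom Z.toMF Y := ⟨e0.symm.toLinearMap, e1.symm.toLinearMap,
    by rw [hd0]; ext v; simp [f0], by rw [hd1]; ext v; simp [f1]⟩
  have hFG : F.comp G = Hom.id Y := Hom.ext (LinearEquiv.symm_comp e0) (LinearEquiv.symm_comp e1)
  have hGF : G.comp F = Hom.id Z.toMF :=
    Hom.ext (LinearEquiv.comp_symm e0) (LinearEquiv.comp_symm e1)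
  exact ⟨Z, h.trans ⟨F, G, hFG ▸ Homotopic.refl _, hGF ▸ Homotopic.refl _⟩⟩

end MF

/-! ### Cokernels of matrix factorisations and closure under the tensor product -/

namespace MatFact

variable {W : ℂ[X]} (Z : MatFact W)

/-- Followed by d1 it is multiplication by a nonzero element of a domain on a free module. -/
theorem d0_injective (hW : 0 < W.natDegree) : Function.Injective Z.toMF.d0 := by
  rw [injective_iff_map_eq_zero]
  intro v hv
  have h := Z.toMF.d1_d0_apply v
  rw [hv, map_zero, eq_comm] at h
  exact (smul_eq_zero.1 h).resolve_left (pot_ne_zero hW)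

theorem d1_injective (hW : 0 < W.natDegree) : Function.Injective Z.toMF.d1 := by
  rw [injective_iff_map_eq_zero]
  intro v hv
  have h := Z.toMF.d0_d1_apply v
  rw [hv, map_zero, eq_comm] at h
  exact (smul_eq_zero.1 h).resolve_left (pot_ne_zero hW)

/-- The cokernel of `d1`. -/
abbrev Coker : Type := (Fin Z.n0 → Bi) ⧸ LinearMap.range Z.D1.mulVecLin

theorem pot_smul_coker (m : Z.Coker) : pot W • m = 0 := by
  obtain ⟨v, rfl⟩ := Submodule.Quotient.mk_surjective _ m
  rw [← Submodule.Quotient.mk_smul, Submodule.Quotient.mk_eq_zero]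
  exact ⟨Z.toMF.d0 v, Z.toMF.d1_d0_apply v⟩

/-- If r v = d1(w) then r d0(v) = (W(a) - W(b)) w. Since R ⊗ R modulo W(a) - W(b) is torsion free
from the left, d0(v) is itself a multiple (W(a) - W(b)) y = d0(d1(y)), and injectivity of d0 gives v
= d1(y). -/
theorem coker_torsionFree (hW : 0 < W.natDegree) :
    Module.IsTorsionFree ℂ[X] (LeftRes Z.Coker) := by
  refine ⟨fun r hr => ?_⟩
  have hr0 : r ≠ 0 := hr.ne_zero
  rw [isSMulRegular_iff_right_eq_zero_of_smul]
  intro m hm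
  obtain ⟨v, rfl⟩ := Submodule.Quotient.mk_surjective _ m
  have hm' : inl r • (Submodule.Quotient.mk v : Z.Coker) = 0 := hm
  rw [← Submodule.Quotient.mk_smul, Submodule.Quotient.mk_eq_zero] at hm'
  obtain ⟨w, hw⟩ := hm'
  have h : ∀ i, ∃ y, Z.toMF.d0 v i = pot W * y := fun i => by
    refine pot_dvd_of_inl_mul hW hr0 ⟨w i, ?_⟩
    have := congrFun (congrArg Z.toMF.d0 hw) i
    rw [map_smul] at this
    exact this.symm.trans (congrFun (Z.toMF.d0_d1_apply w) i)
  choose y hy using h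
  refine (Submodule.Quotient.mk_eq_zero _).2 ⟨y, Z.d0_injective hW ?_⟩
  refine (Z.toMF.d0_d1_apply y).trans ?_
  funext i
  exact (hy i).symm

/-- Multiples of W(a) - W(b) lie in the image of d1, so polynomials in b of degree below deg W
represent all classes. -/
theorem coker_finite (hW : 0 < W.natDegree) : Module.Finite ℂ[X] (LeftRes Z.Coker) := by
  let F : (Fin Z.n0 → Polynomial.degreeLT ℂ[X] W.natDegree) →ₗ[ℂ[X]] LeftRes Z.Coker :=
    { toFun := fun p => (Submodule.Quotient.mk fun i => Bi.toPoly.symm (p i).1 : Z.Coker)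
      map_add' := fun p q => by
        refine congrArg (Submodule.Quotient.mk : _ → Z.Coker) ?_
        funext i
        exact map_add Bi.toPoly.symm _ _
      map_smul' := fun r p => by
        refine congrArg (Submodule.Quotient.mk : _ → Z.Coker) ?_
        funext i
        show Bi.toPoly.symm (r • (p i).1) = inl r * _
        rw [AlgEquiv.symm_apply_eq, map_mul, Bi.toPoly_inl, AlgEquiv.apply_symm_apply,
          Polynomial.smul_eq_C_mul] }
  refine Module.Finite.of_surjective F fun m => ?_
  obtain ⟨v, rfl⟩ := Submodule.Quotient.mk_surjective _ m
  choose p hp q hq using fun i => exists_lowDegree hW (v i)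
  refine ⟨fun i => ⟨p i, hp i⟩, ?_⟩
  refine Eq.symm ((Submodule.Quotient.eq (LinearMap.range Z.D1.mulVecLin)).2 ?_)
  have e : (v - fun i => Bi.toPoly.symm (p i)) = pot W • q := funext hq
  rw [e]
  exact ⟨Z.toMF.d0 q, Z.toMF.d1_d0_apply q⟩

theorem coker_free (hW : 0 < W.natDegree) : Module.Free ℂ[X] (LeftRes Z.Coker) :=
  have := Z.coker_finite hW
  have := Z.coker_torsionFree hW
  Module.free_of_finite_type_torsion_free'

/-- `d1` has a left `R`-linear retraction. -/
theorem exists_leftRetraction (hW : 0 < W.natDegree) :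
    ∃ ρ : (Fin Z.n0 → Bi) →+ (Fin Z.n1 → Bi),
      (∀ (r : ℂ[X]) m, ρ (inl r • m) = inl r • ρ m) ∧ ∀ a, ρ (Z.D1.mulVecLin a) = a := by
  have := Z.coker_free hW
  let f : LeftRes (Fin Z.n1 → Bi) →ₗ[ℂ[X]] LeftRes (Fin Z.n0 → Bi) :=
    { toFun := Z.D1.mulVecLin
      map_add' := map_add Z.D1.mulVecLin
      map_smul' := fun r a => map_smul Z.D1.mulVecLin (inl r) a }
  let g : LeftRes (Fin Z.n0 → Bi) →ₗ[ℂ[X]] LeftRes Z.Coker :=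
    { toFun := (LinearMap.range Z.D1.mulVecLin).mkQ
      map_add' := map_add (LinearMap.range Z.D1.mulVecLin).mkQ
      map_smul' := fun r a => map_smul (LinearMap.range Z.D1.mulVecLin).mkQ (inl r) a }
  have hfg : Function.Exact f g := LinearMap.exact_map_mkQ_range Z.D1.mulVecLin
  -- Over the principal ideal domain ℂ[x] the cokernel is free, hence projective, and the sequence
  -- splits left linearly.
  obtain ⟨s, hs⟩ := Module.projective_lifting_property g LinearMap.id
    (Submodule.mkQ_surjective (LinearMap.range Z.D1.mulVecLin))
  have hinj : Function.Injective f := Z.d1_injective hW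
  have hsplit := (hfg.split_tfae'.out 0 1 :
    (Function.Injective f ∧ ∃ l, g ∘ₗ l = LinearMap.id) ↔
      (Function.Surjective g ∧ ∃ l, l ∘ₗ f = LinearMap.id))
  obtain ⟨-, l, hl⟩ := hsplit.1 ⟨hinj, s, hs⟩
  exact ⟨l.toAddMonoidHom, fun r m => map_smul l r (show LeftRes (Fin Z.n0 → Bi) from m), DFunLike.congr_fun hl⟩

/-- `coker(d1) ⊗_R Y`, a bi-factorisation of `W` -/
abbrev cokerTensor (Y : MF W) : MF W where
  X0 := BT Z.Coker Y.X0
  X1 := BT Z.Coker Y.X1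
  d0 := BT.map LinearMap.id Y.d0
  d1 := BT.map LinearMap.id Y.d1
  d1_d0 := by
    rw [BT.map_comp, Y.d1_d0, LinearMap.id_comp, ← map_pot (M := Z.Coker) W,
      show (pot W • LinearMap.id : Z.Coker →ₗ[Bi] Z.Coker) = 0 from
        LinearMap.ext Z.pot_smul_coker, BT.map_zero_left, zero_add]
  d0_d1 := by
    rw [BT.map_comp, Y.d0_d1, LinearMap.id_comp, ← map_pot (M := Z.Coker) W,
      show (pot W • LinearMap.id : Z.Coker →ₗ[Bi] Z.Coker) = 0 from
        LinearMap.ext Z.pot_smul_coker, BT.map_zero_left, zero_add]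

/-- Z ⊗ Y resolves coker(d1) ⊗ Y in the first factor. The left linear splitting of d1 becomes
bilinear because Y is free, so projecting onto the cokernel has a contractible kernel. -/
theorem hEquiv_cokerTensor (hW : 0 < W.natDegree) (Y : MatFact W) :
    MF.HEquiv (MF.tensor Z.toMF Y.toMF) (Z.cokerTensor Y.toMF) := by
  let q := (LinearMap.range Z.D1.mulVecLin).mkQ
  have hq : q ∘ₗ Z.toMF.d1 = 0 := LinearMap.range_mkQ_comp _
  let p : MF.Hom (MF.tensor Z.toMF Y.toMF) (Z.cokerTensor Y.toMF) :=
    { f0 := (BT.map q LinearMap.id).coprod 0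
      f1 := LinearMap.coprod 0 (BT.map q LinearMap.id)
      comm0 := by
        refine LinearMap.prod_ext (BT.hom_ext fun m n => ?_) (BT.hom_ext fun m n => ?_)
        · simp
        · simp [show q (Z.D1.mulVec m) = 0 from DFunLike.congr_fun hq m, bt_zero_left]
      comm1 := by
        refine LinearMap.prod_ext (BT.hom_ext fun m n => ?_) (BT.hom_ext fun m n => ?_)
        · simp [show q (Z.D1.mulVec m) = 0 from DFunLike.congr_fun hq m, bt_zero_left]
        · simp }
  obtain ⟨ρ, h1, h2⟩ := Z.exists_leftRetraction hW
  obtain ⟨r0, hr0⟩ := BT.exists_retraction_right Z.D1.mulVecLin ρ h1 h2 Y.n0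
  obtain ⟨r1, hr1⟩ := BT.exists_retraction_right Z.D1.mulVecLin ρ h1 h2 Y.n1
  have hex : Function.Exact Z.D1.mulVecLin q := LinearMap.exact_map_mkQ_range Z.D1.mulVecLin
  have hs : Function.Surjective q := Submodule.mkQ_surjective _
  obtain ⟨g, hg, hg'⟩ := p.exists_inverse_left (BT.map q LinearMap.id) (BT.map q LinearMap.id)
    rfl rfl (BT.map_surjective hs) (BT.map_surjective hs)
    (fun t => (BT.map_exact hex hs t).1) (fun t => (BT.map_exact hex hs t).1) r0 r1 hr0 hr1
  exact ⟨p, g, hg', hg ▸ MF.Homotopic.refl _⟩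

end MatFact

namespace MFbi

variable {W : ℂ[X]}

/-- The middle variable makes Z ⊗ Z' free of infinite rank in general; the finite model is coker(d1)
⊗_R Z', in which the middle variable acts on a module finite over the left one. -/
theorem tensorClosed (hW : 0 < W.natDegree) : TensorClosed W := by
  intro X Y hX hY
  obtain ⟨Z, hZ⟩ := MF.exists_matFact hX
  obtain ⟨Z', hZ'⟩ := MF.exists_matFact hY
  have := Z.coker_free hW
  have := Z.coker_finite hW
  exact ⟨Z.cokerTensor Z'.toMF, BT.free_of_leftFree (M := Z.Coker) (N := Fin Z'.n0 → Bi),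
    BT.finite_of_leftFinite (M := Z.Coker) (N := Fin Z'.n0 → Bi),
    BT.free_of_leftFree (M := Z.Coker) (N := Fin Z'.n1 → Bi),
    BT.finite_of_leftFinite (M := Z.Coker) (N := Fin Z'.n1 → Bi),
    (hZ.tensor hZ').trans (Z.hEquiv_cokerTensor hW Z')⟩

theorem cls_eq {X Y : MFbi W} {f g : MF.Hom X.toMF Y.toMF} (h : MF.Homotopic f g) :
    (cls f : X ⟶ Y) = cls g := Quotient.sound h

theorem exists_cls {X Y : MFbi W} (f : X ⟶ Y) : ∃ g : MF.Hom X.toMF Y.toMF, cls g = f :=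
  Quotient.exists_rep f

theorem exists_iso (X : MFbi W) : ∃ Z : MatFact W, Nonempty (X ≅ Z.toMFbi) := by
  obtain ⟨Z, f, g, h, h'⟩ := MF.exists_matFact X.essFinite
  exact ⟨Z, ⟨⟨cls f, cls g, cls_eq h, cls_eq h'⟩⟩⟩

end MFbi

/-! ### Unitors -/

section Unitor

/-- `r ⊗ s ↦ -(r ⊗ 1) (s(a) - s(b)) / (a - b)` -/
def leftQuot : Bi →ₗ[ℂ] Bi := -Bi.mulMap inl.toLinearMap dd

/-- `r ⊗ s ↦ (1 ⊗ s) (r(a) - r(b)) / (a - b)` -/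
def rightQuot : Bi →ₗ[ℂ] Bi := Bi.mulMap dd inr.toLinearMap

theorem leftQuot_apply (r s : ℂ[X]) : leftQuot (inl r * inr s) = -(inl r * dd s) :=
  congrArg Neg.neg (Bi.mulMap_apply _ _ r s)

theorem rightQuot_apply (r s : ℂ[X]) : rightQuot (inl r * inr s) = dd r * inr s :=
  Bi.mulMap_apply _ _ r s

theorem leftQuot_smul (r : ℂ[X]) (u : Bi) : leftQuot (inl r • u) = inl r • leftQuot u := by
  rw [smul_eq_mul, smul_eq_mul]
  induction u using Bi.induction with
  | h1 p q => rw [← mul_assoc, ← map_mul, leftQuot_apply, leftQuot_apply, map_mul]; ring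
  | h2 u v hu hv => rw [mul_add, map_add, hu, hv, map_add, mul_add]

theorem rightQuot_smul (r : ℂ[X]) (u : Bi) : rightQuot (inr r • u) = inr r • rightQuot u := by
  rw [smul_eq_mul, smul_eq_mul]
  induction u using Bi.induction with
  | h1 p q => rw [mul_left_comm, ← map_mul, rightQuot_apply, rightQuot_apply, map_mul]; ring
  | h2 u v hu hv => rw [mul_add, map_add, hu, hv, map_add, mul_add]

theorem dd_X : dd Polynomial.X = 1 := by
  apply mul_left_cancel₀ pot_X_ne_zero
  rw [← pot_eq_dd_mul, mul_one]

/-- Together with left linearity this splits multiplication by a - b from the left, the input for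
the left unitor; it is the Leibniz rule with the difference quotient of x equal to 1. -/
theorem leftQuot_pot (u : Bi) : leftQuot (pot Polynomial.X * u) = u := by
  induction u using Bi.induction with
  | h1 p q =>
    have e : pot Polynomial.X * (inl p * inr q) =
        inl (Polynomial.X * p) * inr q - inl p * inr (Polynomial.X * q) := by
      simp only [pot, map_mul]; ring
    rw [e, map_sub, leftQuot_apply, leftQuot_apply, dd_mul', dd_X, map_mul]
    ring
  | h2 u v hu hv => rw [mul_add, map_add, hu, hv]

theorem rightQuot_pot (u : Bi) : rightQuot (pot Polynomial.X * u) = u := by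
  induction u using Bi.induction with
  | h1 p q =>
    have e : pot Polynomial.X * (inl p * inr q) =
        inl (p * Polynomial.X) * inr q - inl p * inr (Polynomial.X * q) := by
      simp only [pot, map_mul]; ring
    rw [e, map_sub, rightQuot_apply, rightQuot_apply, dd_mul', dd_X, map_mul inr]
    ring
  | h2 u v hu hv => rw [mul_add, map_add, hu, hv]

theorem leftQuot_pot_smul (u : Bi) : (leftQuot : Bi →+ Bi)
    ((pot Polynomial.X • LinearMap.id : Bi →ₗ[Bi] Bi) u) = u := leftQuot_pot u

theorem rightQuot_pot_smul (u : Bi) : (rightQuot : Bi →+ Bi)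
    ((pot Polynomial.X • LinearMap.id : Bi →ₗ[Bi] Bi) u) = u := rightQuot_pot u

variable {M : Type} [AddCommGroup M] [Module Bi M]

/-- The kernel of `μ ⊗_R M` is generated by the image of `a - b`. -/
theorem BT.exists_of_lUnit {n : ℕ} {t : BT Bi (Fin n → Bi)} (h : BT.lUnit (Fin n → Bi) t = 0) :
    ∃ t', BT.map (pot Polynomial.X • LinearMap.id : Bi →ₗ[Bi] Bi) LinearMap.id t' = t := by
  -- The elements 1 ⊗ m form a section of μ ⊗ M, so it suffices that each tensor differs from its
  -- normal form by a multiple of a - b.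
  have key : ∀ t : BT Bi (Fin n → Bi), ∃ t',
      BT.map (pot Polynomial.X • LinearMap.id : Bi →ₗ[Bi] Bi) LinearMap.id t' =
        t - bt 1 (BT.lUnit (Fin n → Bi) t) := by
    intro t
    induction t using BT.induction with
    | h0 => exact ⟨0, by rw [map_zero, map_zero, bt_zero_right, sub_zero]⟩
    | h1 u m =>
      obtain ⟨v, hv⟩ := mu_dvd u
      refine ⟨bt v m, ?_⟩
      rw [BT.map_bt, BT.lUnit_bt, ← bt_balanced, ← bt_sub_left, smul_eq_mul, mul_one, hv]
      rfl
    | h2 s t hs ht =>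
      obtain ⟨s', hs⟩ := hs
      obtain ⟨t', ht⟩ := ht
      refine ⟨s' + t', ?_⟩
      rw [map_add, hs, ht, map_add, bt_add_right]
      abel
  obtain ⟨t', ht'⟩ := key t
  exact ⟨t', by rw [ht', h, bt_zero_right, sub_zero]⟩

/-- The kernel of `M ⊗_R μ` is generated by the image of `a - b`. -/
theorem BT.exists_of_rUnit {n : ℕ} {t : BT (Fin n → Bi) Bi} (h : BT.rUnit (Fin n → Bi) t = 0) :
    ∃ t', BT.map LinearMap.id (pot Polynomial.X • LinearMap.id : Bi →ₗ[Bi] Bi) t' = t := by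
  have key : ∀ t : BT (Fin n → Bi) Bi, ∃ t',
      BT.map LinearMap.id (pot Polynomial.X • LinearMap.id : Bi →ₗ[Bi] Bi) t' =
        t - bt (BT.rUnit (Fin n → Bi) t) 1 := by
    intro t
    induction t using BT.induction with
    | h0 => exact ⟨0, by rw [map_zero, map_zero, bt_zero_left, sub_zero]⟩
    | h1 m u =>
      have hu : pot Polynomial.X ∣ u - inl (mu u) := by
        have := dvd_add (mu_dvd u) (dvd_neg.2 ⟨dd (mu u), pot_eq_dd_mul _⟩)
        convert this using 1
        rw [pot]; ring
      obtain ⟨v, hv⟩ := hu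
      refine ⟨bt m v, ?_⟩
      rw [BT.map_bt, BT.rUnit_bt, bt_balanced, ← bt_sub_right, smul_eq_mul, mul_one, hv]
      rfl
    | h2 s t hs ht =>
      obtain ⟨s', hs⟩ := hs
      obtain ⟨t', ht⟩ := ht
      refine ⟨s' + t', ?_⟩
      rw [map_add, hs, ht, map_add, bt_add_left]
      abel
  obtain ⟨t', ht'⟩ := key t
  exact ⟨t', by rw [ht', h, bt_zero_left, sub_zero]⟩

theorem BT.lUnit_surjective : Function.Surjective (BT.lUnit M) := fun m =>
  ⟨bt 1 m, by rw [BT.lUnit_bt, map_one, map_one, one_smul]⟩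

theorem BT.rUnit_surjective : Function.Surjective (BT.rUnit M) := fun m =>
  ⟨bt m 1, by rw [BT.rUnit_bt, map_one, map_one, one_smul]⟩

end Unitor

namespace MF

variable {W : ℂ[X]}

theorem leftUnitor_naturality {X Y : MF W} (f : Hom X Y) :
    ((Hom.id (unit W)).tensor f).comp (leftUnitor Y) = (leftUnitor X).comp f := by
  refine Hom.ext ?_ ?_ <;>
  refine LinearMap.prod_ext (BT.hom_ext fun u m => ?_) (BT.hom_ext fun u m => ?_) <;>
  simp [Hom.comp, Hom.tensor, leftUnitor, Hom.id]

theorem rightUnitor_naturality {X Y : MF W} (f : Hom X Y) :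
    (f.tensor (Hom.id (unit W))).comp (rightUnitor Y) = (rightUnitor X).comp f := by
  refine Hom.ext ?_ ?_ <;>
  refine LinearMap.prod_ext (BT.hom_ext fun u m => ?_) (BT.hom_ext fun u m => ?_) <;>
  simp [Hom.comp, Hom.tensor, rightUnitor, Hom.id]

/-- The contraction onto a cokernel, applied to I: a - b is split injective from the left and μ is
its cokernel. -/
theorem leftUnitor_exists_inverse (Z : MatFact W) : ∃ g : Hom Z.toMF (tensor (unit W) Z.toMF),
    g.comp (leftUnitor Z.toMF) = Hom.id _ ∧ Homotopic ((leftUnitor Z.toMF).comp g) (Hom.id _) := by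
  obtain ⟨r0, hr0⟩ := BT.exists_retraction_right (pot Polynomial.X • LinearMap.id : Bi →ₗ[Bi] Bi)
    (leftQuot : Bi →+ Bi) leftQuot_smul leftQuot_pot_smul Z.n0
  obtain ⟨r1, hr1⟩ := BT.exists_retraction_right (pot Polynomial.X • LinearMap.id : Bi →ₗ[Bi] Bi)
    (leftQuot : Bi →+ Bi) leftQuot_smul leftQuot_pot_smul Z.n1
  exact (leftUnitor Z.toMF).exists_inverse_left (A := unit W) (BT.lUnit (Fin Z.n0 → Bi))
    (BT.lUnit (Fin Z.n1 → Bi)) rfl rfl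
    BT.lUnit_surjective BT.lUnit_surjective (fun _ => BT.exists_of_lUnit)
    (fun _ => BT.exists_of_lUnit) r0 r1 hr0 hr1

theorem rightUnitor_exists_inverse (Z : MatFact W) : ∃ g : Hom Z.toMF (tensor Z.toMF (unit W)),
    g.comp (rightUnitor Z.toMF) = Hom.id _ ∧
      Homotopic ((rightUnitor Z.toMF).comp g) (Hom.id _) := by
  obtain ⟨r0, hr0⟩ := BT.exists_retraction_left (pot Polynomial.X • LinearMap.id : Bi →ₗ[Bi] Bi)
    (rightQuot : Bi →+ Bi) rightQuot_smul rightQuot_pot_smul Z.n0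
  obtain ⟨r1, hr1⟩ := BT.exists_retraction_left (pot Polynomial.X • LinearMap.id : Bi →ₗ[Bi] Bi)
    (rightQuot : Bi →+ Bi) rightQuot_smul rightQuot_pot_smul Z.n1
  exact (rightUnitor Z.toMF).exists_inverse_right (A := unit W) (BT.rUnit (Fin Z.n0 → Bi))
    (BT.rUnit (Fin Z.n1 → Bi)) rfl rfl
    BT.rUnit_surjective BT.rUnit_surjective (fun _ => BT.exists_of_rUnit)
    (fun _ => BT.exists_of_rUnit) r0 r1 hr0 hr1

theorem tensor_eq_comp {X X' Y Y' : MF W} (f : Hom X X') (g : Hom Y Y') :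
    f.tensor g = (f.tensor (Hom.id Y)).comp ((Hom.id X').tensor g) :=
  Hom.tensor_comp f (Hom.id X') (Hom.id Y) g

theorem assoc_naturality {X X' Y Y' Z Z' : MF W} (f : Hom X X') (g : Hom Y Y') (h : Hom Z Z') :
    ((f.tensor g).tensor h).comp (assocHom X' Y' Z') =
      (assocHom X Y Z).comp (f.tensor (g.tensor h)) := by
  refine Hom.ext ?_ ?_ <;>
  refine LinearMap.prod_ext (BT.hom_ext_left (fun a b c => ?_) (fun a b c => ?_))
    (BT.hom_ext_left (fun a b c => ?_) (fun a b c => ?_)) <;>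
  simp [Hom.comp, Hom.tensor, assocHom, assocFwd, bt_zero_left]

theorem triangle (X Y : MF W) : (assocHom X (unit W) Y).comp ((Hom.id X).tensor (leftUnitor Y)) =
    (rightUnitor X).tensor (Hom.id Y) := by
  refine Hom.ext ?_ ?_ <;>
  refine LinearMap.prod_ext (BT.hom_ext_left (fun a b c => ?_) (fun a b c => ?_))
    (BT.hom_ext_left (fun a b c => ?_) (fun a b c => ?_)) <;>
  simp [Hom.comp, Hom.tensor, Hom.id, assocHom, assocFwd, bt_zero_left, bt_zero_right, leftUnitor,
    rightUnitor, bt_balanced]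

end MF

namespace MFbi

variable {W : ℂ[X]} (hT : TensorClosed W)

theorem lam_naturality {X Y : MFbi W} (f : X ⟶ Y) :
    whiskL hT (one W) f ≫ lam hT Y = lam hT X ≫ f := by
  obtain ⟨f, rfl⟩ := exists_cls f
  exact congrArg cls (MF.leftUnitor_naturality f)

theorem rho_naturality {X Y : MFbi W} (f : X ⟶ Y) :
    whiskR hT f (one W) ≫ rho hT Y = rho hT X ≫ f := by
  obtain ⟨f, rfl⟩ := exists_cls f
  exact congrArg cls (MF.rightUnitor_naturality f)

theorem whiskL_comp (A : MFbi W) {X Y Z : MFbi W} (f : X ⟶ Y) (g : Y ⟶ Z) :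
    whiskL hT A (f ≫ g) = whiskL hT A f ≫ whiskL hT A g := by
  obtain ⟨f, rfl⟩ := exists_cls f
  obtain ⟨g, rfl⟩ := exists_cls g
  exact congrArg cls (MF.Hom.tensor_comp (MF.Hom.id A.toMF) (MF.Hom.id A.toMF) f g)

theorem whiskR_comp (A : MFbi W) {X Y Z : MFbi W} (f : X ⟶ Y) (g : Y ⟶ Z) :
    whiskR hT (f ≫ g) A = whiskR hT f A ≫ whiskR hT g A := by
  obtain ⟨f, rfl⟩ := exists_cls f
  obtain ⟨g, rfl⟩ := exists_cls g
  exact congrArg cls (MF.Hom.tensor_comp f g (MF.Hom.id A.toMF) (MF.Hom.id A.toMF))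

theorem whiskL_id (A X : MFbi W) : whiskL hT A (𝟙 X) = 𝟙 (tens hT A X) :=
  congrArg cls (MF.Hom.tensor_id A.toMF X.toMF)

theorem whiskR_id (A X : MFbi W) : whiskR hT (𝟙 X) A = 𝟙 (tens hT X A) :=
  congrArg cls (MF.Hom.tensor_id X.toMF A.toMF)

theorem isIso_cls {X Y : MFbi W} {f : MF.Hom X.toMF Y.toMF} (h : ∃ g : MF.Hom Y.toMF X.toMF,
    g.comp f = MF.Hom.id _ ∧ MF.Homotopic (f.comp g) (MF.Hom.id _)) :
    IsIso (cls f : X ⟶ Y) := by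
  obtain ⟨g, h1, h2⟩ := h
  exact ⟨cls g, cls_eq h2, congrArg cls h1⟩

/-- Naturality reduces the claim to a matrix object isomorphic to X, where freeness provides the
retractions. -/
theorem lam_isIso (X : MFbi W) : IsIso (lam hT X) := by
  obtain ⟨Z, ⟨ϑ⟩⟩ := exists_iso X
  have hZ : IsIso (lam hT Z.toMFbi) := isIso_cls (MF.leftUnitor_exists_inverse Z)
  have : IsIso (whiskL hT (one W) ϑ.hom) := ⟨whiskL hT (one W) ϑ.inv,
    by rw [← whiskL_comp, ϑ.hom_inv_id, whiskL_id],
    by rw [← whiskL_comp, ϑ.inv_hom_id, whiskL_id]⟩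
  have e : lam hT X = whiskL hT (one W) ϑ.hom ≫ lam hT Z.toMFbi ≫ ϑ.inv := by
    rw [← Category.assoc, lam_naturality, Category.assoc, ϑ.hom_inv_id, Category.comp_id]
  rw [e]
  infer_instance

theorem rho_isIso (X : MFbi W) : IsIso (rho hT X) := by
  obtain ⟨Z, ⟨ϑ⟩⟩ := exists_iso X
  have hZ : IsIso (rho hT Z.toMFbi) := isIso_cls (MF.rightUnitor_exists_inverse Z)
  have : IsIso (whiskR hT ϑ.hom (one W)) := ⟨whiskR hT ϑ.inv (one W),
    by rw [← whiskR_comp, ϑ.hom_inv_id, whiskR_id],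
    by rw [← whiskR_comp, ϑ.inv_hom_id, whiskR_id]⟩
  have e : rho hT X = whiskR hT ϑ.hom (one W) ≫ rho hT Z.toMFbi ≫ ϑ.inv := by
    rw [← Category.assoc, rho_naturality, Category.assoc, ϑ.hom_inv_id, Category.comp_id]
  rw [e]
  infer_instance

end MFbi

end MFBi

namespace MFBi

/-! ### The monoidal category -/

section Ext

variable {A A' B B' C C' D E E' Q : Type} [AddCommGroup A] [Module Bi A] [AddCommGroup A']
  [Module Bi A'] [AddCommGroup B] [Module Bi B] [AddCommGroup B'] [Module Bi B'] [AddCommGroup C]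
  [Module Bi C] [AddCommGroup C'] [Module Bi C'] [AddCommGroup D] [Module Bi D]
  [AddCommGroup Q] [Module Bi Q]

theorem BT.induction_left {p : BT (BT A B × BT A' B') C → Prop}
    (h : ∀ a b c, p (bt (bt a b, 0) c)) (h' : ∀ a b c, p (bt (0, bt a b) c))
    (h0 : p 0) (hadd : ∀ s t, p s → p t → p (s + t)) (t : BT (BT A B × BT A' B') C) : p t := by
  induction t using BT.induction with
  | h0 => exact h0
  | h2 s t hs ht => exact hadd _ _ hs ht
  | h1 x c =>
    obtain ⟨t, u⟩ := x
    rw [show ((t, u) : BT A B × BT A' B') = (t, 0) + (0, u) by simp, bt_add_left]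
    refine hadd _ _ ?_ ?_
    · induction t using BT.induction with
      | h0 => rw [Prod.mk_zero_zero, bt_zero_left]; exact h0
      | h1 a b => exact h a b c
      | h2 s t hs ht =>
        rw [show ((s + t, 0) : BT A B × BT A' B') = (s, 0) + (t, 0) by simp, bt_add_left]
        exact hadd _ _ hs ht
    · induction u using BT.induction with
      | h0 => rw [Prod.mk_zero_zero, bt_zero_left]; exact h0
      | h1 a b => exact h' a b c
      | h2 s t hs ht =>
        rw [show ((0, s + t) : BT A B × BT A' B') = (0, s) + (0, t) by simp, bt_add_left]
        exact hadd _ _ hs ht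

theorem BT.hom_ext_left₄ {f g : BT (BT (BT A B × BT A' B') C × BT (BT A' B × BT A B') C') D →ₗ[Bi] Q}
    (h1 : ∀ a b c d, f (bt (bt (bt a b, 0) c, 0) d) = g (bt (bt (bt a b, 0) c, 0) d))
    (h2 : ∀ a b c d, f (bt (bt (0, bt a b) c, 0) d) = g (bt (bt (0, bt a b) c, 0) d))
    (h3 : ∀ a b c d, f (bt (0, bt (bt a b, 0) c) d) = g (bt (0, bt (bt a b, 0) c) d))
    (h4 : ∀ a b c d, f (bt (0, bt (0, bt a b) c) d) = g (bt (0, bt (0, bt a b) c) d)) : f = g :=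
  BT.hom_ext fun x d => by
    obtain ⟨t, u⟩ := x
    rw [show ((t, u) : BT (BT A B × BT A' B') C × BT (BT A' B × BT A B') C') = (t, 0) + (0, u) by
      simp, bt_add_left, map_add, map_add]
    congr 1
    · induction t using BT.induction_left with
      | h a b c => exact h1 a b c d
      | h' a b c => exact h2 a b c d
      | h0 => rw [Prod.mk_zero_zero, bt_zero_left, map_zero, map_zero]
      | hadd s t hs ht =>
        rw [show ((s + t, 0) : BT (BT A B × BT A' B') C × BT (BT A' B × BT A B') C') =
          (s, 0) + (t, 0) by simp, bt_add_left, map_add, map_add, hs, ht]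
    · induction u using BT.induction_left with
      | h a b c => exact h3 a b c d
      | h' a b c => exact h4 a b c d
      | h0 => rw [Prod.mk_zero_zero, bt_zero_left, map_zero, map_zero]
      | hadd s t hs ht =>
        rw [show ((0, s + t) : BT (BT A B × BT A' B') C × BT (BT A' B × BT A B') C') =
          (0, s) + (0, t) by simp, bt_add_left, map_add, map_add, hs, ht]

end Ext

namespace MF

variable {W : ℂ[X]}

set_option maxHeartbeats 1000000 in
theorem pentagon (V X Y Z : MF W) :
    ((assocHom V X Y).tensor (Hom.id Z)).comp ((assocHom V (tensor X Y) Z).comp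
      ((Hom.id V).tensor (assocHom X Y Z))) =
      (assocHom (tensor V X) Y Z).comp (assocHom V X (tensor Y Z)) := by
  refine Hom.ext ?_ ?_ <;>
  refine LinearMap.prod_ext (BT.hom_ext_left₄ (fun a b c d => ?_) (fun a b c d => ?_)
      (fun a b c d => ?_) (fun a b c d => ?_))
    (BT.hom_ext_left₄ (fun a b c d => ?_) (fun a b c d => ?_)
      (fun a b c d => ?_) (fun a b c d => ?_)) <;>
  simp [Hom.comp, Hom.tensor, Hom.id, assocHom, assocFwd, bt_zero_left]

end MF

namespace MFbi

variable {W : ℂ[X]} (hT : TensorClosed W)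

/-- All axioms hold strictly for representatives; homotopies are needed only to invert the unitors.
-/
theorem monoidalLaws (hL : ∀ X : MFbi W, IsIso (lam hT X)) (hR : ∀ X : MFbi W, IsIso (rho hT X)) :
    @PivotalCat.MonoidalLaws (MFbi W) _ (monStruct hT hL hR) := by
  let := monStruct hT hL hR
  refine PivotalCat.MonoidalLaws.mk ?_ ?_ ?_ ?_ ?_ ?_ ?_ ?_ ?_ ?_
  · intro X₁ Y₁ X₂ Y₂ f g
    obtain ⟨f, rfl⟩ := exists_cls f
    obtain ⟨g, rfl⟩ := exists_cls g
    exact congrArg cls (MF.tensor_eq_comp f g)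
  · intro X Y
    exact congrArg cls (MF.Hom.tensor_id X.toMF Y.toMF)
  · intro X₁ Y₁ Z₁ X₂ Y₂ Z₂ f₁ f₂ g₁ g₂
    obtain ⟨f₁, rfl⟩ := exists_cls f₁
    obtain ⟨f₂, rfl⟩ := exists_cls f₂
    obtain ⟨g₁, rfl⟩ := exists_cls g₁
    obtain ⟨g₂, rfl⟩ := exists_cls g₂
    exact congrArg cls (MF.Hom.tensor_comp f₁ g₁ f₂ g₂).symm
  · exact fun X Y => whiskL_id hT X Y
  · exact fun X Y => whiskR_id hT Y X
  · intro X₁ X₂ X₃ Y₁ Y₂ Y₃ f g h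
    obtain ⟨f, rfl⟩ := exists_cls f
    obtain ⟨g, rfl⟩ := exists_cls g
    obtain ⟨h, rfl⟩ := exists_cls h
    exact congrArg cls (MF.assoc_naturality f g h)
  · exact fun f => lam_naturality hT f
  · exact fun f => rho_naturality hT f
  · exact fun V X Y Z => congrArg cls (MF.pentagon V.toMF X.toMF Y.toMF Z.toMF)
  · exact fun X Y => congrArg cls (MF.triangle X.toMF Y.toMF)

variable [hW : Fact (0 < W.natDegree)]

instance : MonoidalCategory (MFbi W) :=
  @PivotalCat.MonoidalLaws.toMonoidalCategory _ _ (monStruct (tensorClosed hW.out)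
    (lam_isIso (tensorClosed hW.out)) (rho_isIso (tensorClosed hW.out)))
    (monoidalLaws (tensorClosed hW.out) _ _)

end MFbi

end MFBi

namespace MFBi

/-! ### Evaluation and coevaluation of matrix objects -/

section Div

variable {P Q : Type} [AddCommGroup P] [Module Bi P] [AddCommGroup Q] [Module Bi Q]

/-- A map that factors pointwise through an injective map factors through it. -/
theorem exists_lift {i : Q →ₗ[Bi] P} {A : Type} [AddCommGroup A] [Module Bi A]
    (hi : Function.Injective i) (g : A →ₗ[Bi] P) (hg : ∀ p, ∃ q, g p = i q) :
    ∃ h : A →ₗ[Bi] Q, g = i ∘ₗ h := by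
  choose h hh using hg
  refine ⟨⟨⟨h, fun p q => hi ?_⟩, fun u p => hi ?_⟩, LinearMap.ext hh⟩
  · rw [map_add, ← hh, ← hh, ← hh, map_add]
  · rw [RingHom.id_apply, map_smul, ← hh, ← hh, map_smul]

theorem unit_d1_injective (W : ℂ[X]) : Function.Injective (MF.unit W).d1 := fun _ _ h =>
  mul_left_cancel₀ pot_X_ne_zero h

theorem exists_unit_d1 (W : ℂ[X]) (u : Bi) (h : mu u = 0) : ∃ v, u = (MF.unit W).d1 v :=
  (mu_eq_zero_iff u).1 h

end Div

section ProdInduction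

variable {A A' B B' : Type} [AddCommGroup A] [Module Bi A] [AddCommGroup A'] [Module Bi A']
  [AddCommGroup B] [Module Bi B] [AddCommGroup B'] [Module Bi B']

theorem BT.prod_induction {p : BT A B × BT A' B' → Prop} (h1 : ∀ a b, p (bt a b, 0))
    (h2 : ∀ a b, p (0, bt a b)) (h3 : ∀ s t, p s → p t → p (s + t)) (t : BT A B × BT A' B') :
    p t := by
  have h0 : p (0, 0) := by simpa [bt_zero_left] using h1 0 0
  obtain ⟨t, t'⟩ := t
  have e : ((t, t') : BT A B × BT A' B') = (t, 0) + (0, t') := by simp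
  rw [e]
  refine h3 _ _ ?_ ?_
  · induction t using BT.induction with
    | h0 => exact h0
    | h1 a b => exact h1 a b
    | h2 s t hs ht =>
      have e : ((s + t, 0) : BT A B × BT A' B') = (s, 0) + (t, 0) := by simp
      rw [e]; exact h3 _ _ (hs (by simp)) (ht (by simp))
  · induction t' using BT.induction with
    | h0 => exact h0
    | h1 a b => exact h2 a b
    | h2 s t hs ht =>
      have e : ((0, s + t) : BT A B × BT A' B') = (0, s) + (0, t) := by simp
      rw [e]; exact h3 _ _ (hs (by simp)) (ht (by simp))

end ProdInduction

namespace MF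

variable {W : ℂ[X]}

/-- A criterion for homotopy in terms of even parts. -/
theorem Homotopic.of_range {P Z : MF W} (hd : Function.Injective Z.d1) {f f' : Hom P Z}
    (h : ∀ x, ∃ y, f.f0 x - f'.f0 x = Z.d1 y) : Homotopic f f' := by
  obtain ⟨h0, e0⟩ := exists_lift hd (f.f0 - f'.f0) h
  -- One component of the homotopy suffices: the odd equation follows from the even one after
  -- applying the injective d1.
  refine ⟨h0, 0, ?_, ?_⟩
  · rw [LinearMap.zero_comp, add_zero, ← e0]; abel
  · refine LinearMap.ext fun x => hd ?_
    have := DFunLike.congr_fun e0 (P.d1 x)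
    simp only [LinearMap.sub_apply, LinearMap.comp_apply] at this
    simp only [LinearMap.comp_zero, zero_add, LinearMap.add_apply, LinearMap.comp_apply, map_add,
      ← this]
    rw [Hom.comm1_apply, Hom.comm1_apply]; abel

/-- Maps to the unit with the same composite with `mu` in even degree are homotopic. -/
theorem Homotopic.of_mu {P : MF W} {f f' : Hom P (unit W)}
    (h : ∀ x, mu (f.f0 x) = mu (f'.f0 x)) : Homotopic f f' :=
  .of_range (unit_d1_injective W) fun x => exists_unit_d1 W _ <| by
    show mu ((f.f0 x : Bi) - f'.f0 x) = 0
    rw [map_sub, h, sub_self]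

/-- A map `P0 → I0` such that its composite with `mu` kills the image of `d1` is the even part of a
closed map. -/
theorem exists_hom_unit {P : MF W} (g : P.X0 →ₗ[Bi] Bi) (hg : ∀ x, mu (g (P.d1 x)) = 0) :
    ∃ f : Hom P (unit W), f.f0 = g := by
  -- Closedness forces the odd part to be g d1 divided by a - b, which is possible exactly because μ
  -- kills g d1; the other closedness relation follows by cancelling a - b.
  obtain ⟨h, e⟩ := exists_lift (unit_d1_injective W) (g ∘ₗ P.d1) fun x => exists_unit_d1 W _ (hg x)
  refine ⟨⟨g, h, ?_, e.symm⟩, rfl⟩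
  refine LinearMap.ext fun x => unit_d1_injective W ?_
  have h1 := DFunLike.congr_fun e (P.d0 x)
  simp only [LinearMap.comp_apply, d1_d0_apply, map_smul] at h1
  simp only [LinearMap.comp_apply]
  rw [← h1, ← LinearMap.comp_apply, (unit W).d1_d0]
  rfl

/-- `e` is an evaluation in terms of residues. -/
def IsResEv (X : MF W) (e : Hom (tensor (dual X) X) (unit W)) : Prop :=
  (∀ φ z, mu (e.f0 (bt φ z, 0)) = Res W (φ (X.d0 z))) ∧ ∀ φ z, mu (e.f0 (0, bt φ z)) = 0

end MF

section Pair

variable {W : ℂ[X]} {n : ℕ}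

theorem atLeft_apply (r s : ℂ[X]) :
    atLeft (inl r * inr s) = toX r * Polynomial.C (inl s) := by
  rw [atLeft, map_mul (Bi.lift _ _), Bi.lift_inl, Bi.lift_inr]
  congr 1
  have : (Polynomial.aeval (Polynomial.C (inl Polynomial.X)) : ℂ[X] →ₐ[ℂ] Polynomial Bi) =
      (Polynomial.CAlgHom (R := ℂ)).comp inl := Polynomial.algHom_ext (by simp)
  rw [this]; rfl

theorem atRight_apply (r s : ℂ[X]) :
    atRight (inl r * inr s) = toX r * Polynomial.C (inr s) := by
  rw [atRight, map_mul (Bi.lift _ _), Bi.lift_inl, Bi.lift_inr]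
  congr 1
  have : (Polynomial.aeval (Polynomial.C (inr Polynomial.X)) : ℂ[X] →ₐ[ℂ] Polynomial Bi) =
      (Polynomial.CAlgHom (R := ℂ)).comp inr := Polynomial.algHom_ext (by simp)
  rw [this]; rfl

theorem atLeft_inl (r : ℂ[X]) : atLeft (inl r) = toX r := by simpa using atLeft_apply r 1
theorem atLeft_inr (r : ℂ[X]) : atLeft (inr r) = Polynomial.C (inl r) := by
  simpa using atLeft_apply 1 r
theorem atRight_inl (r : ℂ[X]) : atRight (inl r) = toX r := by simpa using atRight_apply r 1
theorem atRight_inr (r : ℂ[X]) : atRight (inr r) = Polynomial.C (inr r) := by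
  simpa using atRight_apply 1 r

/-- `pairPoly` as a biadditive map -/
def pairAdd (n : ℕ) : BDual (Fin n → Bi) →+ (Fin n → Bi) →+ Polynomial Bi :=
  mkBi pairPoly (fun φ φ' z => by
      simp only [pairPoly, BDual.add_apply, map_add, add_mul, Finset.sum_add_distrib])
    (fun φ z z' => by
      simp only [pairPoly, Pi.add_apply, map_add, mul_add, Finset.sum_add_distrib])

theorem pairPoly_inl_smul (r : ℂ[X]) (φ : BDual (Fin n → Bi)) (z : Fin n → Bi) :
    pairPoly (inl r • φ) z = Polynomial.C (inl r) * pairPoly φ z := by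
  simp only [pairPoly, BDual.smul_apply, map_smul, sig_inl, smul_eq_mul, map_mul atLeft, atLeft_inr,
    Finset.mul_sum, mul_assoc]

theorem pairPoly_smul_inr (r : ℂ[X]) (φ : BDual (Fin n → Bi)) (z : Fin n → Bi) :
    pairPoly φ (inr r • z) = Polynomial.C (inr r) * pairPoly φ z := by
  simp only [pairPoly, Pi.smul_apply, smul_eq_mul, map_mul atRight, atRight_inr,
    Finset.mul_sum, mul_left_comm]

theorem pairPoly_smul_inl (r : ℂ[X]) (φ : BDual (Fin n → Bi)) (z : Fin n → Bi) :
    pairPoly φ (inl r • z) = toX r * pairPoly φ z := by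
  simp only [pairPoly, Pi.smul_apply, smul_eq_mul, map_mul atRight, atRight_inl,
    Finset.mul_sum, mul_left_comm]

theorem pairPoly_inr_smul (r : ℂ[X]) (φ : BDual (Fin n → Bi)) (z : Fin n → Bi) :
    pairPoly (inr r • φ) z = pairPoly φ (inl r • z) := by
  rw [pairPoly_smul_inl]
  simp only [pairPoly, BDual.smul_apply, map_smul, sig_inr, smul_eq_mul, map_mul atLeft, atLeft_inl,
    Finset.mul_sum, mul_assoc]

theorem pairPoly_pot_smul (W : ℂ[X]) (φ : BDual (Fin n → Bi)) (z : Fin n → Bi) :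
    pairPoly φ (pot W • z) = diffPoly W * pairPoly φ z := by
  have h := map_sub (pairAdd n φ) (inl W • z) (inr W • z)
  rw [← sub_smul] at h
  refine h.trans ?_
  show pairPoly φ (inl W • z) - pairPoly φ (inr W • z) = _
  rw [pairPoly_smul_inl, pairPoly_smul_inr, ← sub_mul, toX_eq]
  rfl

/-- For a = b the two substitutions φ(x, a) and z(x, b) involve the same pair of variables, and the
pairing polynomial becomes φ(z) itself, so only the ordinary residue remains. -/
theorem mu_res_pairPoly (φ : BDual (Fin n → Bi)) (z : Fin n → Bi) :
    mu (-res W (pairPoly φ z)) = Res W (φ z) := by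
  have key : ∀ u v, mu (-res W (atLeft u * atRight v)) = Res W (u * v) := by
    intro u v
    induction u using Bi.induction with
    | h1 r s =>
      induction v using Bi.induction with
      | h1 r' s' =>
        rw [atLeft_apply, atRight_apply, mul_mul_mul_comm, ← map_mul toX, ← Polynomial.C_mul,
          mul_comm, res_C_mul, ← mul_neg, map_mul mu, map_mul mu, mu_inl, mu_inr, mul_mul_mul_comm,
          ← map_mul inl, ← map_mul inr, Res_apply, mul_comm]
        rfl
      | h2 v v' hv hv' => rw [map_add, mul_add, res_add, neg_add, map_add, hv, hv', mul_add, map_add]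
    | h2 v v' hv hv' => rw [map_add, add_mul, res_add, neg_add, map_add, hv, hv', add_mul, map_add]
  have hz : φ z = ∑ i, φ (Pi.single i 1) * z i := by
    conv_lhs => rw [← (Pi.basisFun Bi (Fin n)).sum_repr z]
    rw [map_sum]
    refine Finset.sum_congr rfl fun i _ => ?_
    rw [map_smul, smul_eq_mul, mul_comm]
    simp
  have hr : ∀ (s : Finset (Fin n)) (f : Fin n → Polynomial Bi), mu (-res W (∑ i ∈ s, f i)) =
      ∑ i ∈ s, mu (-res W (f i)) := by
    intro s f
    induction s using Finset.induction_on with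
    | empty => simp [res_zero]
    | insert i s hi ih => rw [Finset.sum_insert hi, res_add, neg_add, map_add, ih,
        Finset.sum_insert hi]
  rw [hz, map_sum, pairPoly, hr]
  exact Finset.sum_congr rfl fun i _ => key _ _

/-- `φ ⊗ z ↦ -res(pairPoly φ z)` -/
def resPair (W : ℂ[X]) (n : ℕ) : BT (BDual (Fin n → Bi)) (Fin n → Bi) →ₗ[Bi] Bi :=
  BT.lift (mkBi (fun φ z => -res W (pairPoly φ z))
      (fun φ φ' z => by
        rw [show pairPoly (φ + φ') z = pairPoly φ z + pairPoly φ' z from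
          DFunLike.congr_fun (map_add (pairAdd n) φ φ') z, res_add, neg_add])
      (fun φ z z' => by
        rw [show pairPoly φ (z + z') = pairPoly φ z + pairPoly φ z' from
          map_add (pairAdd n φ) z z', res_add, neg_add]))
    (fun r φ z => by simp only [mkBi_apply, pairPoly_inr_smul])
    (fun r s φ z => by
      simp only [mkBi_apply, pairPoly_inl_smul, pairPoly_smul_inr, res_C_mul, smul_eq_mul]
      ring)

end Pair

namespace MatFact

variable {W : ℂ[X]} (Z : MatFact W)

/-- Only the even part is chosen. It extends to a closed map because the residue kills multiples of
W(a) - W(b), and the two odd formulas follow by cancelling a - b; the one on Z1^∨ ⊗ Z1 needs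
`res_diffPoly_mul`. -/
theorem exists_ev (hW : 0 < W.natDegree) :
    ∃ e : MF.Hom (Z.toMF.dual.tensor Z.toMF) (MF.unit W), Z.IsEv e := by
  obtain ⟨e, he⟩ := MF.exists_hom_unit (P := Z.toMF.dual.tensor Z.toMF)
    (LinearMap.coprod (resPair W Z.n1 ∘ₗ BT.map LinearMap.id Z.toMF.d0) 0) (by
      refine BT.prod_induction (fun φ z => ?_) (fun φ z => ?_) (fun s t hs ht => ?_)
      · simp only [LinearMap.coprod_apply, LinearMap.comp_apply, blk_apply, map_zero, add_zero,
          BT.map_bt, LinearMap.id_apply, LinearMap.zero_apply]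
        refine (mu_res_pairPoly _ _).trans ?_
        show Res W (-φ (Z.toMF.d1 (Z.toMF.d0 z))) = 0
        rw [MF.d1_d0_apply, map_smul, smul_eq_mul, map_neg, Res_pot_mul hW, neg_zero]
      · simp only [LinearMap.coprod_apply, LinearMap.comp_apply, blk_apply, map_zero, zero_add,
          BT.map_bt, LinearMap.id_apply, LinearMap.zero_apply, add_zero]
        refine (mu_res_pairPoly _ _).trans ?_
        show Res W (φ (Z.toMF.d0 (Z.toMF.d1 z))) = 0
        rw [MF.d0_d1_apply, map_smul, smul_eq_mul, Res_pot_mul hW]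
      · rw [map_add, map_add, map_add, hs, ht, add_zero])
  have h1 : ∀ x, pot Polynomial.X * (e.f1 x : Bi) =
      e.f0 ((Z.toMF.dual.tensor Z.toMF).d1 x) := fun x => e.comm1_apply x
  refine ⟨e, fun φ z => ?_, fun φ z => ?_, fun φ z => ?_, fun φ z => ?_⟩
  · rw [he]
    simp only [LinearMap.coprod_apply, map_zero, add_zero]
    rfl
  · rw [he]; simp
  · refine (h1 _).trans ?_
    rw [he]
    simp only [LinearMap.coprod_apply, LinearMap.comp_apply, blk_apply, map_zero, add_zero,
          BT.map_bt, LinearMap.id_apply, LinearMap.zero_apply]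
    show -res W (pairAdd Z.n1 (-dualMap Z.toMF.d1 φ) (Z.toMF.d0 z)) = _
    rw [map_neg, AddMonoidHom.neg_apply, res_neg, neg_neg]
    rfl
  · refine mul_left_cancel₀ pot_X_ne_zero ((h1 _).trans ?_)
    rw [he]
    simp only [LinearMap.coprod_apply, LinearMap.comp_apply, blk_apply, map_zero, zero_add,
          BT.map_bt, LinearMap.id_apply, LinearMap.zero_apply, add_zero]
    show -res W (pairPoly φ (Z.toMF.d0 (Z.toMF.d1 z))) = _
    rw [MF.d0_d1_apply]
    show -res W (pairPoly φ (pot W • z)) = _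
    rw [pairPoly_pot_smul, res_diffPoly_mul hW, mul_neg]

theorem IsEv.isResEv {e : MF.Hom (Z.toMF.dual.tensor Z.toMF) (MF.unit W)} (he : Z.IsEv e) :
    Z.toMF.IsResEv e := by
  refine ⟨fun φ z => ?_, fun φ z => ?_⟩
  · rw [he.1, mu_res_pairPoly]; rfl
  · rw [he.2.1, map_zero]

/-- Multiplying by a - b undoes the difference quotient: the term with a acts on m, and the term
with b acts on n, with the variables exchanged by the bimodule convention of duals. -/
theorem pot_X_smul_ddMid {M N : Type} [AddCommGroup M] [Module Bi M] [AddCommGroup N] [Module Bi N]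
    (m : M) (n : N) (u : Bi) :
    pot Polynomial.X • ddMid m n u = bt (u • m) n - bt m (sig u • n) := by
  induction u using Bi.induction with
  | h1 r s =>
    rw [ddMid_apply, smul_smul, ← pot_eq_dd_mul, pot, sub_smul, inl_smul_bt, inr_smul_bt, smul_smul,
      bt_balanced s m (inr r • n), smul_smul, map_mul sig, sig_inl, sig_inr, mul_comm (inr r)]
  | h2 u v hu hv => rw [map_add, smul_add, hu, hv, add_smul, bt_add_left, map_add, add_smul,
      bt_add_right]; abel

theorem mulVecLin_single {m n : ℕ} (A : Matrix (Fin m) (Fin n) Bi) (l : Fin n) :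
    A.mulVecLin (Pi.single l 1) = ∑ k, A k l • (Pi.single k 1 : Fin m → Bi) := by
  ext i
  simp [Finset.sum_apply, Pi.single_apply]

theorem dualMap_mulVecLin_coord {m n : ℕ} (A : Matrix (Fin m) (Fin n) Bi) (k : Fin m) :
    dualMap A.mulVecLin (coord k) = ∑ l, sig (A k l) • coord l := by
  have h : ∀ z, (∑ l, sig (A k l) • coord l : BDual (Fin n → Bi)) z = ∑ l, A k l * z l := by
    intro z
    have : ∀ s : Finset (Fin n), (∑ l ∈ s, sig (A k l) • coord l : BDual (Fin n → Bi)) z =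
        ∑ l ∈ s, A k l * z l := by
      intro s
      induction s using Finset.induction_on with
      | empty => rfl
      | insert i s hi ih =>
        rw [Finset.sum_insert hi, BDual.add_apply, ih, Finset.sum_insert hi, BDual.smul_apply,
          sig_sig, map_smul]
        rfl
    exact this _
  ext z
  rw [h]; rfl

/-- `∑ e_i ⊗ e_i^*` -/
def basisSum (n : ℕ) : BT (Fin n → Bi) (BDual (Fin n → Bi)) :=
  ∑ l : Fin n, bt (Pi.single l (1 : Bi) : Fin n → Bi) (coord l)

/-- `∑ (D(a, x) - D(b, x))_{ml} / (a - b) • e_m ⊗ e_l^*` -/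
def quotSum {m n : ℕ} (A : Matrix (Fin m) (Fin n) Bi) : BT (Fin m → Bi) (BDual (Fin n → Bi)) :=
  ∑ k : Fin m, ∑ l : Fin n, ddMid (Pi.single k (1 : Bi) : Fin m → Bi) (coord l) (A k l)

/-- This is one closedness relation of the coevaluation: the difference quotients of the matrix
entries measure how far the canonical elements ∑ e ⊗ e^* are from being exchanged by A ⊗ 1 and 1 ⊗
A^∨. -/
theorem pot_X_smul_quotSum {m n : ℕ} (A : Matrix (Fin m) (Fin n) Bi) :
    pot Polynomial.X • quotSum A = BT.map A.mulVecLin LinearMap.id (basisSum n) -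
      BT.map LinearMap.id (dualMap A.mulVecLin) (basisSum m) := by
  simp only [quotSum, basisSum, Finset.smul_sum, pot_X_smul_ddMid, Finset.sum_sub_distrib, map_sum,
    BT.map_bt, LinearMap.id_apply, mulVecLin_single, dualMap_mulVecLin_coord, bt_sum_left,
    bt_sum_right]
  rw [Finset.sum_comm]

theorem exists_coev :
    ∃ c : MF.Hom (MF.unit W) (Z.toMF.tensor Z.toMF.dual), Z.IsCoev c := by
  have i1 := BDual.free_finite (M := Fin Z.n0 → Bi)
  have i2 := BDual.free_finite (M := Fin Z.n1 → Bi)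
  have := i1.1
  have := i1.2
  have := i2.1
  have := i2.2
  have h1 : (Z.toMF.tensor Z.toMF.dual).d1 (basisSum Z.n1, basisSum Z.n0) =
      pot Polynomial.X • (quotSum Z.D1, quotSum Z.D0) := by
    rw [Prod.smul_mk, pot_X_smul_quotSum, pot_X_smul_quotSum, blk_apply, BT.map_neg_right,
      LinearMap.neg_apply, LinearMap.neg_apply, sub_eq_add_neg, sub_eq_neg_add]
  have h0 : (Z.toMF.tensor Z.toMF.dual).d0 (quotSum Z.D1, quotSum Z.D0) =
      dd W • (basisSum Z.n1, basisSum Z.n0) := by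
    -- The remaining closedness relation is checked after multiplication by a - b; the tensor
    -- products are free, so this loses nothing.
    have : Function.Injective fun x : BT (Fin Z.n1 → Bi) (BDual (Fin Z.n1 → Bi)) ×
        BT (Fin Z.n0 → Bi) (BDual (Fin Z.n0 → Bi)) => pot Polynomial.X • x :=
      smul_right_injective _ pot_X_ne_zero
    refine this ?_
    show pot Polynomial.X • (Z.toMF.tensor Z.toMF.dual).d0 _ = pot Polynomial.X • _
    rw [← map_smul, ← h1, MF.d0_d1_apply, pot_eq_dd_mul, smul_smul]
  refine ⟨⟨LinearMap.toSpanSingleton Bi _ (quotSum Z.D1, quotSum Z.D0),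
    LinearMap.toSpanSingleton Bi _ (basisSum Z.n1, basisSum Z.n0), ?_, ?_⟩, ?_, ?_⟩
  · refine LinearMap.ext_ring ?_
    simp only [LinearMap.comp_apply, LinearMap.toSpanSingleton_apply, one_smul, LinearMap.smul_apply,
      LinearMap.id_apply]
    rw [h0, smul_eq_mul, mul_one]
  · refine LinearMap.ext_ring ?_
    simp only [LinearMap.comp_apply, LinearMap.toSpanSingleton_apply, one_smul, LinearMap.smul_apply,
      LinearMap.id_apply]
    rw [h1, smul_eq_mul, mul_one]
  · exact one_smul Bi _
  · exact one_smul Bi _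

end MatFact

end MFBi

namespace MFBi

/-! ### The zig-zag identities for matrix objects -/

section Contract

variable {W : ℂ[X]} {M N P : Type} [AddCommGroup M] [Module Bi M] [AddCommGroup N] [Module Bi N]
  [AddCommGroup P] [Module Bi P]

theorem BT.mem_of_one_left {N' : Type} [AddCommGroup N'] [Module Bi N'] {g : BT Bi N × BT Bi N' →ₗ[Bi] P}
    {S : Submodule Bi P} (h1 : ∀ n, g (bt 1 n, 0) ∈ S) (h2 : ∀ n, g (0, bt 1 n) ∈ S)
    (t : BT Bi N × BT Bi N') : g t ∈ S := by
  induction t using BT.prod_induction with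
  | h1 u n =>
    induction u using Bi.induction with
    | h1 r s =>
      have e : ((bt (inl r * inr s) n, 0) : BT Bi N × BT Bi N') = inl r • (bt 1 (inl s • n), 0) := by
        rw [bt_mul_left, Prod.smul_mk, smul_zero]
      rw [e, map_smul]
      exact S.smul_mem _ (h1 _)
    | h2 u v hu hv =>
      have e : ((bt (u + v) n, 0) : BT Bi N × BT Bi N') = (bt u n, 0) + (bt v n, 0) := by
        rw [bt_add_left, Prod.mk_add_mk, add_zero]
      rw [e, map_add]
      exact S.add_mem hu hv
  | h2 u n =>
    induction u using Bi.induction with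
    | h1 r s =>
      have e : ((0, bt (inl r * inr s) n) : BT Bi N × BT Bi N') = inl r • (0, bt 1 (inl s • n)) := by
        rw [bt_mul_left, Prod.smul_mk, smul_zero]
      rw [e, map_smul]
      exact S.smul_mem _ (h2 _)
    | h2 u v hu hv =>
      have e : ((0, bt (u + v) n) : BT Bi N × BT Bi N') = (0, bt u n) + (0, bt v n) := by
        rw [bt_add_left, Prod.mk_add_mk, add_zero]
      rw [e, map_add]
      exact S.add_mem hu hv
  | h3 s t hs ht => rw [map_add]; exact S.add_mem hs ht

theorem BT.mem_of_one_right {M' : Type} [AddCommGroup M'] [Module Bi M'] {g : BT M Bi × BT M' Bi →ₗ[Bi] P}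
    {S : Submodule Bi P} (h1 : ∀ n, g (bt n 1, 0) ∈ S) (h2 : ∀ n, g (0, bt n 1) ∈ S)
    (t : BT M Bi × BT M' Bi) : g t ∈ S := by
  induction t using BT.prod_induction with
  | h1 n u =>
    induction u using Bi.induction with
    | h1 r s =>
      have e : ((bt n (inl r * inr s), 0) : BT M Bi × BT M' Bi) = inr s • (bt (inr r • n) 1, 0) := by
        rw [bt_mul_right, Prod.smul_mk, smul_zero]
      rw [e, map_smul]
      exact S.smul_mem _ (h1 _)
    | h2 u v hu hv =>
      have e : ((bt n (u + v), 0) : BT M Bi × BT M' Bi) = (bt n u, 0) + (bt n v, 0) := by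
        rw [bt_add_right, Prod.mk_add_mk, add_zero]
      rw [e, map_add]
      exact S.add_mem hu hv
  | h2 n u =>
    induction u using Bi.induction with
    | h1 r s =>
      have e : ((0, bt n (inl r * inr s)) : BT M Bi × BT M' Bi) = inr s • (0, bt (inr r • n) 1) := by
        rw [bt_mul_right, Prod.smul_mk, smul_zero]
      rw [e, map_smul]
      exact S.smul_mem _ (h2 _)
    | h2 u v hu hv =>
      have e : ((0, bt n (u + v)) : BT M Bi × BT M' Bi) = (0, bt n u) + (0, bt n v) := by
        rw [bt_add_right, Prod.mk_add_mk, add_zero]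
      rw [e, map_add]
      exact S.add_mem hu hv
  | h3 s t hs ht => rw [map_add]; exact S.add_mem hs ht

/-- `t ↦ t ⊗ n`, additively -/
def btLeft (M : Type) [AddCommGroup M] [Module Bi M] (n : N) : M →+ BT M N :=
  AddMonoidHom.mk' (fun m => bt m n) fun m m' => bt_add_left m m' n

/-- `t ↦ m ⊗ t`, additively -/
def btRight (N : Type) [AddCommGroup N] [Module Bi N] (m : M) : N →+ BT M N :=
  AddMonoidHom.mk' (fun n => bt m n) fun n n' => bt_add_right m n n'

/-- L pairs the second factor with v. It is not linear for the right action on the second factor,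
since that variable is integrated out; the action of u turns into a middle residue. -/
theorem contract_smul_right {L : BT M (BDual N) →+ M} {v : N}
    (hL : ∀ m φ, L (bt m φ) = inr (Res W (φ v)) • m) (m : M) (φ : BDual N) (u : Bi) :
    L (u • bt m φ) = star W u (φ v) • m := by
  induction u using Bi.induction with
  | h1 p q => rw [smul_bt, hL, BDual.smul_apply, sig_inr, map_smul, smul_eq_mul, smul_smul,
      star_apply', mul_comm]
  | h2 u u' hu hu' => rw [add_smul, map_add, hu, hu', star_add_left, add_smul]

/-- The commutator identity `star_dd` in module form: one entry of the coevaluation, contracted with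
v. -/
theorem contract_ddMid_right {L : BT M (BDual N) →+ M} {v : N}
    (hL : ∀ m φ, L (bt m φ) = inr (Res W (φ v)) • m) (m : M) (φ : BDual N) (u : Bi) :
    L (ddMid m φ u) = (u * kapBi W (φ v) - kapBi W (u * φ v)) • m := by
  induction u using Bi.induction with
  | h1 p q => rw [ddMid_apply, contract_smul_right hL, smul_smul, star_dd]
  | h2 u u' hu hu' => rw [map_add, map_add, hu, hu', ← add_smul, add_mul, add_mul, map_add]; congr 1; ring

theorem contract_smul_left {L : BT M (BDual N) →+ BDual N} {ρ : M →ₗ[Bi] Bi}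
    (hL : ∀ m φ, L (bt m φ) = inl (Res W (ρ m)) • φ) (m : M) (φ : BDual N) (u : Bi) :
    L (u • bt m φ) = sig (star W (sig u) (ρ m)) • φ := by
  induction u using Bi.induction with
  | h1 p q => rw [smul_bt, hL, map_smul, smul_eq_mul, smul_smul, map_mul sig, sig_inl, sig_inr, mul_comm,
      mul_comm (inr p), star_apply', map_mul sig, sig_inl, sig_inr, mul_comm]
  | h2 u u' hu hu' => rw [add_smul, map_add, hu, hu', map_add sig, star_add_left, map_add, add_smul]

theorem contract_ddMid_left {L : BT M (BDual N) →+ BDual N} {ρ : M →ₗ[Bi] Bi}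
    (hL : ∀ m φ, L (bt m φ) = inl (Res W (ρ m)) • φ) (m : M) (φ : BDual N) (u : Bi) :
    L (ddMid m φ u) = sig (u * kapBi W (ρ m) - kapBi W (u * ρ m)) • φ := by
  induction u using Bi.induction with
  | h1 p q =>
    rw [ddMid_apply, contract_smul_left hL, sig_dd, map_smul, smul_eq_mul, ← star_dd]
    congr 2
    have : ∀ x v, star W x (inr q * v) = star W x v * inr q := fun x v => by
      rw [star_mul_inr, mul_comm]
    exact this _ _
  | h2 u u' hu hu' =>
    rw [map_add, map_add, hu, hu', ← add_smul, add_mul, add_mul, map_add, ← map_add sig]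
    congr 2; ring

end Contract

namespace MatFact

variable {W : ℂ[X]} (Z : MatFact W)

/-- Only even parts modulo the image of d1 matter. On 1 ⊗ z the composite is the commutator of D1
and κ applied to d0(z), that is d1(κ(d0(z))) - κ(D1 D0 z), and the second term equals z. -/
theorem zigzag_right (hW : 0 < W.natDegree) {c : MF.Hom (MF.unit W) (Z.toMF.tensor Z.toMF.dual)}
    (hc : Z.IsCoev c) {e : MF.Hom (Z.toMF.dual.tensor Z.toMF) (MF.unit W)} (he : Z.IsEv e) :
    MF.Homotopic
      (((c.tensor (MF.Hom.id Z.toMF)).comp (MF.assocHom _ _ _)).comp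
        (((MF.Hom.id Z.toMF).tensor e).comp Z.toMF.rightUnitor)) Z.toMF.leftUnitor := by
  refine MF.Homotopic.of_range (Z.d1_injective hW) ?_
  set f := ((c.tensor (MF.Hom.id Z.toMF)).comp (MF.assocHom _ _ _)).comp
        (((MF.Hom.id Z.toMF).tensor e).comp Z.toMF.rightUnitor) with hf
  suffices h : ∀ x, (f.f0 - Z.toMF.leftUnitor.f0) x ∈ LinearMap.range Z.toMF.d1 by
    intro x
    obtain ⟨y, hy⟩ := h x
    exact ⟨y, hy.symm⟩
  refine BT.mem_of_one_left (fun z => ?_) (fun z => ?_)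
  -- With z fixed, the rest of the composite is a contraction Z0 ⊗ Z1^∨ → Z0 of the kind treated
  -- above.
  · let L : BT (Fin Z.n0 → Bi) (BDual (Fin Z.n1 → Bi)) →+ (Fin Z.n0 → Bi) :=
      (BT.rUnit (Fin Z.n0 → Bi) ∘ₗ BT.map LinearMap.id e.f0 ∘ₗ
        BT.map LinearMap.id (LinearMap.inl Bi _ _) ∘ₗ
        BT.assocHom _ _ _).toAddMonoidHom.comp (btLeft _ z)
    have hL : ∀ m φ, L (bt m φ) = inr (Res W (φ (Z.toMF.d0 z))) • m := fun m φ => by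
      rw [← he.isResEv.1]; rfl
    have h1 : f.f0 (bt 1 z, 0) = L (c.f0 (1 : Bi)).1 := by
      simp [hf, MF.Hom.comp, MF.Hom.tensor, MF.Hom.id, MF.assocHom, assocFwd, MF.rightUnitor]
      rfl
    have h2 : (c.f0 (1 : Bi)).1 = quotSum Z.D1 := congrArg Prod.fst hc.1
    have h3 : L (quotSum Z.D1) = Z.toMF.d1 (fun i => kapBi W (Z.toMF.d0 z i)) + z := by
      have hz : ∀ i, ∑ l, kapBi W (Z.D1 i l * Z.toMF.d0 z l) = -z i := fun i => by
        rw [← map_sum, ← kapBi_pot_mul hW]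
        exact congrArg (kapBi W) (congrFun (Z.toMF.d1_d0_apply z) i)
      rw [quotSum, map_sum]
      ext i
      simp only [map_sum, contract_ddMid_right hL, Finset.sum_apply, Pi.smul_apply, smul_eq_mul,
        Pi.single_apply, mul_ite, mul_one, mul_zero, Finset.sum_ite_irrel, Finset.sum_const_zero,
        Finset.sum_ite_eq, Finset.mem_univ, if_true, Finset.sum_sub_distrib, Pi.add_apply]
      refine (congrArg₂ _ rfl (hz i)).trans ?_
      rw [sub_neg_eq_add]
      rfl
    refine ⟨_, eq_sub_of_add_eq ((congrArg₂ _ rfl ?_).trans (h3.symm.trans (h2 ▸ h1.symm)))⟩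
    simp [MF.leftUnitor]
  -- Here the evaluation is fed elements of Z0^∨ ⊗ Z1, where it vanishes; the unitor vanishes on I1
  -- ⊗ Z1 as well.
  · have h1 : f.f0 (0, bt 1 z) = 0 := by
      have h : BT.rUnit (Fin Z.n0 → Bi) ∘ₗ BT.map LinearMap.id e.f0 ∘ₗ
          BT.map LinearMap.id (LinearMap.inr Bi _ _) ∘ₗ
          BT.assocHom (Fin Z.n0 → Bi) (BDual (Fin Z.n0 → Bi)) (Fin Z.n1 → Bi) = 0 :=
        BT.hom_ext₃ fun m φ z => by
          simp only [LinearMap.comp_apply, BT.assocHom_bt, BT.map_bt, LinearMap.id_apply,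
            LinearMap.inr_apply]
          rw [he.2.1, BT.rUnit_bt, map_zero, map_zero, zero_smul]
          rfl
      simp [hf, MF.Hom.comp, MF.Hom.tensor, MF.Hom.id, MF.assocHom, assocFwd, MF.rightUnitor]
      exact DFunLike.congr_fun h _
    rw [LinearMap.sub_apply, h1]
    simp [MF.leftUnitor]

/-- Expansion in the dual basis; the exchange σ compensates the twisted bimodule structure of the
dual. -/
theorem sum_coord {n : ℕ} (φ : BDual (Fin n → Bi)) :
    ∑ l, sig (φ (Pi.single l 1)) • coord l = φ := by
  refine (Pi.basisFun Bi (Fin n)).ext (f₂ := φ) fun i => ?_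
  have : ∀ s : Finset (Fin n), (∑ l ∈ s, sig (φ (Pi.single l 1)) • coord l : BDual (Fin n → Bi))
      (Pi.single i 1) = ∑ l ∈ s, if i = l then φ (Pi.single l 1) else 0 := by
    intro s
    induction s using Finset.induction_on with
    | empty => rfl
    | insert k s hk ih =>
      rw [Finset.sum_insert hk, BDual.add_apply, ih, Finset.sum_insert hk, BDual.smul_apply, sig_sig,
        map_smul]
      congr 1
      show _ * (Pi.single i 1 : Fin n → Bi) k = _
      rw [Pi.single_apply]
      simp [eq_comm]
  rw [Pi.basisFun_apply]
  refine (this Finset.univ).trans ?_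
  rw [Finset.sum_ite_eq, if_pos (Finset.mem_univ _)]
  rfl

theorem dual_d1_injective (hW : 0 < W.natDegree) : Function.Injective Z.toMF.dual.d1 := by
  rw [injective_iff_map_eq_zero]
  intro φ hφ
  ext z
  have h := DFunLike.congr_fun hφ (Z.toMF.d0 z)
  have h' : φ (Z.toMF.d1 (Z.toMF.d0 z)) = 0 := neg_eq_zero.1 h
  rw [MF.d1_d0_apply, map_smul, smul_eq_mul] at h'
  exact (mul_eq_zero.1 h').resolve_left (pot_ne_zero hW)

/-- The same commutator argument with rows in place of columns: now D0 D1 = W(a) - W(b) is used, and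
coefficients act on duals through σ. -/
theorem zigzag_left (hW : 0 < W.natDegree) {c : MF.Hom (MF.unit W) (Z.toMF.tensor Z.toMF.dual)}
    (hc : Z.IsCoev c) {e : MF.Hom (Z.toMF.dual.tensor Z.toMF) (MF.unit W)} (he : Z.IsEv e) :
    MF.Homotopic
      ((((MF.Hom.id Z.toMF.dual).tensor c).comp (MF.assocInv _ _ _)).comp
        ((e.tensor (MF.Hom.id Z.toMF.dual)).comp Z.toMF.dual.leftUnitor))
      Z.toMF.dual.rightUnitor := by
  refine MF.Homotopic.of_range (Z.dual_d1_injective hW) ?_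
  set f := (((MF.Hom.id Z.toMF.dual).tensor c).comp (MF.assocInv _ _ _)).comp
        ((e.tensor (MF.Hom.id Z.toMF.dual)).comp Z.toMF.dual.leftUnitor) with hf
  suffices h : ∀ x, (f.f0 - Z.toMF.dual.rightUnitor.f0) x ∈ LinearMap.range Z.toMF.dual.d1 by
    intro x
    obtain ⟨y, hy⟩ := h x
    exact ⟨y, hy.symm⟩
  refine BT.mem_of_one_right (fun φ => ?_) (fun φ => ?_)
  · let L : BT (Fin Z.n0 → Bi) (BDual (Fin Z.n1 → Bi)) →+ BDual (Fin Z.n1 → Bi) :=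
      (BT.lUnit (BDual (Fin Z.n1 → Bi)) ∘ₗ BT.map e.f0 LinearMap.id ∘ₗ
        BT.map (LinearMap.inl Bi _ _) LinearMap.id ∘ₗ
        BT.assocInv _ _ _).toAddMonoidHom.comp (btRight _ φ)
    let ρ : (Fin Z.n0 → Bi) →ₗ[Bi] Bi := dualMap Z.toMF.d0 φ
    have hL : ∀ m ψ, L (bt m ψ) = inl (Res W (ρ m)) • ψ := fun m ψ => by
      show _ = inl (Res W (φ (Z.toMF.d0 m))) • ψ
      rw [← he.isResEv.1]; rfl
    have h1 : f.f0 (bt φ 1, 0) = L (c.f0 (1 : Bi)).1 := by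
      simp [hf, MF.Hom.comp, MF.Hom.tensor, MF.Hom.id, MF.assocInv, assocBwd, MF.leftUnitor]
      rfl
    have h2 : (c.f0 (1 : Bi)).1 = quotSum Z.D1 := congrArg Prod.fst hc.1
    -- The functional φ ∘ d0 with κ applied to its coordinates; the sign cancels the one in d1 of
    -- the dual.
    let κ : BDual (Fin Z.n0 → Bi) := -(∑ k, sig (kapBi W (ρ (Pi.single k 1))) • coord k)
    have h3 : L (quotSum Z.D1) = Z.toMF.dual.d1 κ + φ := by
      have hz : ∀ l, ∑ k, kapBi W (Z.D1 k l * ρ (Pi.single k 1)) = -φ (Pi.single l 1) := fun l => by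
        rw [← map_sum, ← kapBi_pot_mul hW, ← smul_eq_mul (pot W), ← map_smul, ← Z.toMF.d0_d1_apply]
        show _ = kapBi W (ρ (Z.D1.mulVecLin (Pi.single l 1)))
        rw [mulVecLin_single, map_sum ρ]
        exact congrArg (kapBi W) (Finset.sum_congr rfl fun k _ => (map_smul ρ _ _).symm)
      have h4 : Z.toMF.dual.d1 κ = ∑ k, ∑ l, sig (Z.D1 k l * kapBi W (ρ (Pi.single k 1))) • coord l := by
        show -dualMap Z.D1.mulVecLin κ = _
        rw [← map_neg, neg_neg, map_sum]
        refine Finset.sum_congr rfl fun k _ => ?_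
        rw [map_smul, dualMap_mulVecLin_coord, Finset.smul_sum]
        refine Finset.sum_congr rfl fun l _ => ?_
        rw [smul_smul, map_mul sig, mul_comm]
      have h5 : ∑ k, ∑ l, sig (kapBi W (Z.D1 k l * ρ (Pi.single k 1))) • coord l = -φ := by
        rw [Finset.sum_comm]
        conv_rhs => rw [← sum_coord φ]
        rw [← Finset.sum_neg_distrib]
        refine Finset.sum_congr rfl fun l _ => ?_
        rw [← Finset.sum_smul, ← map_sum sig, hz, map_neg, neg_smul]
      rw [quotSum, map_sum, h4, ← sub_neg_eq_add _ φ, ← h5, ← Finset.sum_sub_distrib]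
      refine Finset.sum_congr rfl fun k _ => ?_
      rw [map_sum, ← Finset.sum_sub_distrib]
      refine Finset.sum_congr rfl fun l _ => ?_
      rw [contract_ddMid_left hL, map_sub sig, sub_smul]
    refine ⟨_, eq_sub_of_add_eq ((congrArg₂ _ rfl ?_).trans (h3.symm.trans (h2 ▸ h1.symm)))⟩
    simp [MF.rightUnitor]
  · have h1 : f.f0 (0, bt φ 1) = 0 := by
      have h : BT.lUnit (BDual (Fin Z.n1 → Bi)) ∘ₗ BT.map e.f0 LinearMap.id ∘ₗ
          BT.map (LinearMap.inr Bi _ _) LinearMap.id ∘ₗ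
          BT.assocInv (BDual (Fin Z.n0 → Bi)) (Fin Z.n1 → Bi) (BDual (Fin Z.n1 → Bi)) = 0 :=
        BT.hom_ext₃' fun φ m ψ => by
          simp only [LinearMap.comp_apply, BT.assocInv_bt, BT.map_bt, LinearMap.id_apply,
            LinearMap.inr_apply]
          rw [he.2.1, BT.lUnit_bt, map_zero, map_zero, zero_smul]
          rfl
      simp [hf, MF.Hom.comp, MF.Hom.tensor, MF.Hom.id, MF.assocInv, assocBwd, MF.leftUnitor]
      exact DFunLike.congr_fun h _
    rw [LinearMap.sub_apply, h1]
    simp [MF.rightUnitor]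

end MatFact

end MFBi

/-! ### Exact pairings are controlled by their evaluations -/

namespace PivotalCat

variable {C : Type*} [Category C] [MonoidalCategory C]

/-- Morphisms into a dual are determined by their contraction with the evaluation. -/
theorem evaluation_injective {A X Y : C} (p : ExactPairing X Y) {f g : A ⟶ Y}
    (h : f ▷ X ≫ p.evaluation' = g ▷ X ≫ p.evaluation') : f = g := by
  have key : ∀ k : A ⟶ Y, (tensorRightHomEquiv A X Y (𝟙_ C)) (k ▷ X ≫ ε_ X Y) = k ≫ (λ_ Y).inv :=
    fun k => @tensorRightHomEquiv_whiskerRight_comp_evaluation C _ _ X A ⟨Y⟩ k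
  have h' := congrArg (tensorRightHomEquiv A X Y (𝟙_ C)) h
  exact (cancel_mono _).1 ((key f).symm.trans (h'.trans (key g)))

/-- The evaluation determines the coevaluation. -/
theorem coevaluation_unique {X Y : C} (p q : ExactPairing X Y)
    (h : p.evaluation' = q.evaluation') : p.coevaluation' = q.coevaluation' := by
  have h1 := @coevaluation_comp_rightAdjointMate C _ _ X X (@HasRightDual.mk _ _ _ X Y p)
    (@HasRightDual.mk _ _ _ X Y q) (𝟙 X)
  have h2 := @rightAdjointMate_comp_evaluation C _ _ X X (@HasRightDual.mk _ _ _ X Y p)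
    (@HasRightDual.mk _ _ _ X Y q) (𝟙 X)
  -- The comparison between the two pairings is the identity of Y, because it intertwines
  -- evaluations that are equal.
  have h3 : @rightAdjointMate C _ _ X X (@HasRightDual.mk _ _ _ X Y p)
      (@HasRightDual.mk _ _ _ X Y q) (𝟙 X) = 𝟙 Y := by
    refine evaluation_injective p (h2.trans ?_)
    rw [whiskerLeft_id, id_whiskerRight Y X]
    exact congrArg (𝟙 (Y ⊗ X) ≫ ·) h.symm
  rw [h3, id_whiskerRight] at h1
  have h4 : q.coevaluation' ≫ X ◁ 𝟙 Y = p.coevaluation' ≫ 𝟙 (X ⊗ Y) := h1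
  rw [whiskerLeft_id, Category.comp_id, Category.comp_id] at h4
  exact h4.symm

namespace RightDuality

variable (D : RightDuality C)

theorem map_whiskerRight_ev {X Y : C} (f : X ⟶ Y) :
    D.map f ▷ X ≫ D.ev X = D.dual Y ◁ f ≫ D.ev Y :=
  @rightAdjointMate_comp_evaluation C _ _ X Y (@HasRightDual.mk _ _ _ X (D.dual X) (D.pairing X))
      (@HasRightDual.mk _ _ _ Y (D.dual Y) (D.pairing Y)) f

theorem map_eq_of {X Y : C} {f : X ⟶ Y} {g : D.dual Y ⟶ D.dual X}
    (h : g ▷ X ≫ D.ev X = D.dual Y ◁ f ≫ D.ev Y) : D.map f = g :=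
  evaluation_injective (D.pairing X) ((D.map_whiskerRight_ev f).trans h.symm)

/-- Turns the definition through coevaluations into one through nested evaluations, which determine
ν² and which residues can compute. -/
theorem nu2_hom_ev (X Y : C) : (D.nu2 X Y).hom ▷ (Y ⊗ X) ≫ D.ev (Y ⊗ X) =
    (α_ _ _ _).hom ≫ D.dual X ◁ (α_ _ _ _).inv ≫ D.dual X ◁ (D.ev Y ▷ X) ≫
      D.dual X ◁ (λ_ X).hom ≫ D.ev X := by
  have h := @rightAdjointMate_comp_evaluation C _ _ (Y ⊗ X) (Y ⊗ X)
    (@HasRightDual.mk _ _ _ (Y ⊗ X) (D.dual (Y ⊗ X)) (D.pairing (Y ⊗ X)))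
    (@HasRightDual.mk _ _ _ (Y ⊗ X) (D.dual X ⊗ D.dual Y)
      (@ExactPairing.tensor C _ _ Y X (D.dual Y) (D.dual X) (D.pairing Y) (D.pairing X))) (𝟙 _)
  refine h.trans ?_
  rw [whiskerLeft_id, Category.id_comp]
  refine (@ExactPairing.tensor_evaluation C _ _ Y X (D.dual Y) (D.dual X) (D.pairing Y) (D.pairing X)).trans ?_
  show 𝟙 _ ⊗≫ D.dual X ◁ (D.ev Y ▷ X) ⊗≫ D.ev X = _
  monoidal

theorem nu0_hom_ev : D.nu0.hom ▷ 𝟙_ C ≫ D.ev (𝟙_ C) = (ρ_ (𝟙_ C)).hom := by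
  have h := @rightAdjointMate_comp_evaluation C _ _ (𝟙_ C) (𝟙_ C)
    (@HasRightDual.mk _ _ _ (𝟙_ C) (D.dual (𝟙_ C)) (D.pairing (𝟙_ C)))
    (@HasRightDual.mk _ _ _ (𝟙_ C) (𝟙_ C) exactPairingUnit) (𝟙 _)
  refine h.trans ?_
  rw [whiskerLeft_id, Category.id_comp]
  rfl

end RightDuality

end PivotalCat

/-! ### Dinaturality of the evaluation and duality of arbitrary objects -/

namespace MFBi

namespace MF

variable {W : ℂ[X]}

/-- Maps from a tensor product to the unit whose even parts have the same composite with `mu` on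
pure tensors are homotopic. -/
theorem Homotopic.of_mu_tensor {A B : MF W} {f g : Hom (MF.tensor A B) (unit W)}
    (h0 : ∀ a b, mu (f.f0 (bt a b, 0)) = mu (g.f0 (bt a b, 0)))
    (h1 : ∀ a b, mu (f.f0 (0, bt a b)) = mu (g.f0 (0, bt a b))) : Homotopic f g :=
  .of_mu <| BT.prod_induction h0 h1 fun s t hs ht => by
    rw [map_add, map_add g.f0]
    exact (map_add mu _ _).trans ((congrArg₂ _ hs ht).trans (map_add mu _ _).symm)

/-- After μ both sides are the residue of φ applied to f d = d f, and on the other even summand both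
vanish. -/
theorem IsResEv.dinatural {X Y : MF W} (f : Hom X Y) {e : Hom (tensor (dual X) X) (unit W)}
    {e' : Hom (tensor (dual Y) Y) (unit W)} (h : X.IsResEv e) (h' : Y.IsResEv e') :
    Homotopic (((Hom.id Y.dual).tensor f).comp e') ((f.dual.tensor (Hom.id X)).comp e) := by
  refine .of_mu_tensor (fun φ z => ?_) (fun φ z => ?_)
  · simp only [Hom.comp, Hom.tensor, Hom.id, Hom.dual, LinearMap.comp_apply, blk_apply, BT.map_bt,
      LinearMap.id_apply, map_zero, add_zero, LinearMap.zero_apply]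
    rw [h'.1, h.1, f.comm0_apply]
    rfl
  · simp only [Hom.comp, Hom.tensor, Hom.id, Hom.dual, LinearMap.comp_apply, blk_apply, BT.map_bt,
      LinearMap.id_apply, map_zero, zero_add, LinearMap.zero_apply]
    rw [h'.2, h.2]

end MF

namespace MFbi

variable {W : ℂ[X]}

theorem dualHom_comp {X Y Z : MFbi W} (f : X ⟶ Y) (g : Y ⟶ Z) :
    dualHom (f ≫ g) = dualHom g ≫ dualHom f := by
  obtain ⟨f, rfl⟩ := exists_cls f
  obtain ⟨g, rfl⟩ := exists_cls g
  rfl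

theorem dualHom_id (X : MFbi W) : dualHom (𝟙 X) = 𝟙 (dual X) := rfl

/-- The isomorphism of duals induced by an isomorphism. -/
def dualIso {X Y : MFbi W} (ϑ : X ≅ Y) : dual X ≅ dual Y where
  hom := dualHom ϑ.inv
  inv := dualHom ϑ.hom
  hom_inv_id := by rw [← dualHom_comp, ϑ.hom_inv_id, dualHom_id]
  inv_hom_id := by rw [← dualHom_comp, ϑ.inv_hom_id, dualHom_id]

variable [hW : Fact (0 < W.natDegree)]

/-- The coevaluation of a matrix object. -/
def matCoev (Z : MatFact W) : 𝟙_ (MFbi W) ⟶ Z.toMFbi ⊗ dual Z.toMFbi :=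
  cls (X := one W) (Y := tens (tensorClosed hW.out) Z.toMFbi (dual Z.toMFbi)) Z.exists_coev.choose

/-- The evaluation of a matrix object. -/
def matEv (Z : MatFact W) : dual Z.toMFbi ⊗ Z.toMFbi ⟶ 𝟙_ (MFbi W) :=
  cls (X := tens (tensorClosed hW.out) (dual Z.toMFbi) Z.toMFbi) (Y := one W)
    (Z.exists_ev hW.out).choose

/-- The duality of matrix objects. -/
abbrev matPairing (Z : MatFact W) : ExactPairing Z.toMFbi (dual Z.toMFbi) where
  coevaluation' := matCoev Z
  evaluation' := matEv Z
  coevaluation_evaluation' := by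
    rw [Iso.eq_comp_inv, Category.assoc, Category.assoc]
    exact cls_eq (Z.zigzag_left hW.out Z.exists_coev.choose_spec (Z.exists_ev hW.out).choose_spec)
  evaluation_coevaluation' := by
    rw [Iso.eq_comp_inv, Category.assoc, Category.assoc]
    exact cls_eq (Z.zigzag_right hW.out Z.exists_coev.choose_spec (Z.exists_ev hW.out).choose_spec)

theorem matEv_dinatural {Z Z' : MatFact W} (f : Z.toMFbi ⟶ Z'.toMFbi) :
    dual Z'.toMFbi ◁ f ≫ matEv Z' = dualHom f ▷ Z.toMFbi ≫ matEv Z := by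
  obtain ⟨f, rfl⟩ := exists_cls f
  exact cls_eq (MF.IsResEv.dinatural f (Z.exists_ev hW.out).choose_spec.isResEv
    (Z'.exists_ev hW.out).choose_spec.isResEv)

/-- A matrix object isomorphic to `X`. -/
def model (X : MFbi W) : MatFact W := (exists_iso X).choose

/-- The isomorphism of `X` with its model. -/
def toModel (X : MFbi W) : X ≅ X.model.toMFbi := (exists_iso X).choose_spec.some

/-- The duality of an object, transported along an isomorphism to a matrix object. -/
abbrev pairingOf {X : MFbi W} {Z : MatFact W} (ϑ : X ≅ Z.toMFbi) : ExactPairing X (dual X) :=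
  @exactPairingCongr _ _ _ _ _ _ _ (matPairing Z) ϑ (dualIso ϑ)

theorem pairingOf_ev {X : MFbi W} {Z : MatFact W} (ϑ : X ≅ Z.toMFbi) :
    (pairingOf ϑ).evaluation' = (dualHom ϑ.inv ⊗ₘ ϑ.hom) ≫ matEv Z := by
  refine Eq.trans (b := dual X ◁ ϑ.hom ≫ dualHom ϑ.inv ▷ _ ≫ matEv Z) rfl ?_
  rw [tensorHom_def', Category.assoc]

theorem pairingOf_coev {X : MFbi W} {Z : MatFact W} (ϑ : X ≅ Z.toMFbi) :
    (pairingOf ϑ).coevaluation' = matCoev Z ≫ (ϑ.inv ⊗ₘ dualHom ϑ.hom) := by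
  refine Eq.trans (b := (matCoev Z ≫ _ ◁ dualHom ϑ.hom) ≫ ϑ.inv ▷ _) rfl ?_
  rw [tensorHom_def', Category.assoc]

/-- The duality of an arbitrary object. -/
abbrev pairing (X : MFbi W) : ExactPairing X (dual X) := pairingOf X.toModel

variable (W) in
/-- The right duality of `MF_bi(W)`. -/
def duality : PivotalCat.RightDuality (MFbi W) := ⟨dual, pairing⟩

/-- The evaluation of an arbitrary object. -/
def ev (X : MFbi W) : dual X ⊗ X ⟶ 𝟙_ (MFbi W) := (duality W).ev X

/-- Composing f with the isomorphism to the chosen model gives a map of matrix objects; dinaturality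
moves it to the dual side, where the isomorphism cancels. The model has disappeared from the result.
-/
theorem whiskerLeft_ev {X : MFbi W} {Z : MatFact W} (f : Z.toMFbi ⟶ X) :
    dual X ◁ f ≫ ev X = dualHom f ▷ Z.toMFbi ≫ matEv Z := by
  rw [show ev X = _ from pairingOf_ev X.toModel, MonoidalCategory.tensorHom_def,
    Category.assoc, whisker_exchange_assoc, ← whiskerLeft_comp_assoc, matEv_dinatural,
    ← comp_whiskerRight_assoc, ← dualHom_comp, Category.assoc, Iso.hom_inv_id, Category.comp_id]

theorem ev_dinatural {X Y : MFbi W} (f : X ⟶ Y) :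
    dualHom f ▷ X ≫ ev X = dual Y ◁ f ≫ ev Y := by
  rw [← cancel_epi (dual Y ◁ X.toModel.inv), whisker_exchange_assoc, whiskerLeft_ev,
    ← whiskerLeft_comp_assoc, whiskerLeft_ev, dualHom_comp, comp_whiskerRight_assoc]

theorem ev_eq {X : MFbi W} {Z : MatFact W} (ϑ : X ≅ Z.toMFbi) :
    ev X = (dualHom ϑ.inv ⊗ₘ ϑ.hom) ≫ matEv Z := by
  rw [tensorHom_def', Category.assoc, ← whiskerLeft_ev, whiskerLeft_hom_inv_assoc]

theorem map_eq_dualHom {X Y : MFbi W} (f : X ⟶ Y) : (duality W).map f = dualHom f :=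
  (duality W).map_eq_of (ev_dinatural f)

/-- Independence of the model passes from the evaluation to the coevaluation, because the former
determines the latter. -/
theorem coev_eq {X : MFbi W} {Z : MatFact W} (ϑ : X ≅ Z.toMFbi) :
    (duality W).coev X = matCoev Z ≫ (ϑ.inv ⊗ₘ dualHom ϑ.hom) :=
  (PivotalCat.coevaluation_unique _ _ ((ev_eq ϑ).trans (pairingOf_ev ϑ).symm)).trans
    (pairingOf_coev ϑ)

theorem isEv (X : MFbi W) : IsEv (tensorClosed hW.out) X ((duality W).ev X) := fun Z ϑ =>
  ⟨_, (Z.exists_ev hW.out).choose_spec, ev_eq ϑ⟩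

theorem isCoev (X : MFbi W) : IsCoev (tensorClosed hW.out) X ((duality W).coev X) := fun Z ϑ =>
  ⟨_, Z.exists_coev.choose_spec, coev_eq ϑ⟩

end MFbi

end MFBi

/-! ### Explicit representatives of ν⁰ and ν² by residues -/

namespace MFBi

section DualTensor

variable {W : ℂ[X]} {M N : Type} [AddCommGroup M] [Module Bi M] [AddCommGroup N] [Module Bi N]

variable (W) in
/-- `m ⊗ n ↦ φ(m) ⋆ ψ(n)` -/
def dualTensorAux (ψ : BDual N) (φ : BDual M) : BDual (BT M N) :=
  BT.lift (mkBi (fun m n => star W (φ m) (ψ n))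
      (fun m m' n => by rw [map_add, star_add_left])
      (fun m n n' => by rw [map_add, star_add_right]))
    (fun r m n => by
      simp only [mkBi_apply, map_smul, smul_eq_mul, star_inr_mul])
    (fun r s m n => by
      simp only [mkBi_apply, map_smul, smul_eq_mul, star_inl_mul, star_mul_inr,
        mul_assoc, mul_left_comm (inr s)])

theorem dualTensorAux_bt (ψ : BDual N) (φ : BDual M) (m : M) (n : N) :
    dualTensorAux W ψ φ (bt m n) = star W (φ m) (ψ n) := rfl

theorem BDual.ext_bt {φ ψ : BDual (BT M N)} (h : ∀ m n, φ (bt m n) = ψ (bt m n)) : φ = ψ :=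
  BT.hom_ext h

variable (W M N) in
/-- `ψ ⊗ φ ↦ (m ⊗ n ↦ φ(m) ⋆ ψ(n))` -/
def dualTensor : BT (BDual N) (BDual M) →ₗ[Bi] BDual (BT M N) :=
  BT.lift (mkBi (fun ψ φ => dualTensorAux W ψ φ)
      (fun ψ ψ' φ => BDual.ext_bt fun m n => by
        simp only [dualTensorAux_bt, BDual.add_apply, star_add_right])
      (fun ψ φ φ' => BDual.ext_bt fun m n => by
        simp only [dualTensorAux_bt, BDual.add_apply, star_add_left]))
    (fun r ψ φ => BDual.ext_bt fun m n => by
      simp only [mkBi_apply, dualTensorAux_bt, BDual.smul_apply, sig_inl, sig_inr, map_smul,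
        smul_eq_mul, star_inr_mul])
    (fun r s ψ φ => BDual.ext_bt fun m n => by
      simp only [mkBi_apply]
      rw [BDual.smul_apply, map_smul, dualTensorAux_bt, dualTensorAux_bt, BDual.smul_apply,
        BDual.smul_apply, map_mul sig]
      simp only [sig_inl, sig_inr, map_smul, smul_eq_mul, star_inl_mul, star_mul_inr]
      ring)

theorem star_pot_mul (hW : 0 < W.natDegree) (u v : Bi) : star W u (pot W * v) = 0 := by
  induction u using Bi.induction with
  | h1 r s => rw [star_apply', mul_left_comm, Res_pot_mul hW, map_zero, mul_zero]
  | h2 u u' hu hu' => rw [star_add_left, hu, hu', add_zero]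

theorem star_neg_right (u v : Bi) : star W u (-v) = -star W u v := by
  rw [eq_neg_iff_add_eq_zero, ← star_add_right, neg_add_cancel]
  have := star_add_right (W := W) u 0 0
  rwa [add_zero, left_eq_add] at this

/-- On pure tensors both iterated residues are products of one-variable residues, since an inner
residue is a scalar for the outer one by `tau_tau_mul`. This identifies nested evaluations with the
evaluation of a tensor product. -/
theorem Res_star (hW : 0 < W.natDegree) (u v : Bi) :
    Res W (star W u v) = Res W (inl (Res W u) * v) := by
  induction u, v using Bi.induction₂ with
  | h r s p q =>
    rw [star_apply, Res_apply, Res_apply, ← mul_assoc (inl _), ← map_mul inl, Res_apply,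
      mul_assoc (tau W r), tau_tau_mul hW, mul_assoc]
  | hl u u' v hu hu' => rw [star_add_left, map_add, hu, hu', map_add, map_add, add_mul, map_add]
  | hr u v v' hu hu' => rw [star_add_right, map_add, hu, hu', mul_add, map_add]

/-- Two orders of integrating out the variables. They agree because the middle residue is a
polynomial in W, which the outer residue treats as a constant. This is the analytic content of the
compatibility of δ with tensor products. -/
theorem Res_star_sig (hW : 0 < W.natDegree) (u v : Bi) :
    Res W (star W (sig v) (sig u)) = Res W (sig (star W u v)) := by
  induction u, v using Bi.induction₂ with
  | h r s p q =>
    simp only [map_mul sig, sig_inl, sig_inr]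
    rw [mul_comm (inr r), mul_comm (inr p), star_apply, star_apply, map_mul sig, sig_inl, sig_inr,
      mul_comm (inr r), Res_apply, Res_apply, tau_tau_mul hW, mul_comm p]
    ring
  | hl u u' v hu hu' => rw [star_add_left, map_add, star_add_right, map_add, hu, hu', map_add, map_add]
  | hr u v v' hu hu' => rw [star_add_right, map_add, star_add_left, map_add, hu, hu', map_add, map_add]

end DualTensor

namespace MF

variable {W : ℂ[X]}

theorem tensor_d0_left (X Y : MF W) (x : X.X0) (y : Y.X0) :
    (tensor X Y).d0 (bt x y, 0) = (bt (X.d0 x) y, bt x (Y.d0 y)) := by simp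

theorem tensor_d0_right (X Y : MF W) (x : X.X1) (y : Y.X1) :
    (tensor X Y).d0 (0, bt x y) = (bt x (-Y.d1 y), bt (X.d1 x) y) := by simp [bt_neg_right]

theorem tensor_d1_left (X Y : MF W) (x : X.X1) (y : Y.X0) :
    (tensor X Y).d1 (bt x y, 0) = (bt (X.d1 x) y, bt x (-Y.d0 y)) := by simp [bt_neg_right]

theorem tensor_d1_right (X Y : MF W) (x : X.X0) (y : Y.X1) :
    (tensor X Y).d1 (0, bt x y) = (bt x (Y.d1 y), bt (X.d0 x) y) := by simp

/-- The even part of the map `Y^∨ ⊗ X^∨ → (X ⊗ Y)^∨`. -/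
def dualTensorEven (X Y : MF W) : (tensor (dual Y) (dual X)).X0 →ₗ[Bi] (dual (tensor X Y)).X0 :=
  dualMap (LinearMap.fst Bi _ _) ∘ₗ dualTensor W X.X1 Y.X0 ∘ₗ
    BT.map (dualMap Y.d0) LinearMap.id ∘ₗ LinearMap.fst Bi _ _

/-- The odd part of the map `Y^∨ ⊗ X^∨ → (X ⊗ Y)^∨`. -/
def dualTensorOdd (X Y : MF W) : (tensor (dual Y) (dual X)).X1 →ₗ[Bi] (dual (tensor X Y)).X1 :=
  dualMap (LinearMap.fst Bi _ _) ∘ₗ dualTensor W X.X0 Y.X0 ∘ₗ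
    BT.map (dualMap Y.d0) LinearMap.id ∘ₗ LinearMap.snd Bi _ _

theorem dualTensorEven_zero_left (X Y : MF W) (t) : dualTensorEven X Y (0, t) = 0 := by
  simp [dualTensorEven]

theorem dualTensorEven_zero_right (X Y : MF W) (s t) :
    (show BDual (BT X.X1 Y.X0 × BT X.X0 Y.X1) from dualTensorEven X Y s) (0, t) = 0 :=
  map_zero (dualTensor W X.X1 Y.X0 (BT.map (dualMap Y.d0) LinearMap.id s.1))

theorem dualTensorOdd_zero_left (X Y : MF W) (t) : dualTensorOdd X Y (t, 0) = 0 := by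
  simp [dualTensorOdd]

theorem dualTensorOdd_zero_right (X Y : MF W) (s t) :
    (show BDual (BT X.X0 Y.X0 × BT X.X1 Y.X1) from dualTensorOdd X Y s) (0, t) = 0 :=
  map_zero (dualTensor W X.X0 Y.X0 (BT.map (dualMap Y.d0) LinearMap.id s.2))

theorem dualTensor_pot (hW : 0 < W.natDegree) (Y : MF W) (u : Bi) (ψ : BDual Y.X0) (y : Y.X0) :
    star W u (dualMap Y.d1 ψ (Y.d0 y)) = 0 := by
  rw [dualMap_apply, d1_d0_apply, map_smul, smul_eq_mul, star_pot_mul hW]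

theorem dualTensor_pot' (hW : 0 < W.natDegree) (Y : MF W) (u : Bi) (ψ : BDual Y.X1) (y : Y.X1) :
    star W u (ψ (Y.d0 (Y.d1 y))) = 0 := by
  rw [d0_d1_apply, map_smul, smul_eq_mul, star_pot_mul hW]

/-- The map `Y^∨ ⊗ X^∨ → (X ⊗ Y)^∨`. -/
def dualTensorHom (hW : 0 < W.natDegree) (X Y : MF W) :
    Hom (tensor (dual Y) (dual X)) (dual (tensor X Y)) where
  f0 := dualTensorEven X Y
  f1 := dualTensorOdd X Y
  comm0 := by
    refine LinearMap.prod_ext (BT.hom_ext fun ψ φ => LinearMap.prod_ext (BT.hom_ext fun x y => ?_)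
      (BT.hom_ext fun x y => ?_)) (BT.hom_ext fun ψ φ => LinearMap.prod_ext (BT.hom_ext fun x y => ?_)
      (BT.hom_ext fun x y => ?_))
    · show (dualTensorEven X Y (bt ψ φ, 0) : BDual (BT X.X1 Y.X0 × BT X.X0 Y.X1))
          ((tensor X Y).d0 (bt x y, 0)) = (dualTensorOdd X Y ((tensor (dual Y) (dual X)).d0
            (bt ψ φ, 0)) : BDual (BT X.X0 Y.X0 × BT X.X1 Y.X1)) (bt x y, 0)
      rw [tensor_d0_left, tensor_d0_left]
      rfl
    · show (dualTensorEven X Y (bt ψ φ, 0) : BDual (BT X.X1 Y.X0 × BT X.X0 Y.X1))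
          ((tensor X Y).d0 (0, bt x y)) = (dualTensorOdd X Y ((tensor (dual Y) (dual X)).d0
            (bt ψ φ, 0)) : BDual (BT X.X0 Y.X0 × BT X.X1 Y.X1)) (0, bt x y)
      rw [tensor_d0_left, tensor_d0_right]
      -- Both sides vanish: the target sees only one summand of X ⊗ Y, and the middle residue kills
      -- d0 d1 = W(a) - W(b).
      refine Eq.trans ?_ (dualTensorOdd_zero_right X Y _ _).symm
      show star W (φ x) (ψ (Y.d0 (-Y.d1 y))) = 0
      rw [map_neg, map_neg, star_neg_right, dualTensor_pot' hW, neg_zero]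
    · show (dualTensorEven X Y (0, bt ψ φ) : BDual (BT X.X1 Y.X0 × BT X.X0 Y.X1))
          ((tensor X Y).d0 (bt x y, 0)) = (dualTensorOdd X Y ((tensor (dual Y) (dual X)).d0
            (0, bt ψ φ)) : BDual (BT X.X0 Y.X0 × BT X.X1 Y.X1)) (bt x y, 0)
      rw [tensor_d0_left, tensor_d0_right, dualTensorEven_zero_left]
      show 0 = star W (φ x) (-dualMap Y.d1 ψ (Y.d0 y))
      rw [star_neg_right, dualTensor_pot hW, neg_zero]
    · show (dualTensorEven X Y (0, bt ψ φ) : BDual (BT X.X1 Y.X0 × BT X.X0 Y.X1))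
          ((tensor X Y).d0 (0, bt x y)) = (dualTensorOdd X Y ((tensor (dual Y) (dual X)).d0
            (0, bt ψ φ)) : BDual (BT X.X0 Y.X0 × BT X.X1 Y.X1)) (0, bt x y)
      rw [dualTensorEven_zero_left]
      exact (dualTensorOdd_zero_right X Y _ _).symm
  comm1 := by
    refine LinearMap.prod_ext (BT.hom_ext fun ψ φ => LinearMap.prod_ext (BT.hom_ext fun x y => ?_)
      (BT.hom_ext fun x y => ?_)) (BT.hom_ext fun ψ φ => LinearMap.prod_ext (BT.hom_ext fun x y => ?_)
      (BT.hom_ext fun x y => ?_))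
    · show -(dualTensorOdd X Y (bt ψ φ, 0) : BDual (BT X.X0 Y.X0 × BT X.X1 Y.X1))
          ((tensor X Y).d1 (bt x y, 0)) = (dualTensorEven X Y ((tensor (dual Y) (dual X)).d1
            (bt ψ φ, 0)) : BDual (BT X.X1 Y.X0 × BT X.X0 Y.X1)) (bt x y, 0)
      rw [tensor_d1_left, tensor_d1_left, dualTensorOdd_zero_left]
      show -(0 : Bi) = star W (φ x) (-dualMap Y.d1 ψ (Y.d0 y))
      rw [star_neg_right, dualTensor_pot hW]
    · show -(dualTensorOdd X Y (bt ψ φ, 0) : BDual (BT X.X0 Y.X0 × BT X.X1 Y.X1))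
          ((tensor X Y).d1 (0, bt x y)) = (dualTensorEven X Y ((tensor (dual Y) (dual X)).d1
            (bt ψ φ, 0)) : BDual (BT X.X1 Y.X0 × BT X.X0 Y.X1)) (0, bt x y)
      rw [dualTensorOdd_zero_left]
      exact neg_zero.trans (dualTensorEven_zero_right X Y _ _).symm
    · show -(dualTensorOdd X Y (0, bt ψ φ) : BDual (BT X.X0 Y.X0 × BT X.X1 Y.X1))
          ((tensor X Y).d1 (bt x y, 0)) = (dualTensorEven X Y ((tensor (dual Y) (dual X)).d1
            (0, bt ψ φ)) : BDual (BT X.X1 Y.X0 × BT X.X0 Y.X1)) (bt x y, 0)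
      rw [tensor_d1_right, tensor_d1_left]
      show -star W (φ (X.d1 x)) (ψ (Y.d0 y)) = star W (-φ (X.d1 x)) (ψ (Y.d0 y))
      rw [eq_comm, eq_neg_iff_add_eq_zero, ← star_add_left, neg_add_cancel]
      exact map_zero _
    · show -(dualTensorOdd X Y (0, bt ψ φ) : BDual (BT X.X0 Y.X0 × BT X.X1 Y.X1))
          ((tensor X Y).d1 (0, bt x y)) = (dualTensorEven X Y ((tensor (dual Y) (dual X)).d1
            (0, bt ψ φ)) : BDual (BT X.X1 Y.X0 × BT X.X0 Y.X1)) (0, bt x y)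
      rw [tensor_d1_right]
      refine Eq.trans ?_ (dualTensorEven_zero_right X Y _ _).symm
      show -star W (φ x) (ψ (Y.d0 (Y.d1 y))) = 0
      rw [dualTensor_pot' hW, neg_zero]

/-- The map `R ⊗ R → (R ⊗ R)^∨`, `u ↦ (v ↦ σ(u) v)`. -/
def toDual : Bi →ₗ[Bi] BDual Bi where
  toFun u := LinearMap.mulLeft Bi (sig u)
  map_add' u u' := BDual.ext fun v => (congrArg (· * v) (map_add sig u u')).trans (add_mul _ _ _)
  map_smul' w u := BDual.ext fun v => by
    show sig (w * u) * v = sig w * (sig u * v)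
    rw [map_mul sig, mul_assoc]

variable (W) in
/-- The map `I → I^∨`. -/
def unitDual : Hom (unit W) (dual (unit W)) where
  f0 := toDual
  f1 := toDual
  comm0 := LinearMap.ext fun u => BDual.ext fun v => by
    show sig u * (dd W * v) = sig (dd W * u) * v
    rw [map_mul sig, sig_dd]; ring
  comm1 := LinearMap.ext fun u => BDual.ext fun v => by
    show -(sig u * (pot Polynomial.X * v)) = sig (pot Polynomial.X * u) * v
    rw [map_mul sig, sig_pot]; ring

theorem Hom.tensor_f0_left {X X' Y Y' : MF W} (f : Hom X X') (g : Hom Y Y') (x : X.X0) (y : Y.X0) :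
    (f.tensor g).f0 (bt x y, 0) = (bt (f.f0 x) (g.f0 y), 0) := by simp [Hom.tensor]

theorem Hom.tensor_f0_right {X X' Y Y' : MF W} (f : Hom X X') (g : Hom Y Y') (x : X.X1) (y : Y.X1) :
    (f.tensor g).f0 (0, bt x y) = (0, bt (f.f1 x) (g.f1 y)) := by simp [Hom.tensor]

/-- A recipe for recognizing the contraction of a map G with the evaluation: the residues of its
even part are enough. -/
theorem IsResEv.homotopic {A Z : MF W} {e : Hom (tensor (dual Z) Z) (unit W)} (h : Z.IsResEv e)
    (G : Hom A (dual Z)) {e' : Hom (tensor A Z) (unit W)}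
    (h0 : ∀ a z, mu (e'.f0 (bt a z, 0)) = Res W ((G.f0 a : BDual Z.X1) (Z.d0 z)))
    (h1 : ∀ a z, mu (e'.f0 (0, bt a z)) = 0) : Homotopic ((G.tensor (Hom.id Z)).comp e) e' := by
  refine .of_mu_tensor (fun a z => ?_) (fun a z => ?_)
  · rw [h0, ← h.1]
    simp [Hom.comp, Hom.tensor, Hom.id]
  · rw [h1, ← h.2 (G.f1 a) z]
    simp [Hom.comp, Hom.tensor, Hom.id]

end MF

namespace MFbi

variable {W : ℂ[X]} [hW : Fact (0 < W.natDegree)]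

theorem whiskerLeft_whiskerRight_ev {A X : MFbi W} {Z : MatFact W} (F : MF.Hom A.toMF X.toMF.dual)
    (g : MF.Hom Z.toMF X.toMF) (e : MF.Hom (A.toMF.tensor Z.toMF) (MF.unit W))
    (h0 : ∀ a z, mu (e.f0 (bt a z, 0)) = Res W ((F.f0 a : BDual X.toMF.X1) (g.f1 (Z.toMF.d0 z))))
    (h1 : ∀ a z, mu (e.f0 (0, bt a z)) = 0) :
    A ◁ (cls g : Z.toMFbi ⟶ X) ≫ (cls F : A ⟶ dual X) ▷ X ≫ ev X =
      cls (X := tens (tensorClosed hW.out) A Z.toMFbi) (Y := one W) e := by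
  rw [whisker_exchange_assoc, whiskerLeft_ev, ← comp_whiskerRight_assoc]
  exact cls_eq ((Z.exists_ev hW.out).choose_spec.isResEv.homotopic (F.comp g.dual) h0 h1)

/-- A description of the contraction of a morphism `A → X^∨` with the evaluation. -/
theorem whiskerRight_ev {A X : MFbi W} (F : MF.Hom A.toMF X.toMF.dual)
    (e : MF.Hom (A.toMF.tensor X.toMF) (MF.unit W))
    (h0 : ∀ a x, mu (e.f0 (bt a x, 0)) = Res W ((F.f0 a : BDual X.toMF.X1) (X.toMF.d0 x)))
    (h1 : ∀ a x, mu (e.f0 (0, bt a x)) = 0) :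
    (cls F : A ⟶ dual X) ▷ X ≫ ev X =
      cls (X := tens (tensorClosed hW.out) A X) (Y := one W) e := by
  obtain ⟨g, hg⟩ : ∃ g : MF.Hom X.model.toMF X.toMF, (cls g : X.model.toMFbi ⟶ X) = X.toModel.inv :=
    exists_cls X.toModel.inv
  -- The residue description of the evaluation is available on matrix objects, so everything is
  -- pulled back along the isomorphism from the model.
  rw [← cancel_epi (A ◁ X.toModel.inv), ← hg,
    whiskerLeft_whiskerRight_ev F g (((MF.Hom.id A.toMF).tensor g).comp e)]
  · rfl
  · intro a z
    rw [← g.comm0_apply, ← h0]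
    exact congrArg (fun t => mu (e.f0 t)) (MF.Hom.tensor_f0_left (MF.Hom.id A.toMF) g a z)
  · intro a z
    rw [← h1 a (g.f1 z)]
    exact congrArg (fun t => mu (e.f0 t)) (MF.Hom.tensor_f0_right (MF.Hom.id A.toMF) g a z)

/-- Maps into a dual are determined by residues of their even part. -/
theorem cls_eq_of_Res {A X : MFbi W} (F G : MF.Hom A.toMF X.toMF.dual)
    (h : ∀ a x, Res W ((F.f0 a : BDual X.toMF.X1) (X.toMF.d0 x)) =
      Res W ((G.f0 a : BDual X.toMF.X1) (X.toMF.d0 x))) :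
    (cls F : A ⟶ dual X) = cls G := by
  refine PivotalCat.evaluation_injective (pairing X) ?_
  show cls F ▷ X ≫ ev X = cls G ▷ X ≫ ev X
  obtain ⟨g, hg⟩ : ∃ g : MF.Hom X.model.toMF X.toMF, (cls g : X.model.toMFbi ⟶ X) = X.toModel.inv :=
    exists_cls X.toModel.inv
  have he := (X.model.exists_ev hW.out).choose_spec.isResEv
  let e := ((G.comp g.dual).tensor (MF.Hom.id X.model.toMF)).comp (X.model.exists_ev hW.out).choose
  have h0 : ∀ a z, mu (e.f0 (bt a z, 0)) =
      Res W ((G.f0 a : BDual X.toMF.X1) (g.f1 (X.model.toMF.d0 z))) := fun a z => by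
    refine Eq.trans ?_ (he.1 (dualMap g.f1 (G.f0 a)) z)
    exact congrArg (fun t => mu ((X.model.exists_ev hW.out).choose.f0 t))
      (MF.Hom.tensor_f0_left (G.comp g.dual) (MF.Hom.id X.model.toMF) a z)
  have h1 : ∀ a z, mu (e.f0 (0, bt a z)) = 0 := fun a z => by
    refine Eq.trans ?_ (he.2 (dualMap g.f0 (G.f1 a)) z)
    exact congrArg (fun t => mu ((X.model.exists_ev hW.out).choose.f0 t))
      (MF.Hom.tensor_f0_right (G.comp g.dual) (MF.Hom.id X.model.toMF) a z)
  rw [← cancel_epi (A ◁ X.toModel.inv), ← hg, whiskerLeft_whiskerRight_ev F g e _ h1,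
    whiskerLeft_whiskerRight_ev G g e h0 h1]
  intro a z
  rw [h0, ← g.comm0_apply, h]

/-- Contracted with the evaluation, ν⁰ must become the right unitor of I. The residue to compare is
that of σ(u) dd(W) v, and the reproducing property of the difference quotient of W gives μ(u v). -/
theorem nu0_hom : (duality W).nu0.hom = cls (X := one W) (Y := dual (one W)) (MF.unitDual W) := by
  refine PivotalCat.evaluation_injective (pairing (one W)) ((duality W).nu0_hom_ev.trans ?_)
  refine (whiskerRight_ev (A := one W) (X := one W) (MF.unitDual W) (MF.unit W).rightUnitor
    (fun (u v : Bi) => ?_) (fun (u v : Bi) => ?_)).symm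
  · show mu (inr (mu v) * u + 0) = Res W (sig u * (dd W * v))
    rw [mul_left_comm, Res_dd_mul hW.out, add_zero, map_mul mu, map_mul mu, mu_inr, mu_sig, mul_comm]
  · show mu (BT.rUnit Bi 0 + 0) = 0
    rw [map_zero, add_zero, map_zero]

end MFbi

end MFBi

/-! ### Nested evaluations on tensor products -/

namespace MFBi

namespace MF

variable {W : ℂ[X]} {U V Z Z' : MF W}

/-- The contraction of `V ⊗ U` with `Z ⊗ Z'` by pairings of `U` with `Z` and of `V` with `Z'`. -/
def nested (e : Hom (tensor U Z) (unit W)) (e' : Hom (tensor V Z') (unit W)) :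
    Hom (tensor (tensor V U) (tensor Z Z')) (unit W) :=
  (assocHom V U (tensor Z Z')).comp (((Hom.id V).tensor (assocInv U Z Z')).comp
    (((Hom.id V).tensor (e.tensor (Hom.id Z'))).comp
      (((Hom.id V).tensor (leftUnitor Z')).comp e')))

variable (e : Hom (tensor U Z) (unit W)) (e' : Hom (tensor V Z') (unit W))

theorem nested_00_00 (v : V.X0) (u : U.X0) (z : Z.X0) (z' : Z'.X0) :
    (nested e e').f0 (bt (bt v u, 0) (bt z z', 0), 0) =
      e'.f0 (bt v (inl (mu (e.f0 (bt u z, 0))) • z'), 0) := by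
  simp [nested, Hom.comp, Hom.tensor, Hom.id, assocHom, assocInv, assocFwd, assocBwd, leftUnitor,
    bt_zero_left, bt_zero_right]

theorem nested_00_11 (v : V.X0) (u : U.X0) (z : Z.X1) (z' : Z'.X1) :
    (nested e e').f0 (bt (bt v u, 0) (0, bt z z'), 0) = 0 := by
  simp [nested, Hom.comp, Hom.tensor, Hom.id, assocHom, assocInv, assocFwd, assocBwd, leftUnitor,
    bt_zero_left, bt_zero_right]
  exact map_zero e'.f0

theorem nested_11 (v : V.X1) (u : U.X1) (b) :
    ∃ t, (nested e e').f0 (bt (0, bt v u) b, 0) = e'.f0 (0, t) := by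
  simp [nested, Hom.comp, Hom.tensor, Hom.id, assocHom, assocInv, assocFwd, assocBwd, leftUnitor,
    bt_zero_left]
  exact ⟨_, rfl⟩

theorem nested_10 (v : V.X1) (u : U.X0) (b) :
    ∃ t, (nested e e').f0 (0, bt (bt v u, 0) b) = e'.f0 (0, t) := by
  simp [nested, Hom.comp, Hom.tensor, Hom.id, assocHom, assocInv, assocFwd, assocBwd, leftUnitor,
    bt_zero_left]
  exact ⟨_, rfl⟩

theorem nested_01_10 (v : V.X0) (u : U.X1) (z : Z.X1) (z' : Z'.X0) :
    (nested e e').f0 (0, bt (0, bt v u) (bt z z', 0)) =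
      e'.f0 (bt v (inl (mu (e.f0 (0, bt u z))) • z'), 0) := by
  simp [nested, Hom.comp, Hom.tensor, Hom.id, assocHom, assocInv, assocFwd, assocBwd, leftUnitor,
    bt_zero_left, bt_zero_right]

theorem nested_01_01 (v : V.X0) (u : U.X1) (z : Z.X0) (z' : Z'.X1) :
    (nested e e').f0 (0, bt (0, bt v u) (0, bt z z')) = 0 := by
  simp [nested, Hom.comp, Hom.tensor, Hom.id, assocHom, assocInv, assocFwd, assocBwd, leftUnitor,
    bt_zero_left, bt_zero_right]
  exact map_zero e'.f0

/-- Biadditive maps on direct sums of tensor products agree if they agree on pure tensors. -/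
theorem biadd_ext {A B A' B' C D C' D' Q : Type} [AddCommGroup A] [Module Bi A] [AddCommGroup A']
    [Module Bi A'] [AddCommGroup B] [Module Bi B] [AddCommGroup B'] [Module Bi B']
    [AddCommGroup C] [Module Bi C] [AddCommGroup C'] [Module Bi C'] [AddCommGroup D] [Module Bi D]
    [AddCommGroup D'] [Module Bi D'] [AddCommGroup Q]
    {f g : (BT A B × BT A' B') →+ (BT C D × BT C' D') →+ Q}
    (h00 : ∀ a b c d, f (bt a b, 0) (bt c d, 0) = g (bt a b, 0) (bt c d, 0))
    (h01 : ∀ a b c d, f (bt a b, 0) (0, bt c d) = g (bt a b, 0) (0, bt c d))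
    (h10 : ∀ a b c d, f (0, bt a b) (bt c d, 0) = g (0, bt a b) (bt c d, 0))
    (h11 : ∀ a b c d, f (0, bt a b) (0, bt c d) = g (0, bt a b) (0, bt c d)) (s t) :
    f s t = g s t := by
  have add : ∀ s t t', f s t = g s t → f s t' = g s t' → f s (t + t') = g s (t + t') :=
    fun s t t' h h' => by rw [map_add, map_add, h, h']
  refine BT.prod_induction (p := fun s => ∀ t, f s t = g s t)
    (fun a b => BT.prod_induction (fun c d => h00 a b c d) (fun c d => h01 a b c d) (add _))
    (fun a b => BT.prod_induction (fun c d => h10 a b c d) (fun c d => h11 a b c d) (add _))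
    (fun s s' h h' t => ?_) s t
  rw [map_add, map_add, AddMonoidHom.add_apply, AddMonoidHom.add_apply, h, h']

variable {e e'}

theorem mu_f0_add {P Q : MF W} (n : Hom (tensor P Q) (unit W)) (s t : BT P.X0 Q.X0) :
    mu (n.f0 (s + t, 0)) = mu (n.f0 (s, 0)) + mu (n.f0 (t, 0)) := by
  refine Eq.trans ?_ (map_add mu _ _)
  refine congrArg mu (Eq.trans ?_ (map_add n.f0 _ _))
  rw [Prod.mk_add_mk, add_zero]

theorem mu_f0_add' {P Q : MF W} (n : Hom (tensor P Q) (unit W)) (s t : BT P.X1 Q.X1) :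
    mu (n.f0 (0, s + t)) = mu (n.f0 (0, s)) + mu (n.f0 (0, t)) := by
  refine Eq.trans ?_ (map_add mu _ _)
  refine congrArg mu (Eq.trans ?_ (map_add n.f0 _ _))
  rw [Prod.mk_add_mk, add_zero]

variable {X Y : MF W} {e : Hom (tensor (dual X) Z) (unit W)} {e' : Hom (tensor (dual Y) Z') (unit W)}
  {f : Hom Z X} {g : Hom Z' Y}

/-- The inner evaluation inserts a one-variable residue as a scalar before the outer one is taken;
`Res_star` rewrites this as a single residue of a middle residue. On the remaining three pairs of
summands both sides vanish. -/
theorem mu_nested_even (hW : 0 < W.natDegree)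
    (he : ∀ (φ : BDual X.X1) z, mu (e.f0 (bt φ z, 0)) = Res W (φ (X.d0 (f.f0 z))))
    (he' : ∀ (ψ : BDual Y.X1) z, mu (e'.f0 (bt ψ z, 0)) = Res W (ψ (Y.d0 (g.f0 z))))
    (hz' : ∀ t, mu (e'.f0 (0, t)) = 0) (a b) :
    mu ((nested e e').f0 (bt a b, 0)) =
      Res W ((((dualTensorHom hW X Y).comp (f.tensor g).dual).f0 a : BDual (tensor Z Z').X1)
        ((tensor Z Z').d0 b)) := by
  let F : (tensor (dual Y) (dual X)).X0 →+ (tensor Z Z').X0 →+ ℂ[X] :=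
    mkBi (fun a b => mu ((nested e e').f0 (bt a b, 0)))
      (fun a a' b => by rw [bt_add_left, mu_f0_add]) (fun a b b' => by rw [bt_add_right, mu_f0_add])
  let G : (tensor (dual Y) (dual X)).X0 →+ (tensor Z Z').X0 →+ ℂ[X] :=
    mkBi (fun a b => Res W ((dualTensorEven X Y a : BDual (tensor X Y).X1)
        ((tensor X Y).d0 ((f.tensor g).f0 b))))
      (fun a a' b => by rw [map_add, BDual.add_apply, map_add])
      (fun a b b' => by rw [map_add, map_add, map_add, map_add])
  have h : F a b = G a b := by
    refine biadd_ext (fun ψ φ z z' => ?_) (fun ψ φ z z' => ?_) (fun ψ φ z z' => ?_)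
      (fun ψ φ z z' => ?_) a b
    · show mu ((nested e e').f0 (bt (bt ψ φ, 0) (bt z z', 0), 0)) =
        Res W ((dualTensorEven X Y (bt ψ φ, 0) : BDual (tensor X Y).X1)
          ((tensor X Y).d0 ((f.tensor g).f0 (bt z z', 0))))
      rw [nested_00_00, he', he, map_smul, map_smul, map_smul, smul_eq_mul, Hom.tensor_f0_left,
        tensor_d0_left]
      exact (Res_star hW _ _).symm
    · show mu ((nested e e').f0 (bt (bt ψ φ, 0) (0, bt z z'), 0)) =
        Res W ((dualTensorEven X Y (bt ψ φ, 0) : BDual (tensor X Y).X1)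
          ((tensor X Y).d0 ((f.tensor g).f0 (0, bt z z'))))
      rw [nested_00_11, Hom.tensor_f0_right, tensor_d0_right]
      refine (map_zero mu).trans (Eq.trans (map_zero (Res W)).symm (congrArg _ ?_))
      show 0 = star W (φ (f.f1 z)) (ψ (Y.d0 (-Y.d1 (g.f1 z'))))
      rw [map_neg, map_neg, star_neg_right, dualTensor_pot' hW, neg_zero]
    · show mu ((nested e e').f0 (bt (0, bt ψ φ) (bt z z', 0), 0)) =
        Res W ((dualTensorEven X Y (0, bt ψ φ) : BDual (tensor X Y).X1)
          ((tensor X Y).d0 ((f.tensor g).f0 (bt z z', 0))))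
      obtain ⟨t, ht⟩ := nested_11 e e' ψ φ (bt z z', 0)
      rw [ht, hz', dualTensorEven_zero_left]
      exact (map_zero (Res W)).symm
    · show mu ((nested e e').f0 (bt (0, bt ψ φ) (0, bt z z'), 0)) =
        Res W ((dualTensorEven X Y (0, bt ψ φ) : BDual (tensor X Y).X1)
          ((tensor X Y).d0 ((f.tensor g).f0 (0, bt z z'))))
      obtain ⟨t, ht⟩ := nested_11 e e' ψ φ (0, bt z z')
      rw [ht, hz', dualTensorEven_zero_left]
      exact (map_zero (Res W)).symm
  refine h.trans ?_
  show Res W ((dualTensorEven X Y a : BDual (tensor X Y).X1)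
    ((tensor X Y).d0 ((f.tensor g).f0 b))) = _
  rw [Hom.comm0_apply]
  rfl

theorem mu_nested_odd (hz : ∀ t, mu (e.f0 (0, t)) = 0) (hz' : ∀ t, mu (e'.f0 (0, t)) = 0) (a b) :
    mu ((nested e e').f0 (0, bt a b)) = 0 := by
  let F : (tensor (dual Y) (dual X)).X1 →+ (tensor Z Z').X1 →+ ℂ[X] :=
    mkBi (fun a b => mu ((nested e e').f0 (0, bt a b)))
      (fun a a' b => by rw [bt_add_left, mu_f0_add']) (fun a b b' => by rw [bt_add_right, mu_f0_add'])
  refine biadd_ext (f := F) (g := 0) (fun ψ φ z z' => ?_) (fun ψ φ z z' => ?_) (fun ψ φ z z' => ?_)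
      (fun ψ φ z z' => ?_) a b
  · obtain ⟨t, ht⟩ := nested_10 e e' ψ φ (bt z z', 0)
    exact (congrArg mu ht).trans (hz' t)
  · obtain ⟨t, ht⟩ := nested_10 e e' ψ φ (0, bt z z')
    exact (congrArg mu ht).trans (hz' t)
  · refine (congrArg mu (nested_01_10 e e' ψ φ z z')).trans ?_
    rw [hz, map_zero, zero_smul, bt_zero_right]
    exact hz' 0
  · exact (congrArg mu (nested_01_01 e e' ψ φ z z')).trans (map_zero mu)

theorem IsResEv.comp_dual {e : Hom (tensor (dual Z) Z) (unit W)} (h : Z.IsResEv e) (f : Hom Z X) :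
    (∀ (φ : BDual X.X1) z, mu (((f.dual.tensor (Hom.id Z)).comp e).f0 (bt φ z, 0)) =
      Res W (φ (X.d0 (f.f0 z)))) ∧
    ∀ t, mu (((f.dual.tensor (Hom.id Z)).comp e).f0 (0, t)) = 0 := by
  refine ⟨fun φ z => ?_, fun t => ?_⟩
  · rw [f.comm0_apply]
    exact (congrArg (fun t => mu (e.f0 t)) (Hom.tensor_f0_left f.dual (Hom.id Z) φ z)).trans (h.1 _ _)
  · induction t using BT.induction with
    | h0 => exact (congrArg mu (map_zero _)).trans (map_zero mu)
    | h1 φ z =>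
      exact (congrArg (fun t => mu (e.f0 t)) (Hom.tensor_f0_right f.dual (Hom.id Z) φ z)).trans
        (h.2 _ _)
    | h2 s t hs ht => rw [mu_f0_add', hs, ht, add_zero]

end MF

end MFBi

namespace PivotalCat

variable {C : Type*} [Category C] [MonoidalCategory C]

/-- Lets the nested contraction for X and Y be computed on their matrix models, with the maps i and
j absorbed into the pairings. -/
theorem nested_naturality {U V X Y Z Z' : C} (e : U ⊗ X ⟶ 𝟙_ C) (e' : V ⊗ Y ⟶ 𝟙_ C) (i : Z ⟶ X)
    (j : Z' ⟶ Y) :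
    (V ⊗ U) ◁ (i ⊗ₘ j) ≫ (α_ V U (X ⊗ Y)).hom ≫ V ◁ (α_ U X Y).inv ≫ V ◁ (e ▷ Y) ≫
      V ◁ (λ_ Y).hom ≫ e' =
    (α_ V U (Z ⊗ Z')).hom ≫ V ◁ (α_ U Z Z').inv ≫ V ◁ ((U ◁ i ≫ e) ▷ Z') ≫ V ◁ (λ_ Z').hom ≫
      V ◁ j ≫ e' := by
  have h : ((U ◁ i ≫ e) ▷ Z') ≫ (λ_ Z').hom ≫ j =
      (U ◁ i) ▷ Z' ≫ (U ⊗ X) ◁ j ≫ e ▷ Y ≫ (λ_ Y).hom := by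
    rw [← leftUnitor_naturality, comp_whiskerRight, Category.assoc, whisker_exchange_assoc]
  have h' : V ◁ ((U ◁ i ≫ e) ▷ Z') ≫ V ◁ (λ_ Z').hom ≫ V ◁ j ≫ e' =
      V ◁ ((U ◁ i) ▷ Z' ≫ (U ⊗ X) ◁ j ≫ e ▷ Y ≫ (λ_ Y).hom) ≫ e' := by
    rw [← h]; simp
  rw [h', MonoidalCategory.tensorHom_def]
  monoidal

end PivotalCat

namespace MFBi

namespace MFbi

variable {W : ℂ[X]} [hW : Fact (0 < W.natDegree)]

/-- The morphism `Y^∨ ⊗ X^∨ → (X ⊗ Y)^∨`. -/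
def nuHom (X Y : MFbi W) : dual Y ⊗ dual X ⟶ dual (X ⊗ Y) :=
  cls (X := tens (tensorClosed hW.out) (dual Y) (dual X))
    (Y := dual (tens (tensorClosed hW.out) X Y)) (MF.dualTensorHom hW.out X.toMF Y.toMF)

/-- Both maps have the same contraction with the evaluation of X ⊗ Y: for ν² it is the nested
evaluation, and `mu_nested_even` matches it, on the models of X and Y, with the explicit formula. -/
theorem nu2_hom (X Y : MFbi W) : ((duality W).nu2 Y X).hom = nuHom X Y := by
  refine PivotalCat.evaluation_injective (pairing (X ⊗ Y)) (((duality W).nu2_hom_ev Y X).trans ?_)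
  show (α_ (dual Y) (dual X) (X ⊗ Y)).hom ≫ dual Y ◁ (α_ (dual X) X Y).inv ≫ dual Y ◁ (ev X ▷ Y) ≫
      dual Y ◁ (λ_ Y).hom ≫ ev Y = nuHom X Y ▷ (X ⊗ Y) ≫ ev (X ⊗ Y)
  obtain ⟨f, hf⟩ : ∃ g : MF.Hom X.model.toMF X.toMF, (cls g : X.model.toMFbi ⟶ X) = X.toModel.inv :=
    exists_cls X.toModel.inv
  obtain ⟨g, hg⟩ : ∃ g : MF.Hom Y.model.toMF Y.toMF, (cls g : Y.model.toMFbi ⟶ Y) = Y.toModel.inv :=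
    exists_cls Y.toModel.inv
  rw [← cancel_epi ((dual Y ⊗ dual X) ◁ (X.toModel.inv ⊗ₘ Y.toModel.inv)),
    PivotalCat.nested_naturality, whiskerLeft_ev, whiskerLeft_ev,
    whisker_exchange_assoc (nuHom X Y), ← ev_dinatural, ← comp_whiskerRight_assoc, ← hf, ← hg]
  have h := (X.model.exists_ev hW.out).choose_spec.isResEv
  have h' := (Y.model.exists_ev hW.out).choose_spec.isResEv
  let e := (f.dual.tensor (MF.Hom.id X.model.toMF)).comp (X.model.exists_ev hW.out).choose
  let e' := (g.dual.tensor (MF.Hom.id Y.model.toMF)).comp (Y.model.exists_ev hW.out).choose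
  have he := h.comp_dual f
  have he' := h'.comp_dual g
  exact (whiskerRight_ev (A := dual Y ⊗ dual X) (X := X.model.toMFbi ⊗ Y.model.toMFbi)
    ((MF.dualTensorHom hW.out X.toMF Y.toMF).comp (f.tensor g).dual) (MF.nested e e')
    (MF.mu_nested_even hW.out he.1 he'.1 he'.2) (MF.mu_nested_odd he.2 he'.2)).symm

end MFbi

end MFBi

/-! ### The canonical map δ is pivotal -/

namespace MFBi

theorem bidual_bijective (n : ℕ) : Function.Bijective (bidual (Fin n → Bi)) := by
  refine ⟨fun m m' h => funext fun i => ?_, fun Ξ => ⟨fun i => sig (Ξ (coord i)), ?_⟩⟩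
  · have hi := congrArg sig (DFunLike.congr_fun h (coord i))
    rwa [bidual_apply, bidual_apply, sig_sig, sig_sig] at hi
  · refine BDual.ext fun φ => ?_
    have h : ∀ φ : BDual (Fin n → Bi), φ = ∑ l, sig (φ (Pi.single l 1)) • coord l :=
      fun φ => (MatFact.sum_coord φ).symm
    rw [h φ, map_sum, map_sum]
    refine Finset.sum_congr rfl fun l _ => ?_
    rw [map_smul, map_smul, bidual_apply]
    exact congrArg (sig (φ (Pi.single l 1)) • ·) (sig_sig _)

namespace MF

variable {W : ℂ[X]}

/-- The two composites `X ⊗ Y → (Y^∨ ⊗ X^∨)^∨` have the same residues. -/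
theorem Res_delta_dualTensor (hW : 0 < W.natDegree) (X Y : MF W) (a : (tensor X Y).X0)
    (q : (tensor (dual Y) (dual X)).X0) :
    Res W ((((delta X).tensor (delta Y)).comp (dualTensorHom hW (dual Y) (dual X))).f0 a
        |> fun t : BDual (tensor (dual Y) (dual X)).X1 => t ((tensor (dual Y) (dual X)).d0 q)) =
      Res W (((delta (tensor X Y)).comp (dualTensorHom hW X Y).dual).f0 a
        |> fun t : BDual (tensor (dual Y) (dual X)).X1 => t ((tensor (dual Y) (dual X)).d0 q)) := by
  let F : (tensor X Y).X0 →+ (tensor (dual Y) (dual X)).X0 →+ ℂ[X] :=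
    mkBi (fun a q => Res W ((dualTensorEven (dual Y) (dual X) (((delta X).tensor (delta Y)).f0 a) :
        BDual (tensor (dual Y) (dual X)).X1) ((tensor (dual Y) (dual X)).d0 q)))
      (fun a a' q => by rw [map_add, map_add, BDual.add_apply, map_add])
      (fun a q q' => by rw [map_add, map_add, map_add])
  let G : (tensor X Y).X0 →+ (tensor (dual Y) (dual X)).X0 →+ ℂ[X] :=
    mkBi (fun a q => Res W (sig ((dualTensorOdd X Y ((tensor (dual Y) (dual X)).d0 q) :
        BDual (tensor X Y).X0) a)))
      (fun a a' q => by rw [map_add, map_add, map_add])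
      (fun a q q' => by rw [map_add, map_add, BDual.add_apply, map_add, map_add])
  show F a q = G a q
  refine biadd_ext (fun x y ψ φ => ?_) (fun x y ψ φ => ?_) (fun x y ψ φ => ?_)
    (fun x y ψ φ => ?_) a q
  -- The only pair of summands on which the two sides are not both zero.
  · exact Res_star_sig hW (φ (X.d0 x)) (ψ (Y.d0 y))
  · show Res W ((dualTensorEven (dual Y) (dual X) (((delta X).tensor (delta Y)).f0 (bt x y, 0)) :
        BDual (tensor (dual Y) (dual X)).X1) ((tensor (dual Y) (dual X)).d0 (0, bt ψ φ))) =
      Res W (sig ((dualTensorOdd X Y ((tensor (dual Y) (dual X)).d0 (0, bt ψ φ)) :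
        BDual (tensor X Y).X0) (bt x y, 0)))
    rw [Hom.tensor_f0_left, tensor_d0_right]
    refine congrArg (Res W) ((?_ : _ = (0 : Bi)).trans (?_ : (0 : Bi) = _))
    · show star W (sig (ψ y)) (bidual X.X0 x ((dual X).d0 (-(dual X).d1 φ))) = 0
      rw [map_neg, map_neg, star_neg_right, d0_d1_apply, map_smul, smul_eq_mul, star_pot_mul hW,
        neg_zero]
    · show 0 = sig (star W (φ x) (dualMap Y.d1 (-ψ) (Y.d0 y)))
      rw [dualTensor_pot hW, map_zero]
  · show Res W ((dualTensorEven (dual Y) (dual X) (((delta X).tensor (delta Y)).f0 (0, bt x y)) :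
        BDual (tensor (dual Y) (dual X)).X1) ((tensor (dual Y) (dual X)).d0 (bt ψ φ, 0))) =
      Res W (sig ((dualTensorOdd X Y ((tensor (dual Y) (dual X)).d0 (bt ψ φ, 0)) :
        BDual (tensor X Y).X0) (0, bt x y)))
    rw [Hom.tensor_f0_right, dualTensorEven_zero_left]
    exact congrArg (Res W) ((map_zero sig).symm.trans
      (congrArg sig (dualTensorOdd_zero_right X Y _ _).symm))
  · show Res W ((dualTensorEven (dual Y) (dual X) (((delta X).tensor (delta Y)).f0 (0, bt x y)) :
        BDual (tensor (dual Y) (dual X)).X1) ((tensor (dual Y) (dual X)).d0 (0, bt ψ φ))) =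
      Res W (sig ((dualTensorOdd X Y ((tensor (dual Y) (dual X)).d0 (0, bt ψ φ)) :
        BDual (tensor X Y).X0) (0, bt x y)))
    rw [Hom.tensor_f0_right, dualTensorEven_zero_left]
    exact congrArg (Res W) ((map_zero sig).symm.trans
      (congrArg sig (dualTensorOdd_zero_right X Y _ _).symm))

theorem delta_comp_unitDual_dual (W : ℂ[X]) :
    (delta (unit W)).comp (unitDual W).dual = unitDual W := by
  have h : dualMap toDual ∘ₗ bidual Bi = toDual := LinearMap.ext fun u => BDual.ext fun v => by
    show sig (sig v * u) = sig u * v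
    rw [map_mul sig, sig_sig, mul_comm]
  exact Hom.ext h h

end MF

namespace MFbi

variable {W : ℂ[X]}

theorem delta_natural {X Y : MFbi W} (f : X ⟶ Y) :
    delta X ≫ dualHom (dualHom f) = f ≫ delta Y := by
  obtain ⟨f, rfl⟩ := exists_cls f
  rfl

/-- Free modules of finite rank are reflexive, so δ is bijective on a matrix object and needs no
homotopy to be inverted there; naturality transports this to X. -/
theorem delta_isIso (X : MFbi W) : IsIso (delta X) := by
  obtain ⟨Z, ⟨ϑ⟩⟩ := exists_iso X
  have hZ : IsIso (delta Z.toMFbi) := by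
    have b0 := bidual_bijective Z.n0
    have b1 := bidual_bijective Z.n1
    refine isIso_cls (MF.Hom.exists_inverse (MF.delta Z.toMF) 0 0 b0.2 b1.2 (LinearMap.comp_zero _)
      (LinearMap.comp_zero _) (fun x hx => ?_) (fun x hx => ?_))
    · rw [b0.1 (hx.trans (map_zero (bidual _)).symm)]; simp
    · rw [b1.1 (hx.trans (map_zero (bidual _)).symm)]; simp
  have : delta X = ϑ.hom ≫ delta Z.toMFbi ≫ (dualIso (dualIso ϑ)).inv := by
    rw [← Category.assoc, ← delta_natural, Category.assoc]
    show delta X = delta X ≫ (dualIso (dualIso ϑ)).hom ≫ _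
    rw [Iso.hom_inv_id, Category.comp_id]
  rw [this]
  infer_instance

variable [hW : Fact (0 < W.natDegree)]

/-- Both sides are maps into a dual, so residues of their even parts decide, even though the
representatives need not coincide. -/
theorem delta_tensor_nuHom (X Y : MFbi W) :
    (delta X ⊗ₘ delta Y) ≫ nuHom (dual Y) (dual X) = delta (X ⊗ Y) ≫ dualHom (nuHom X Y) :=
  cls_eq_of_Res (A := X ⊗ Y) (X := dual Y ⊗ dual X)
    (((MF.delta X.toMF).tensor (MF.delta Y.toMF)).comp
      (MF.dualTensorHom hW.out (MF.dual Y.toMF) (MF.dual X.toMF)))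
    ((MF.delta (MF.tensor X.toMF Y.toMF)).comp (MF.dualTensorHom hW.out X.toMF Y.toMF).dual)
    (MF.Res_delta_dualTensor hW.out X.toMF Y.toMF)

/-- A relation of the form `f = g ≫ e^∨` for an isomorphism `e`, solved for `g`. -/
theorem comp_map_inv_eq {A X Y : MFbi W} (e : X ≅ Y) {f : A ⟶ dual X} {g : A ⟶ dual Y}
    (h : f = g ≫ dualHom e.hom) : f ≫ (duality W).map e.inv = g := by
  refine (congrArg (f ≫ ·) (map_eq_dualHom e.inv)).trans ?_
  rw [h]
  exact (Category.assoc _ _ _).trans ((congrArg (g ≫ ·) (dualIso e).inv_hom_id).trans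
    (Category.comp_id g))

theorem delta_comp_dualHom_nu0 :
    (duality W).nu0.hom = delta (one W) ≫ dualHom (duality W).nu0.hom := by
  rw [nu0_hom]
  exact (congrArg cls (MF.delta_comp_unitDual_dual W)).symm

/-- For the monoidal axioms the inverse of ν inside ω is moved to the other side, which leaves
identities between explicit representatives. -/
theorem isPivotal : (duality W).IsPivotal fun X => delta X where
  isIso := delta_isIso
  natural f := by
    rw [map_eq_dualHom, map_eq_dualHom]
    exact delta_natural f
  tensor X Y := by
    have h : (delta X ⊗ₘ delta Y) ≫ ((duality W).nu2 (dual X) (dual Y)).hom =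
        delta (X ⊗ Y) ≫ dualHom ((duality W).nu2 Y X).hom :=
      ((congrArg ((delta X ⊗ₘ delta Y) ≫ ·) (nu2_hom (dual Y) (dual X))).trans
        (delta_tensor_nuHom X Y)).trans
        (congrArg (fun t => delta (X ⊗ Y) ≫ dualHom t) (nu2_hom X Y).symm)
    exact (Category.assoc _ _ _).symm.trans (comp_map_inv_eq _ h)
  unit := (comp_map_inv_eq (duality W).nu0 (delta_comp_dualHom_nu0 (W := W))).symm

end MFbi

/-- If `R / (W')` is finite-dimensional then `W` is not constant. -/
theorem natDegree_pos_of_finite (W : ℂ[X])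
    (hW : Module.Finite ℂ (ℂ[X] ⧸ Ideal.span {Polynomial.derivative W})) : 0 < W.natDegree := by
  refine Nat.pos_of_ne_zero fun h => Polynomial.not_finite (R := ℂ) ?_
  rw [Polynomial.derivative_of_natDegree_zero h] at hW
  have e : (ℂ[X] ⧸ Ideal.span {(0 : ℂ[X])}) ≃ₐ[ℂ] ℂ[X] :=
    (Ideal.quotientEquivAlgOfEq ℂ Ideal.span_singleton_zero).trans (AlgEquiv.quotientBot ℂ ℂ[X])
  exact Module.Finite.equiv e.toLinearEquiv

end MFBi

end

open MFBi PivotalCat in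
theorem theorem2p11 (W : ℂ[X])
    (hW : Module.Finite ℂ (ℂ[X] ⧸ Ideal.span {Polynomial.derivative W})) :
    ∃ (hT : MFbi.TensorClosed W)
      (hL : ∀ X : MFbi W, IsIso (MFbi.lam hT X))
      (hR : ∀ X : MFbi W, IsIso (MFbi.rho hT X))
      (hM : @MonoidalLaws (MFbi W) _ (MFbi.monStruct hT hL hR)),
      letI : MonoidalCategory (MFbi W) :=
        @MonoidalLaws.toMonoidalCategory _ _ (MFbi.monStruct hT hL hR) hM
      ∃ p : ∀ X : MFbi W, ExactPairing X (MFbi.dual X),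
        let D : RightDuality (MFbi W) := ⟨MFbi.dual, p⟩
        (∀ X : MFbi W, MFbi.IsCoev hT X (D.coev X)) ∧
        (∀ X : MFbi W, MFbi.IsEv hT X (D.ev X)) ∧
        (∀ (X Y : MFbi W) (f : X ⟶ Y), D.map f = MFbi.dualHom f) ∧
        D.IsPivotal (fun X => MFbi.delta X) := by
  have : Fact (0 < W.natDegree) := ⟨natDegree_pos_of_finite W hW⟩
  exact ⟨MFbi.tensorClosed Fact.out, MFbi.lam_isIso _, MFbi.rho_isIso _, MFbi.monoidalLaws _ _ _,
    MFbi.pairing, MFbi.isCoev, MFbi.isEv, fun _ _ => MFbi.map_eq_dualHom, MFbi.isPivotal⟩
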